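/- Fix an integer $n\ge 3$. Let $\mathcal H_{reg}=\{u\in[0,1)^n : u_1>\dots>u_n\}$, and $\tilde u=(1-u_n,\dots,1-u_1)$, $|u|=\sum_j|u_j|$ for $u\in\mathbb R^n$. \textbf{Triangular honeycombs.} Let $T\subset\mathbb C$ be the triangle with vertices $0,1,e^{i\pi/3}$; write $v=v_1+v_2e^{i\pi/3}$, $v_0=1-v_1-v_2$, and $\partial_iT=\{v\in T: v_i=0\}$ (indices mod $3$). The angle from a vector $z$ to $z'$ is $\arccos\langle z/\|z\|,z'/\|z'\|\rangle$, defined when $\det(z,z')>0$. A triangular honeycomb $h$ of size $n$ is a finite set of non-trivial segments of $T$, coloured by $c$ with values in $\{0,1,3\}$, such that: (a) if the relative interiors of two distinct segments meet, then, in some order, their colours are $0$ and $1$ and the angle from the first to the second (as unoriented segments) is $\pi/3$; (b) two distinct segments with a common endpoint $v$ leave $v$, in some order, at an angle $2\pi/3$ from the first to the second, with (first, second) colours in $\{(0,0),(1,1),(0,1),(1,3),(3,0)\}$; (c) in the structure graph $G(h)$ (vertices: endpoints; edges: segments; coloured by $c$) all degrees are $1$ or $3$, and the union $t(h)$ of the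 segments meets $\partial T$ exactly in the vertices of degree $1$; (d) every segment $e$ is parallel to $e^{2\pi i(\ell+1)/3}$ for some $\ell=\ell(e)\in\{0,1,2\}$; its height $L(e)$ is the constant value of the coordinate $v_{\ell(e)}$ on $e$; (e) $\#\,t(h)\cap\partial_iT=n$ for each $i$; a segment $e$ with an endpoint on $\partial_iT$ has $c(e)=0,\ \ell(e)=i+1$ or $c(e)=1,\ \ell(e)=i+2$; and the colour is non-decreasing in the $(i+1)$-coordinate of that endpoint along $\partial_iT$. The boundary vertices on $\partial_iT$ are ordered by decreasing $(i+1)$-coordinate. Each vertex $v$ has a sign $s(v)\in\{\pm1\}$ such that every edge $e$ at $v$ lies in $v-s(v)e^{2\pi i(\ell(e)+1)/3}\mathbb R_{\ge0}$. \textbf{Surfaces.} Let $\mathcal T$ be a connected oriented surface obtained from $N$ copies $T^1,\dots,T^N$ of $T$ by gluing some of their sides in pairs, isometrically and reversing orientation, with $p\ge2$ unglued sides $L_1,\dots,L_p$. A honeycomb on $\mathcal T$ is a tuple $h=(h^1,\dots,h^N)$ of triangular honeycombs of size $n$ whose boundary points coincide on any two sides glued together. Its structure graph is obtained from $G(h^1),\dots,G(h^N)$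 by merging the boundary vertices that are identified by the gluing. Let $\mathcal G_{\mathcal T}$ be the set of isomorphism classes of these graphs, as coloured graphs with ordered boundary vertices that are decomposed into the graphs $G_1,\dots,G_N$ of the triangles (that is, of the tuples of isomorphism classes of the coloured graphs $G(h^i)$ with ordered boundary). For $G\in\mathcal G_{\mathcal T}$, let $\mathrm{HONEY}^G_{\mathcal T}(\gamma^1,\dots,\gamma^p)$ be the set of honeycombs on $\mathcal T$ with structure graph $G$ and such that, if $L_j=\partial_{\ell}T^{i}$, the ordered tuple of $(\ell+1)$-coordinates of the points of $t(h^i)$ on $\partial_\ell T$ is $\gamma^j$. \textbf{Volumes.} For a finite graph $G=(V,E)$ let $\Omega^1(G)$ be the space of antisymmetric functions on oriented edges, with $\langle\omega_1,\omega_2\rangle=\sum_{e\in E}\omega_1(e)\omega_2(e)$; for $\phi:V\to\mathbb R$ let $\mathcal F_G(\phi)=\{\omega:\sum_{x\sim v}\omega(v,x)=\phi(v)\ \forall v\}$, and let $\mathrm{Vol}$ be the Lebesgue measure of this Euclidean affine space divided by $\sqrt{\#\{\text{spanning trees of }G\}}$. The flow of a honeycomb $h$ with structure graph $G$ is $\mathcal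 L[h](v,v')=s(v)L(\{v,v'\})$. The set $\mathcal L(\mathrm{HONEY}^G_{\mathcal T}(\gamma^1,\dots,\gamma^p))$ lies in one space $\mathcal F_G(\phi)$, and $\mathrm{Vol}$ of it is taken there. \textbf{Proposition.} Let $\mathcal T'$ be the surface obtained from $\mathcal T$ by gluing $L_{p-1}$ and $L_p$ together (isometrically, reversing orientation). Then for all $\gamma^1,\dots,\gamma^{p-2}\in\mathcal H_{reg}$ with $\sum_{i=1}^{p-2}|\gamma^i|\in\mathbb Z$, the integrand below is a Lebesgue measurable function of $u$ and $$\sum_{G\in\mathcal G_{\mathcal T'}}\mathrm{Vol}\big[\mathcal L(\mathrm{HONEY}^G_{\mathcal T'}(\gamma^1,\dots,\gamma^{p-2}))\big]=\int_{\mathcal H_{reg}}\ \sum_{G\in\mathcal G_{\mathcal T}}\mathrm{Vol}\big[\mathcal L(\mathrm{HONEY}^G_{\mathcal T}(\gamma^1,\dots,\gamma^{p-2},u,\tilde u))\big]\,du,$$ where $du$ is the Lebesgue measure on $\mathbb R^n$ and both sides are elements of $[0,\infty]$. -/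

import Mathlib

open scoped ENNReal

noncomputable section

namespace Honey

/-! ## The set of regular conjugacy classes -/

/-- `𝓗_reg`: strictly decreasing `n`-tuples with entries in `[0, 1)`. -/
def Hreg (n : ℕ) : Set (Fin n → ℝ) :=
  {u | StrictAnti u ∧ ∀ i, 0 ≤ u i ∧ u i < 1}

/-- `ũ = (1 - u_n, …, 1 - u_1)`. -/
def tilde {n : ℕ} (u : Fin n → ℝ) : Fin n → ℝ := fun i => 1 - u i.rev

/-! ## Honeycombs on a domain of the plane

A non-trivial segment is represented by the unordered pair of its (distinct) endpoints. -/

/-- The relative interior of the segment with endpoints `e`. -/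
def segInterior (e : Sym2 ℂ) : Set ℂ :=
  {z | ∃ v w, e = s(v, w) ∧ z ∈ openSegment ℝ v w}

/-- The closed segment with endpoints `e`. -/
def segSet (e : Sym2 ℂ) : Set ℂ :=
  {z | ∃ v w, e = s(v, w) ∧ z ∈ segment ℝ v w}

/-- The angle from the vector `z` to the vector `z'` is `θ`:
`det (z, z') > 0` and `arccos ⟨z / ‖z‖, z' / ‖z'‖⟩ = θ`. -/
def HasAngle (z z' : ℂ) (θ : ℝ) : Prop :=
  0 < z.re * z'.im - z.im * z'.re ∧ InnerProductGeometry.angle z z' = θ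

/-- A (non-degenerate) honeycomb on `S ⊆ ℂ`: a finite set of non-trivial segments of `S`,
coloured by `{0, 1, 3}`. -/
structure Honeycomb (S : Set ℂ) where
  edges : Finset (Sym2 ℂ)
  color : {e // e ∈ edges} → ℕ
  nontrivial : ∀ e ∈ edges, ¬ e.IsDiag
  subset : ∀ e ∈ edges, segSet e ⊆ S
  color_mem : ∀ e, color e ∈ ({0, 1, 3} : Set ℕ)
  /-- Two distinct segments whose interiors meet are, in some order, coloured `0` and `1`,
  and the angle from the (unoriented) first one to the (unoriented) second one is `π / 3`. -/
  crossing : ∀ e e' : {e // e ∈ edges}, e ≠ e' →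
    (segInterior e.1 ∩ segInterior e'.1).Nonempty →
    ∃ f f' : {e // e ∈ edges}, ((f = e ∧ f' = e') ∨ (f = e' ∧ f' = e)) ∧
      color f = 0 ∧ color f' = 1 ∧
      ∃ v w v' w', f.1 = s(v, w) ∧ f'.1 = s(v', w') ∧
        HasAngle (w - v) (w' - v') (Real.pi / 3)
  /-- Two distinct segments with a common endpoint `v` leave `v`, in some order, at an angle
  `2π / 3` and with colours `(0,0), (1,1), (0,1), (1,3)` or `(3,0)` in that order. -/
  vertex : ∀ (v w w' : ℂ) (h : s(v, w) ∈ edges) (h' : s(v, w') ∈ edges), w ≠ w' →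
    (HasAngle (w - v) (w' - v) (2 * Real.pi / 3) ∧
      (color ⟨_, h⟩, color ⟨_, h'⟩) ∈
        ({(0, 0), (1, 1), (0, 1), (1, 3), (3, 0)} : Set (ℕ × ℕ))) ∨
    (HasAngle (w' - v) (w - v) (2 * Real.pi / 3) ∧
      (color ⟨_, h'⟩, color ⟨_, h⟩) ∈
        ({(0, 0), (1, 1), (0, 1), (1, 3), (3, 0)} : Set (ℕ × ℕ)))

namespace Honeycomb

variable {S : Set ℂ}

/-- `t(h)`, the union of the segments of `h`. -/
def support (h : Honeycomb S) : Set ℂ := ⋃ e ∈ h.edges, segSet e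

/-- The vertices of the structure graph: the endpoints of the segments. -/
def verts (h : Honeycomb S) : Set ℂ := {v | ∃ e ∈ h.edges, v ∈ e}

/-- The degree of a point in the structure graph. -/
def degree (h : Honeycomb S) (v : ℂ) : ℕ := {e | e ∈ h.edges ∧ v ∈ e}.ncard

/-- The structure graph `G(h)`. -/
def graph (h : Honeycomb S) : SimpleGraph h.verts where
  Adj v w := s(v.1, w.1) ∈ h.edges
  symm := ⟨fun v w hvw => by rwa [Sym2.eq_swap]⟩
  loopless := ⟨fun v hv => h.nontrivial _ hv (by simp)⟩

end Honeycomb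

/-! ## The equilateral triangle -/

/-- The equilateral triangle `T` with vertices `0, 1, e^{iπ/3}`. -/
def triangle : Set ℂ :=
  {v | ∃ x y : ℝ, 0 ≤ x ∧ x ≤ 1 ∧ 0 ≤ y ∧ y ≤ 1 ∧ x + y ≤ 1 ∧
    v = x + y * Complex.exp (Real.pi / 3 * Complex.I)}

/-- The coordinates `(v_0, v_1, v_2)`: `v = v_1 + v_2 e^{iπ/3}` and `v_0 = 1 - v_1 - v_2`. -/
def coord (i : Fin 3) (v : ℂ) : ℝ :=
  ![1 - v.re - v.im / √3, v.re - v.im / √3, 2 * v.im / √3] i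

theorem exp_pi_div_three :
    Complex.exp (Real.pi / 3 * Complex.I) = (1 / 2 : ℝ) + (√3 / 2 : ℝ) * Complex.I := by
  rw [show (Real.pi / 3 * Complex.I : ℂ) = ((Real.pi / 3 : ℝ) : ℂ) * Complex.I by push_cast; ring,
    Complex.exp_mul_I, ← Complex.ofReal_cos, ← Complex.ofReal_sin,
    Real.cos_pi_div_three, Real.sin_pi_div_three]

theorem eq_coord (v : ℂ) :
    v = coord 1 v + coord 2 v * Complex.exp (Real.pi / 3 * Complex.I) := by
  have h3 : √3 ≠ 0 := by positivity
  rw [exp_pi_div_three]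
  apply Complex.ext
  · simp [coord]; field_simp; ring
  · simp [coord]; field_simp

theorem coord_sum (v : ℂ) : coord 0 v = 1 - coord 1 v - coord 2 v := by
  simp [coord]; ring

/-- The side `∂_i T`. -/
def side (i : Fin 3) : Set ℂ := {v | v ∈ triangle ∧ coord i v = 0}

/-- The direction `e^{2πi(ℓ+1)/3}` of the edges of type `ℓ`. -/
def dir (l : Fin 3) : ℂ := Complex.exp (2 * Real.pi * Complex.I * ((l : ℕ) + 1) / 3)

/-! ## Triangular honeycombs -/

/-- A triangular honeycomb of size `n`. The type of an edge is determined by the edge.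
Indices `i + 1`, `i + 2` are modulo `3`. -/
structure TriHoneycomb (n : ℕ) extends Honeycomb triangle where
  /-- The type `ℓ(e)` of an edge. -/
  type : {e // e ∈ edges} → Fin 3
  degree_eq : ∀ v ∈ toHoneycomb.verts, toHoneycomb.degree v = 1 ∨ toHoneycomb.degree v = 3
  boundary_eq : toHoneycomb.support ∩ (⋃ i, side i) =
    {v | v ∈ toHoneycomb.verts ∧ toHoneycomb.degree v = 1}
  type_spec : ∀ e : {e // e ∈ edges}, ∀ v ∈ e.1, ∀ w ∈ e.1, ∃ r : ℝ, w = v + r * dir (type e)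
  encard_side : ∀ i, (toHoneycomb.support ∩ side i).encard = n
  side_type : ∀ i, ∀ e : {e // e ∈ edges}, ∀ v ∈ e.1, v ∈ side i →
    (color e = 0 ∧ type e = i + 1) ∨ (color e = 1 ∧ type e = i + 2)
  side_mono : ∀ i, ∀ e e' : {e // e ∈ edges}, ∀ v ∈ e.1, ∀ v' ∈ e'.1,
    v ∈ side i → v' ∈ side i → coord (i + 1) v < coord (i + 1) v' → color e ≤ color e'

namespace TriHoneycomb

variable {n : ℕ}

/-- The height `L(e)`: the common `ℓ(e)`-coordinate of the points of `e`. -/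
def height (h : TriHoneycomb n) (e : {e // e ∈ h.edges}) : ℝ :=
  coord (h.type e) (Quot.out e.1).1

open Classical in
/-- The sign `s(v) ∈ {-1, 1}`: every edge at `v` of type `ℓ` is contained in
`v - s(v) e^{2πi(ℓ+1)/3} ℝ_{≥0}`. With this rule the two endpoints of any edge, including those
on the boundary of the triangle, have opposite signs. -/
def sign (h : TriHoneycomb n) (v : ℂ) : ℝ :=
  if ∀ (w : ℂ) (hw : s(v, w) ∈ h.edges), ∃ r : ℝ, 0 ≤ r ∧ w = v - r * dir (h.type ⟨_, hw⟩)
  then 1 else -1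

/-- The set of `(j+1)`-coordinates of the points of `t(h)` on the side `∂_j T`. -/
def sideValues (h : TriHoneycomb n) (j : Fin 3) : Set ℝ :=
  coord (j + 1) '' (h.support ∩ side j)

/-- Isomorphisms between structure graphs, as coloured graphs with ordered boundary:
the boundary vertices are ordered side by side, and on `∂_j T` by decreasing
`(j+1)`-coordinate. -/
structure StructIso (h h' : TriHoneycomb n) where
  iso : h.graph ≃g h'.graph
  color_eq : ∀ (v w : h.verts) (hvw : s(v.1, w.1) ∈ h.edges)
    (hvw' : s((iso v).1, (iso w).1) ∈ h'.edges), h'.color ⟨_, hvw'⟩ = h.color ⟨_, hvw⟩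
  side_iff : ∀ (j : Fin 3) (v : h.verts), (iso v).1 ∈ side j ↔ v.1 ∈ side j
  order_iff : ∀ (j : Fin 3) (v w : h.verts), v.1 ∈ side j → w.1 ∈ side j →
    (coord (j + 1) (iso v).1 < coord (j + 1) (iso w).1 ↔ coord (j + 1) v.1 < coord (j + 1) w.1)

/-- The identity. -/
def StructIso.refl (h : TriHoneycomb n) : StructIso h h where
  iso := SimpleGraph.Iso.refl
  color_eq _ _ _ _ := rfl
  side_iff _ _ := Iff.rfl
  order_iff _ _ _ _ _ := Iff.rfl

/-- The inverse isomorphism. -/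
def StructIso.symm {h h' : TriHoneycomb n} (φ : StructIso h h') : StructIso h' h where
  iso := φ.iso.symm
  color_eq v w hvw hvw' := by
    obtain ⟨v, rfl⟩ := φ.iso.surjective v
    obtain ⟨w, rfl⟩ := φ.iso.surjective w
    simp only [RelIso.symm_apply_apply] at hvw' ⊢
    exact (φ.color_eq v w hvw' hvw).symm
  side_iff j v := by
    obtain ⟨v, rfl⟩ := φ.iso.surjective v
    simpa using (φ.side_iff j v).symm
  order_iff j v w hv hw := by
    obtain ⟨v, rfl⟩ := φ.iso.surjective v
    obtain ⟨w, rfl⟩ := φ.iso.surjective w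
    simpa using (φ.order_iff j v w ((φ.side_iff j v).1 hv) ((φ.side_iff j w).1 hw)).symm

/-- The composition of two isomorphisms. -/
def StructIso.trans {h h' h'' : TriHoneycomb n} (φ : StructIso h h') (ψ : StructIso h' h'') :
    StructIso h h'' where
  iso := φ.iso.trans ψ.iso
  color_eq v w hvw hvw' := by
    have hm : s((φ.iso v).1, (φ.iso w).1) ∈ h'.edges := φ.iso.map_rel_iff.2 hvw
    exact (ψ.color_eq _ _ hm hvw').trans (φ.color_eq v w hvw hm)
  side_iff j v := (ψ.side_iff j _).trans (φ.side_iff j v)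
  order_iff j v w hv hw :=
    (ψ.order_iff j _ _ ((φ.side_iff j v).2 hv) ((φ.side_iff j w).2 hw)).trans
      (φ.order_iff j v w hv hw)

end TriHoneycomb

/-! ## Surfaces glued from equilateral triangles -/

/-- An oriented surface obtained from `N` copies of `T` by gluing some of their sides by pairs,
isometrically and reversing the orientation, with `p` unglued sides `L_1, …, L_p`.
The pair `(i, j)` stands for the side `∂_j T^i`. A side is glued to its image under the
involution `glue`, and the fixed points of `glue` are the unglued sides. -/
structure Surface (N p : ℕ) where
  glue : Fin N × Fin 3 → Fin N × Fin 3
  glue_glue : Function.Involutive glue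
  bdry : Fin p → Fin N × Fin 3
  bdry_injective : Function.Injective bdry
  mem_range_bdry : ∀ x, x ∈ Set.range bdry ↔ glue x = x

namespace Surface

variable {N p : ℕ}

/-- The triangles `T^i` and `T^i'` have sides that are glued together. -/
def adjGraph (T : Surface N p) : SimpleGraph (Fin N) :=
  SimpleGraph.fromRel fun i i' => ∃ j j', T.glue (i, j) = (i', j')

/-- The surface is connected. -/
def IsConnected (T : Surface N p) : Prop := T.adjGraph.Connected

/-- The surface obtained by gluing together the last two boundary edges. -/
def glueLastTwo (T : Surface N (p + 2)) : Surface N p where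
  glue x :=
    if x = T.bdry (Fin.last p).castSucc then T.bdry (Fin.last (p + 1))
    else if x = T.bdry (Fin.last (p + 1)) then T.bdry (Fin.last p).castSucc
    else T.glue x
  glue_glue := by
    have ha : T.glue (T.bdry (Fin.last p).castSucc) = T.bdry (Fin.last p).castSucc :=
      (T.mem_range_bdry _).1 ⟨_, rfl⟩
    have hb : T.glue (T.bdry (Fin.last (p + 1))) = T.bdry (Fin.last (p + 1)) :=
      (T.mem_range_bdry _).1 ⟨_, rfl⟩
    generalize T.bdry (Fin.last p).castSucc = a at ha ⊢
    generalize T.bdry (Fin.last (p + 1)) = b at hb ⊢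
    intro x
    have hx := T.glue_glue x
    have key : ∀ y, T.glue y = y → T.glue x = y → x = y := by
      intro y hy hxy
      rw [hxy, hy] at hx
      exact hx.symm
    have h1 := key a ha
    have h2 := key b hb
    dsimp only
    split_ifs <;> simp_all
  bdry r := T.bdry r.castSucc.castSucc
  bdry_injective := fun r r' h => by
    simpa using T.bdry_injective h
  mem_range_bdry x := by
    have hx := T.mem_range_bdry x
    have hab : T.bdry (Fin.last p).castSucc ≠ T.bdry (Fin.last (p + 1)) := fun h =>
      (Fin.castSucc_lt_last (Fin.last p)).ne (T.bdry_injective h)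
    constructor
    · rintro ⟨r, rfl⟩
      have h1 : T.bdry r.castSucc.castSucc ≠ T.bdry (Fin.last p).castSucc := fun h =>
        (Fin.castSucc_lt_last r).ne (Fin.castSucc_injective _ (T.bdry_injective h))
      have h2 : T.bdry r.castSucc.castSucc ≠ T.bdry (Fin.last (p + 1)) := fun h =>
        (Fin.castSucc_lt_last r.castSucc).ne (T.bdry_injective h)
      simp only [h1, h2, if_false]
      exact hx.1 ⟨_, rfl⟩
    · intro h
      split_ifs at h with h1 h2
      · exact absurd (h1.symm.trans h.symm) hab
      · exact absurd (h.trans h2) hab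
      · obtain ⟨r, hr⟩ := hx.2 h
        induction r using Fin.lastCases with
        | last => exact absurd hr.symm h2
        | cast r =>
          induction r using Fin.lastCases with
          | last => exact absurd hr.symm h1
          | cast r => exact ⟨r, hr⟩

end Surface

/-! ## Flows on finite graphs and their volume -/

/-- A finite graph, given by the endpoints of its edges; `src` and `tgt` fix a reference
orientation of each edge. -/
structure FinGraph where
  V : Type
  E : Type
  [fintypeE : Fintype E]
  src : E → V
  tgt : E → V

attribute [instance] FinGraph.fintypeE

namespace FinGraph

/-- `Ω¹(G)`, the antisymmetric functions on oriented edges, with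
`⟨ω₁, ω₂⟩ = ∑_{e ∈ E} ω₁(e) ω₂(e)`. A flow `ω` is recorded by its values
`ω(src e, tgt e)`; thus `ω(tgt e, src e)` is minus the coordinate `e`. -/
abbrev Flow (G : FinGraph) : Type := EuclideanSpace ℝ G.E

open Classical in
/-- The divergence `v ↦ ∑_{x ∼ v} ω(v, x)`. -/
def div (G : FinGraph) : G.Flow →ₗ[ℝ] (G.V → ℝ) where
  toFun ω v := ∑ e, ((if G.src e = v then ω e else 0) - (if G.tgt e = v then ω e else 0))
  map_add' ω ω' := by
    ext v
    rw [Pi.add_apply, ← Finset.sum_add_distrib]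
    refine Finset.sum_congr rfl fun e _ => ?_
    split_ifs <;> (simp; try ring)
  map_smul' r ω := by
    ext v
    rw [Pi.smul_apply, smul_eq_mul, Finset.mul_sum]
    refine Finset.sum_congr rfl fun e _ => ?_
    split_ifs <;> simp

/-- A set of edges is a spanning tree if it connects all the vertices and has
one element less than the set of vertices. -/
def IsSpanningTree (G : FinGraph) (S : Finset G.E) : Prop :=
  (SimpleGraph.fromEdgeSet ((fun e => s(G.src e, G.tgt e)) '' (S : Set G.E))).Connected ∧
    S.card + 1 = Nat.card G.V

/-- The number of spanning trees. -/
def numSpanningTrees (G : FinGraph) : ℕ := {S : Finset G.E | G.IsSpanningTree S}.ncard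

open Classical in
/-- The Lebesgue measure of the affine subspace `𝓕(φ) = {ω | div ω = φ}` of the Euclidean space
`Ω¹(G)`: the translate, by any element of `𝓕(φ)`, of the Lebesgue measure of `ker div`. -/
def lebesgue (G : FinGraph) (φ : G.V → ℝ) : MeasureTheory.Measure G.Flow :=
  if h : ∃ ω₀ : G.Flow, G.div ω₀ = φ then
    (MeasureTheory.volume : MeasureTheory.Measure (LinearMap.ker G.div)).map
      (fun x : LinearMap.ker G.div => h.choose + (x : G.Flow))
  else 0

/-- The measure `Vol` on `𝓕(φ)`: the Lebesgue measure divided by the square root of the number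
of spanning trees. -/
def vol (G : FinGraph) (φ : G.V → ℝ) : MeasureTheory.Measure G.Flow :=
  (ENNReal.ofReal √(G.numSpanningTrees : ℝ))⁻¹ • G.lebesgue φ

open Classical in
/-- The volume of a set `A` of flows which all have the same divergence `φ`: `Vol(A)` computed
in `𝓕(φ)`. -/
def volOf (G : FinGraph) (A : Set G.Flow) : ℝ≥0∞ :=
  if h : A.Nonempty then G.vol (G.div h.some) A else 0

end FinGraph

/-! ## Honeycombs on a glued surface -/

/-- A honeycomb on the surface `T`: a triangular honeycomb on every triangle, such that the
boundary points on two sides glued together coincide. Since the gluing of `∂_j T^i` to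
`∂_j' T^i'` is isometric and reverses the orientation, it identifies the point of `∂_j T` with
`(j+1)`-coordinate `x` to the point of `∂_j' T` with `(j'+1)`-coordinate `1 - x`. -/
structure SurfHoneycomb {N p : ℕ} (T : Surface N p) (n : ℕ) where
  tri : Fin N → TriHoneycomb n
  compat : ∀ i j i' j', T.glue (i, j) = (i', j') → (i', j') ≠ (i, j) →
    (tri i').sideValues j' = (fun x => 1 - x) '' (tri i).sideValues j

namespace SurfHoneycomb

variable {N p : ℕ} {T : Surface N p} {n : ℕ}

/-- The vertices of the triangles that are identified by the gluing of the sides. -/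
def VertRel (h : SurfHoneycomb T n) (x y : Σ i, (h.tri i).verts) : Prop :=
  ∃ j j', T.glue (x.1, j) = (y.1, j') ∧ (y.1, j') ≠ (x.1, j) ∧
    x.2.1 ∈ side j ∧ y.2.1 ∈ side j' ∧ coord (j' + 1) y.2.1 = 1 - coord (j + 1) x.2.1

/-- The structure graph of a honeycomb on `T`: the structure graphs of the triangular honeycombs,
with the boundary vertices identified by the gluing of the sides being merged. -/
def structGraph (h : SurfHoneycomb T n) : FinGraph where
  V := Quot h.VertRel
  E := Σ i, {e // e ∈ (h.tri i).edges}
  src e := Quot.mk _ ⟨e.1, (Quot.out e.2.1).1, e.2.1, e.2.2, Sym2.out_fst_mem _⟩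
  tgt e := Quot.mk _ ⟨e.1, (Quot.out e.2.1).2, e.2.1, e.2.2, Sym2.out_snd_mem _⟩

/-- Isomorphisms of structure graphs of honeycombs on `T`, as coloured graphs with ordered
boundary decomposed into the structure graphs of the `N` triangles. -/
abbrev StructIso (h h' : SurfHoneycomb T n) : Type :=
  ∀ i, TriHoneycomb.StructIso (h.tri i) (h'.tri i)

/-- Honeycombs with isomorphic structure graphs. -/
instance setoid (T : Surface N p) (n : ℕ) : Setoid (SurfHoneycomb T n) where
  r h h' := Nonempty (StructIso h h')
  iseqv :=
    { refl := fun _ => ⟨fun _ => TriHoneycomb.StructIso.refl _⟩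
      symm := fun ⟨φ⟩ => ⟨fun i => (φ i).symm⟩
      trans := fun ⟨φ⟩ ⟨ψ⟩ => ⟨fun i => (φ i).trans (ψ i)⟩ }

/-- The ordered boundary points of `h` on `L_1, …, L_p` are given by `γ^1, …, γ^p`. -/
def HasBoundary (h : SurfHoneycomb T n) (γ : Fin p → Fin n → ℝ) : Prop :=
  ∀ r, StrictAnti (γ r) ∧ (h.tri (T.bdry r).1).sideValues (T.bdry r).2 = Set.range (γ r)

/-- `ω` is the flow `𝓛[h]` of `h`, seen on the structure graph of `h₀` through the isomorphism
`φ`: its value at the image of an oriented edge `(v, w)` of `h` is `s(v) L({v, w})`. -/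
def IsFlow (h h₀ : SurfHoneycomb T n) (φ : StructIso h h₀) (ω : h₀.structGraph.Flow) : Prop :=
  ∀ (i : Fin N) (v w : (h.tri i).verts) (hvw : s(v.1, w.1) ∈ (h.tri i).edges)
    (e : {e // e ∈ (h₀.tri i).edges}),
    (Quot.out e.1).1 = ((φ i).iso v).1 → (Quot.out e.1).2 = ((φ i).iso w).1 →
      ω ⟨i, e⟩ = (h.tri i).sign v.1 * (h.tri i).height ⟨_, hvw⟩

/-- `𝓛(HONEY_T^G(γ^1, …, γ^p))`, where `G` is the structure graph of `h₀`: the flows of the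
honeycombs on `T` with boundary `γ` and structure graph isomorphic to `G`. -/
def flowSet (h₀ : SurfHoneycomb T n) (γ : Fin p → Fin n → ℝ) : Set h₀.structGraph.Flow :=
  {ω | ∃ (h : SurfHoneycomb T n) (φ : StructIso h h₀), h.HasBoundary γ ∧ IsFlow h h₀ φ ω}

end SurfHoneycomb

/-- The set `𝓖_T` of isomorphism classes of structure graphs of honeycombs on `T`. -/
abbrev GraphClass {N p : ℕ} (T : Surface N p) (n : ℕ) : Type :=
  Quotient (SurfHoneycomb.setoid T n)

/-- The total honeycomb volume `∑_{G ∈ 𝓖_T} Vol [𝓛 (HONEY_T^G (γ^1, …, γ^p))]`. -/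
def totalVolume {N p n : ℕ} (T : Surface N p) (γ : Fin p → Fin n → ℝ) : ℝ≥0∞ :=
  ∑' G : GraphClass T n, G.out.structGraph.volOf (G.out.flowSet γ)

end Honey

end

open scoped ENNReal

noncomputable section

namespace Honey

/-! ## The Cauchy–Binet formula -/

section CauchyBinet

variable {E k R : Type*} [Fintype E] [Fintype k] [DecidableEq k] [CommRing R]

/-! Cutting along the glued side turns a honeycomb on `T.glueLastTwo` into a honeycomb on `T` whose
last two boundary tuples are `u` and `tilde u` for some `u`, and every such honeycomb on `T` can be
glued back. Edges and heights are unchanged, so the flow set of a glued graph is the union over `u`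
of the flow sets of the cut graph. The statement is then Tonelli's theorem, provided the
normalisations of the volumes agree.

Normalisation. For a graph with a spanning tree, the fundamental cycles span a lattice of
divergence-free flows of covolume √(number of spanning trees): this is the Cauchy–Binet formula for
the matrix of cycles, whose maximal minors are 0 or ±1. Hence `vol` is plain Lebesgue measure in the
coordinates given by the edges outside a spanning tree (`IsSpanningTree.vol_apply`). Gluing merges
`n` leaves with `n` other vertices. A spanning tree of the cut graph contains the `n` leaf edges,
and removing them leaves a spanning tree of the glued graph. So coordinates for the glued graph are
coordinates for the cut graph together with the flows through the leaf edges, and these are ±(c_k -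
u_k) with fixed colours c_k (`LeafMerging.exists_disintegration`).

Three facts about honeycombs are needed. (1) All flows in a flow set have the same divergence
(`div_eq_of_mem_flowSet`). The outflow at a trivalent vertex is its sign, because the three
coordinates sum to 1; at a boundary point with coordinate x it is the colour minus x; and the
coordinates of two glued points add up to 1. (2) Structure graphs are connected, so that spanning
trees exist (`graph_connected`, `structGraph_isConn`). If the vertices of a triangular honeycomb
split into two parts with no edge between them, charges conserved at the vertices define an
intersection number of the parts. It vanishes term by term: disjoint segments do not contribute, and
the pairing is chosen to be zero on the allowed crossings. Two summations by parts evaluate it on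
the boundary as a nonzero multiple of a product of numbers of ends. The colour pairs (0,0), (1,1),
(0,1) and (1,0) then leave one part without ends, although the leftmost vertex of a nonempty part is
always an end. (3) Flow sets are measurable (`measurableSet_flowSet`). Having a given structure
graph is decided by finitely many Borel conditions on the positions of the vertices, and the flow
together with the types of the edges determines the positions; a flow set is thus a finite union of
injective measurable images of Borel sets.

Finally the identity is summed over the countably many structure graphs. Graphs on `T` that do not
come from a glued honeycomb contribute zero, cutting is injective on classes, and volumes do not
depend on the chosen representatives (`volOf_flowSet_eq`). -/

theorem det_transpose_mul_self_eq_sum_embedding (B : Matrix E k R) :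
    (B.transpose * B).det =
      ∑ f : k → E, (∏ i, B (f i) i) * (B.submatrix f id).det := by
  -- Row `i` of the Gram matrix is a combination of the rows of `B` with coefficients `B e i`, so
  -- multilinearity of the determinant expands it over all choices of rows.
  have h1 : (B.transpose * B).det =
      Matrix.detRowAlternating (fun i => ∑ e : E, B e i • B e) := by
    change _ = Matrix.det _
    congr 1
    ext i j
    simp [Matrix.mul_apply, Finset.sum_apply]
  rw [h1, ← AlternatingMap.coe_multilinearMap, MultilinearMap.map_sum]
  refine Finset.sum_congr rfl fun f _ => ?_
  rw [MultilinearMap.map_smul_univ, smul_eq_mul]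
  rfl

/-- Groups the terms that choose the same set of rows in different orders: each reordered minor is a
sign times `M.det`, and the signed products add up to `M.det` again. -/
theorem sum_perm_prod_mul_det (M : Matrix k k R) :
    ∑ σ : Equiv.Perm k, (∏ i, M (σ i) i) * (M.submatrix σ id).det = M.det ^ 2 := by
  have h : ∀ σ : Equiv.Perm k, (M.submatrix σ id).det = Equiv.Perm.sign σ * M.det :=
    fun σ => Matrix.det_permute σ M
  simp_rw [h]
  rw [sq]
  nth_rewrite 2 [Matrix.det_apply']
  rw [Finset.sum_mul]
  refine Finset.sum_congr rfl fun σ _ => by ring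

/-- The **Cauchy–Binet formula** for a Gram matrix: the sum runs over the sets of rows, enumerated
by `emb`. -/
theorem det_transpose_mul_self [DecidableEq E] (B : Matrix E k R) (emb : Finset E → k → E)
    (hinj : ∀ C : Finset E, C.card = Fintype.card k → Function.Injective (emb C))
    (himg : ∀ C : Finset E, C.card = Fintype.card k → Finset.univ.image (emb C) = C) :
    (B.transpose * B).det =
      ∑ C ∈ Finset.powersetCard (Fintype.card k) (Finset.univ : Finset E),
        (B.submatrix (emb C) id).det ^ 2 := by
  rw [det_transpose_mul_self_eq_sum_embedding]
  -- A non-injective choice repeats a row, so its minor vanishes; the injective choices are fibred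
  -- over their images `C`.
  rw [← Finset.sum_subset (Finset.subset_univ (Finset.univ.filter Function.Injective))]
  · rw [← Finset.sum_fiberwise_of_maps_to
      (t := Finset.powersetCard (Fintype.card k) (Finset.univ : Finset E))
      (g := fun f : k → E => Finset.univ.image f)]
    · refine Finset.sum_congr rfl fun C hC => ?_
      have hc := (Finset.mem_powersetCard.1 hC).2
      rw [← sum_perm_prod_mul_det]
      symm
      refine Finset.sum_bij (fun σ _ => emb C ∘ σ) ?_ ?_ ?_ ?_
      · intro σ _
        simp only [Finset.mem_filter, Finset.mem_univ, true_and]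
        refine ⟨(hinj C hc).comp σ.injective, ?_⟩
        rw [← Finset.image_image, Finset.image_univ_equiv, himg C hc]
      · intro σ _ τ _ h
        ext i
        exact hinj C hc (congrFun h i)
      · intro f hf
        simp only [Finset.mem_filter, Finset.mem_univ, true_and] at hf
        have hm : ∀ i, ∃ j, emb C j = f i := fun i => by
          have : f i ∈ Finset.univ.image (emb C) := by
            rw [himg C hc, ← hf.2]
            exact Finset.mem_image_of_mem _ (Finset.mem_univ i)
          simpa using this
        choose g hg using hm
        have hgi : Function.Injective g := fun i j hij => hf.1 (by rw [← hg, ← hg, hij])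
        refine ⟨Equiv.ofBijective g (Finite.injective_iff_bijective.1 hgi), Finset.mem_univ _, ?_⟩
        ext i
        exact hg i
      · intro σ _
        rfl
    · intro f hf
      simp only [Finset.mem_filter, Finset.mem_univ, true_and] at hf
      rw [Finset.mem_powersetCard]
      exact ⟨Finset.subset_univ _, by rw [Finset.card_image_of_injective _ hf, Finset.card_univ]⟩
  · intro f _ hf
    simp only [Finset.mem_filter, Finset.mem_univ, true_and] at hf
    obtain ⟨i, j, hij, hne⟩ := Function.not_injective_iff.1 hf
    rw [Matrix.det_zero_of_row_eq hne (by ext l; simp [hij]), mul_zero]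

end CauchyBinet

/-! ### Spanning trees and divergence-free flows -/

namespace FinGraph

variable {G : FinGraph}

theorem div_apply (ω : G.Flow) (v : G.V) [DecidableEq G.V] : G.div ω v =
    ∑ e, ((if G.src e = v then ω e else 0) - (if G.tgt e = v then ω e else 0)) := by
  simp only [div, LinearMap.coe_mk, AddHom.coe_mk]

/-- The divergence is adjoint to the gradient of functions on the vertices. -/
theorem sum_mul_div [Fintype G.V] (c : G.V → ℝ) (ω : G.Flow) :
    ∑ v, c v * G.div ω v = ∑ e, ω e * (c (G.src e) - c (G.tgt e)) := by
  classical
  simp_rw [div_apply, Finset.mul_sum]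
  rw [Finset.sum_comm]
  refine Finset.sum_congr rfl fun e _ => ?_
  simp only [mul_sub, Finset.sum_sub_distrib, mul_ite, mul_zero, Finset.sum_ite_eq,
    Finset.mem_univ, if_true]
  ring

/-- The simple graph on the vertices of `G` spanned by a set of edges. -/
abbrev spanned (G : FinGraph) (S : Set G.E) : SimpleGraph G.V :=
  SimpleGraph.fromEdgeSet ((fun e => s(G.src e, G.tgt e)) '' S)

/-- Connected finite graphs. -/
def IsConn (G : FinGraph) : Prop := (G.spanned Set.univ).Connected

theorem spanned_reachable {S : Set G.E} {e : G.E} (he : e ∈ S) :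
    (G.spanned S).Reachable (G.src e) (G.tgt e) := by
  by_cases h : G.src e = G.tgt e
  · rw [h]
  · exact SimpleGraph.Adj.reachable (by
      rw [SimpleGraph.fromEdgeSet_adj]
      exact ⟨⟨e, he, rfl⟩, h⟩)

/-- A function on the vertices that is constant along the edges of `S` is constant on the
connected components. -/
theorem eq_of_spanned_reachable {S : Set G.E} {α : Type*} (c : G.V → α)
    (hc : ∀ e ∈ S, c (G.src e) = c (G.tgt e)) {a b : G.V} (h : (G.spanned S).Reachable a b) :
    c a = c b := by
  obtain ⟨p⟩ := h
  induction p with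
  | nil => rfl
  | cons hadj p ih =>
    rw [← ih]
    rw [SimpleGraph.fromEdgeSet_adj] at hadj
    obtain ⟨⟨e, he, hs⟩, -⟩ := hadj
    simp only [Sym2.eq_iff] at hs
    rcases hs with ⟨h1, h2⟩ | ⟨h1, h2⟩
    · rw [← h1, ← h2, hc e he]
    · rw [← h1, ← h2, hc e he]

open Classical in
/-- The flow of intensity `1` through the edge `e`. -/
def unit (e : G.E) : G.E → ℤ := fun e' => if e' = e then 1 else 0

/-- An integral flow seen as a real flow. -/
def ofInt (z : G.E → ℤ) : G.Flow := WithLp.toLp 2 fun e => (z e : ℝ)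

@[simp] theorem ofInt_apply (z : G.E → ℤ) (e : G.E) : ofInt z e = z e := rfl

theorem ofInt_add (z z' : G.E → ℤ) : ofInt (z + z') = ofInt z + ofInt z' := by
  ext e; simp

theorem ofInt_sub (z z' : G.E → ℤ) : ofInt (z - z') = ofInt z - ofInt z' := by
  ext e; simp

theorem ofInt_zero : ofInt (0 : G.E → ℤ) = 0 := by
  ext e; simp

open Classical in
theorem div_unit (e : G.E) :
    G.div (ofInt (unit e)) = Pi.single (G.src e) 1 - Pi.single (G.tgt e) 1 := by
  ext v
  rw [div_apply, Finset.sum_eq_single e]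
  · simp [unit, Pi.single_apply, eq_comm]
  · intro e' _ h
    simp [unit, h]
  · simp

open Classical in
/-- In the subgraph spanned by `S`, a unit of flow can be sent from a vertex to any vertex of the
same component. -/
theorem exists_int_flow {S : Set G.E} {a b : G.V} (h : (G.spanned S).Reachable a b) :
    ∃ z : G.E → ℤ, (∀ e, e ∉ S → z e = 0) ∧
      G.div (ofInt z) = Pi.single a 1 - Pi.single b 1 := by
  obtain ⟨p⟩ := h
  induction p with
  | nil => exact ⟨0, fun _ _ => rfl, by rw [ofInt_zero, map_zero, sub_self]⟩
  | cons hadj p ih =>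
    obtain ⟨z, hz, hd⟩ := ih
    rw [SimpleGraph.fromEdgeSet_adj] at hadj
    obtain ⟨⟨e, he, hs⟩, -⟩ := hadj
    simp only [Sym2.eq_iff] at hs
    have hu : ∀ e', e' ∉ S → unit e e' = 0 := fun e' h' => by
      simp only [unit]
      exact if_neg fun heq => h' (by rwa [heq])
    rcases hs with ⟨h1, h2⟩ | ⟨h1, h2⟩
    · refine ⟨z + unit e, fun e' h' => by simp [hz e' h', hu e' h'], ?_⟩
      rw [ofInt_add, map_add, hd, div_unit, h1, h2]
      abel
    · refine ⟨z - unit e, fun e' h' => by simp [hz e' h', hu e' h'], ?_⟩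
      rw [ofInt_sub, map_sub, hd, div_unit, h1, h2]
      abel

/-- The flows supported on a set of edges. -/
def extend (S : Finset G.E) : (S → ℝ) →ₗ[ℝ] G.Flow where
  toFun x := WithLp.toLp 2 (Function.extend Subtype.val x 0)
  map_add' x y := by
    ext e
    by_cases he : e ∈ S
    · have := fun x : S → ℝ => Subtype.val_injective.extend_apply x 0 (⟨e, he⟩ : S)
      simp only at this
      simp [this]
    · have := fun x : S → ℝ => Function.extend_apply' (f := (Subtype.val : S → G.E)) x 0 e
        (by simpa using he)
      simp [this]
  map_smul' r x := by
    ext e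
    by_cases he : e ∈ S
    · have := fun x : S → ℝ => Subtype.val_injective.extend_apply x 0 (⟨e, he⟩ : S)
      simp only at this
      simp [this]
    · have := fun x : S → ℝ => Function.extend_apply' (f := (Subtype.val : S → G.E)) x 0 e
        (by simpa using he)
      simp [this]

theorem extend_apply_mem {S : Finset G.E} (x : S → ℝ) (e : S) : extend S x e = x e :=
  Subtype.val_injective.extend_apply x 0 e

theorem extend_apply_notMem {S : Finset G.E} (x : S → ℝ) {e : G.E} (he : e ∉ S) :
    extend S x e = 0 :=
  Function.extend_apply' (f := (Subtype.val : S → G.E)) x 0 e (by simpa using he)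

theorem extend_restrict {S : Finset G.E} (ω : G.Flow) (h : ∀ e ∉ S, ω e = 0) :
    extend S (fun e => ω e) = ω := by
  ext e
  by_cases he : e ∈ S
  · exact extend_apply_mem _ ⟨e, he⟩
  · rw [extend_apply_notMem _ he, h e he]

theorem IsSpanningTree.finite {S : Finset G.E} (hS : G.IsSpanningTree S) : Finite G.V :=
  Nat.finite_of_card_ne_zero (by rw [← hS.2]; omega)

/-- A flow without divergence supported on a spanning tree vanishes. -/
theorem IsSpanningTree.eq_zero {S : Finset G.E} (hS : G.IsSpanningTree S) {ω : G.Flow}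
    (hω : G.div ω = 0) (hs : ∀ e ∉ S, ω e = 0) : ω = 0 := by
  classical
  have := hS.finite
  have := Fintype.ofFinite G.V
  set D : (S → ℝ) →ₗ[ℝ] (G.V → ℝ) := G.div ∘ₗ extend S with hD
  have hne : Nonempty G.V := hS.1.nonempty
  let a : G.V := Classical.arbitrary _
  -- Unit flows from each vertex to `a` inside `S` show that the image of `D` and the point mass at
  -- `a` span everything. So `D` has rank at least `#V - 1 = #S`, and rank–nullity leaves no kernel.
  have htop : LinearMap.range D ⊔ Submodule.span ℝ {(Pi.single a 1 : G.V → ℝ)} = ⊤ := by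
    rw [eq_top_iff]
    intro c _
    have hc : c = ∑ v, c v • (Pi.single v 1 : G.V → ℝ) := by
      ext w
      simp [Finset.sum_apply, Pi.single_apply]
    rw [hc]
    refine Submodule.sum_mem _ fun v _ => Submodule.smul_mem _ _ ?_
    obtain ⟨z, hz, hd⟩ := exists_int_flow (hS.1.preconnected v a)
    have : (Pi.single v 1 : G.V → ℝ) = G.div (ofInt z) + Pi.single a 1 := by rw [hd]; abel
    rw [this]
    refine Submodule.add_mem_sup ⟨fun e => ofInt z e, ?_⟩ (Submodule.mem_span_singleton_self _)
    rw [hD, LinearMap.comp_apply, extend_restrict]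
    intro e he
    simp [hz e (by simpa using he)]
  have h1 : Module.finrank ℝ (G.V → ℝ) ≤ Module.finrank ℝ (LinearMap.range D) + 1 := by
    have := Submodule.finrank_add_le_finrank_add_finrank (LinearMap.range D)
      (Submodule.span ℝ {(Pi.single a 1 : G.V → ℝ)})
    rw [htop, finrank_top] at this
    exact this.trans (Nat.add_le_add_left ((finrank_span_le_card _).trans (by simp)) _)
  have h2 := D.finrank_range_add_finrank_ker
  rw [Module.finrank_pi, Fintype.card_coe] at h2
  rw [Module.finrank_pi, ← Nat.card_eq_fintype_card, ← hS.2] at h1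
  have h3 : Module.finrank ℝ (LinearMap.ker D) = 0 := by omega
  rw [Submodule.finrank_eq_zero] at h3
  have h4 : (fun e : S => ω e) ∈ LinearMap.ker D := by
    rw [LinearMap.mem_ker, hD, LinearMap.comp_apply, extend_restrict ω hs, hω]
  rw [h3, Submodule.mem_bot] at h4
  rw [← extend_restrict ω hs, h4, map_zero]

/-- A set of `#V - 1` edges that supports no divergence-free flow is a spanning tree. -/
theorem isSpanningTree_of_forall {S : Finset G.E} (hc : S.card + 1 = Nat.card G.V)
    (h : ∀ ω : G.Flow, G.div ω = 0 → (∀ e ∉ S, ω e = 0) → ω = 0) : G.IsSpanningTree S := by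
  classical
  have hfin : Finite G.V := Nat.finite_of_card_ne_zero (by omega)
  have := Fintype.ofFinite G.V
  have hne : Nonempty G.V := Finite.card_pos_iff.1 (by omega)
  refine ⟨?_, hc⟩
  rw [SimpleGraph.connected_iff]
  refine ⟨fun a b => ?_, hne⟩
  by_contra hab
  set H := SimpleGraph.fromEdgeSet ((fun e => s(G.src e, G.tgt e)) '' (S : Set G.E)) with hH
  set D : (S → ℝ) →ₗ[ℝ] (G.V → ℝ) := G.div ∘ₗ extend S with hD
  have hinj : LinearMap.ker D = ⊥ := by
    rw [eq_bot_iff]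
    intro x hx
    have h0 := h (extend S x) hx fun e he => extend_apply_notMem x he
    rw [Submodule.mem_bot]
    ext e
    rw [← extend_apply_mem x e, h0]
    rfl
  let f : G.V → ℝ := fun v => if H.Reachable a v then 1 else 0
  -- If `a` and `b` are not connected, the total sum and the sum over the component of `a` are
  -- independent forms that vanish on every divergence supported on `S`. Then `D` has rank at most
  -- `#V - 2 < #S`, against injectivity.
  let Ψ : (G.V → ℝ) →ₗ[ℝ] ℝ × ℝ :=
    { toFun := fun c => (∑ v, c v, ∑ v, f v * c v)
      map_add' := fun c d => by simp [Finset.sum_add_distrib, mul_add]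
      map_smul' := fun r c => by
        simp only [Pi.smul_apply, smul_eq_mul, RingHom.id_apply, Prod.smul_mk, Finset.mul_sum]
        congr 1
        exact Finset.sum_congr rfl fun v _ => by ring }
  have hΨ : LinearMap.range Ψ = ⊤ := by
    rw [eq_top_iff]
    rintro ⟨x, y⟩ -
    refine ⟨Pi.single a y + Pi.single b (x - y), ?_⟩
    have ha : f a = 1 := if_pos (SimpleGraph.Reachable.refl a)
    have hb : f b = 0 := if_neg hab
    simp only [Ψ, LinearMap.coe_mk, AddHom.coe_mk, Pi.add_apply, Finset.sum_add_distrib, mul_add]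
    simp [Pi.single_apply, ha, hb]
  have hsub : LinearMap.range D ≤ LinearMap.ker Ψ := by
    rintro _ ⟨x, rfl⟩
    rw [LinearMap.mem_ker]
    have h1 := sum_mul_div (fun _ : G.V => (1 : ℝ)) (extend S x)
    have h2 := sum_mul_div f (extend S x)
    simp only [sub_self, mul_zero, Finset.sum_const_zero, one_mul] at h1
    have h3 : ∑ v, f v * G.div (extend S x) v = 0 := by
      rw [h2]
      refine Finset.sum_eq_zero fun e _ => ?_
      by_cases he : e ∈ S
      · have hr : H.Reachable (G.src e) (G.tgt e) :=
          spanned_reachable (S := (S : Set G.E)) (Finset.mem_coe.2 he)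
        have : f (G.src e) = f (G.tgt e) := by
          simp only [f]
          exact if_congr ⟨fun h => h.trans hr, fun h => h.trans hr.symm⟩ rfl rfl
        rw [this, sub_self, mul_zero]
      · rw [extend_apply_notMem x he, zero_mul]
    exact Prod.ext h1 h3
  have h1 := D.finrank_range_add_finrank_ker
  have h2 := Ψ.finrank_range_add_finrank_ker
  have h3 := Submodule.finrank_mono hsub
  rw [hinj, finrank_bot, Module.finrank_pi, Fintype.card_coe] at h1
  rw [hΨ, finrank_top, Module.finrank_prod, Module.finrank_self, Module.finrank_pi,
    ← Nat.card_eq_fintype_card] at h2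
  omega

/-- A connected graph has a spanning tree. -/
theorem IsConn.exists_isSpanningTree (h : G.IsConn) [Finite G.V] :
    ∃ S : Finset G.E, G.IsSpanningTree S := by
  classical
  have := Fintype.ofFinite G.V
  obtain ⟨T, hle, hT⟩ := SimpleGraph.Connected.exists_isTree_le h
  have hex : ∀ x ∈ T.edgeSet, ∃ e : G.E, s(G.src e, G.tgt e) = x := by
    intro x hx
    have := SimpleGraph.edgeSet_mono hle hx
    rw [SimpleGraph.edgeSet_fromEdgeSet] at this
    obtain ⟨⟨e, -, he⟩, -⟩ := this
    exact ⟨e, he⟩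
  -- `G` may have parallel edges: one edge is chosen above each edge of a spanning tree of the
  -- underlying simple graph.
  choose f hf using hex
  let S : Finset G.E := Finset.univ.image fun x : T.edgeSet => f x.1 x.2
  have himg : (fun e => s(G.src e, G.tgt e)) '' (S : Set G.E) = T.edgeSet := by
    ext x
    simp only [S, Finset.coe_image, Set.mem_image, Finset.coe_univ, Set.mem_univ, true_and,
      Subtype.exists]
    constructor
    · rintro ⟨_, ⟨y, hy, rfl⟩, rfl⟩
      rwa [hf]
    · intro hx
      exact ⟨_, ⟨x, hx, rfl⟩, hf x hx⟩
  refine ⟨S, ?_, ?_⟩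
  · rw [himg, SimpleGraph.fromEdgeSet_edgeSet]
    exact hT.connected
  · rw [Finset.card_image_of_injective, Finset.card_univ, Nat.card_eq_fintype_card,
      ← hT.card_edgeFinset, SimpleGraph.edgeFinset_card]
    intro x y hxy
    have := hf x.1 x.2
    simp only at hxy
    rw [hxy, hf] at this
    exact Subtype.ext this.symm

end FinGraph

end Honey

end

/-! ### Fundamental cycles and the normalisation of the volume -/

noncomputable section

namespace Honey

namespace FinGraph

variable {G : FinGraph}

namespace IsSpanningTree

open Classical in
-- The edge `e` is closed up by an integral flow inside the tree.
theorem exists_cycle {S : Finset G.E} (hS : G.IsSpanningTree S) (e : {e // e ∉ S}) :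
    ∃ z : G.E → ℤ, G.div (ofInt z) = 0 ∧ ∀ e' : {e // e ∉ S}, z e' = if e' = e then 1 else 0 := by
  obtain ⟨z, hz, hd⟩ := exists_int_flow (hS.1.preconnected (G.src e) (G.tgt e))
  refine ⟨unit e - z, by rw [ofInt_sub, map_sub, hd, div_unit, sub_self], fun e' => ?_⟩
  rw [Pi.sub_apply, hz e' (by simpa using e'.2), sub_zero]
  simp only [unit, Subtype.ext_iff]

/-- The fundamental cycle of an edge that is not in the spanning tree. -/
def cycle {S : Finset G.E} (hS : G.IsSpanningTree S) (e : {e // e ∉ S}) : G.E → ℤ :=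
  (hS.exists_cycle e).choose

theorem div_cycle {S : Finset G.E} (hS : G.IsSpanningTree S) (e : {e // e ∉ S}) :
    G.div (ofInt (hS.cycle e)) = 0 :=
  (hS.exists_cycle e).choose_spec.1

open Classical in
theorem cycle_apply {S : Finset G.E} (hS : G.IsSpanningTree S) (e e' : {e // e ∉ S}) :
    hS.cycle e e' = if e' = e then 1 else 0 :=
  (hS.exists_cycle e).choose_spec.2 e'

open Classical in
/-- The divergence-free flow with prescribed values outside a spanning tree. -/
def sec {S : Finset G.E} (hS : G.IsSpanningTree S) : ({e // e ∉ S} → ℝ) →ₗ[ℝ] G.Flow where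
  toFun x := ∑ e, x e • ofInt (hS.cycle e)
  map_add' x y := by simp [add_smul, Finset.sum_add_distrib]
  map_smul' r x := by simp [Finset.smul_sum, smul_smul]

open Classical in
theorem sec_eq {S : Finset G.E} (hS : G.IsSpanningTree S) (x : {e // e ∉ S} → ℝ) :
    hS.sec x = ∑ e, x e • ofInt (hS.cycle e) := rfl

theorem div_sec {S : Finset G.E} (hS : G.IsSpanningTree S) (x : {e // e ∉ S} → ℝ) :
    G.div (hS.sec x) = 0 := by
  rw [sec_eq, map_sum]
  exact Finset.sum_eq_zero fun e _ => by rw [map_smul, hS.div_cycle, smul_zero]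

open Classical in
theorem sec_apply' {S : Finset G.E} (hS : G.IsSpanningTree S) (x : {e // e ∉ S} → ℝ) (e : G.E) :
    hS.sec x e = ∑ e', (hS.cycle e' e : ℝ) * x e' := by
  rw [sec_eq, WithLp.ofLp_sum, Finset.sum_apply]
  exact Finset.sum_congr rfl fun e' _ => by simp [mul_comm]

theorem sec_apply {S : Finset G.E} (hS : G.IsSpanningTree S) (x : {e // e ∉ S} → ℝ)
    (e : {e // e ∉ S}) : hS.sec x e = x e := by
  classical
  rw [sec_apply', Finset.sum_eq_single e]
  · simp [cycle_apply]
  · intro e' _ h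
    simp [cycle_apply, h.symm]
  · simp

/-- The difference of the two sides is divergence-free and supported on the tree, hence zero. -/
theorem eq_sec {S : Finset G.E} (hS : G.IsSpanningTree S) {ω : G.Flow} (hω : G.div ω = 0) :
    hS.sec (fun e => ω e) = ω := by
  rw [← sub_eq_zero]
  refine hS.eq_zero (by rw [map_sub, hS.div_sec, hω, sub_zero]) fun e he => ?_
  rw [PiLp.sub_apply, hS.sec_apply _ ⟨e, he⟩, sub_self]

/-- The values outside a spanning tree are coordinates on the space of divergence-free flows. -/
def secEquiv {S : Finset G.E} (hS : G.IsSpanningTree S) :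
    ({e // e ∉ S} → ℝ) ≃ₗ[ℝ] LinearMap.ker G.div where
  toFun x := ⟨hS.sec x, hS.div_sec x⟩
  map_add' x y := by ext1; simp
  map_smul' r x := by ext1; simp
  invFun ω := fun e => ω.1 e
  left_inv x := by ext e; exact hS.sec_apply x e
  right_inv ω := by ext1; exact hS.eq_sec ω.2

theorem finrank_ker {S : Finset G.E} (hS : G.IsSpanningTree S) :
    Module.finrank ℝ (LinearMap.ker G.div) + Nat.card G.V = Fintype.card G.E + 1 := by
  classical
  rw [← hS.secEquiv.finrank_eq, Module.finrank_pi, Fintype.card_subtype_compl, Fintype.card_coe,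
    ← hS.2]
  have := Finset.card_le_univ S
  omega

open Classical in
/-- The matrix of the fundamental cycles. -/
def cycleMatrix {S : Finset G.E} (hS : G.IsSpanningTree S) : Matrix G.E {e // e ∉ S} ℤ :=
  Matrix.of fun e e' => hS.cycle e' e

open Classical in
theorem cycleMatrix_mulVec {S : Finset G.E} (hS : G.IsSpanningTree S) (x : {e // e ∉ S} → ℝ) :
    (hS.cycleMatrix.map (Int.cast : ℤ → ℝ)).mulVec x = hS.sec x := by
  ext e
  rw [sec_apply']
  rfl

open Classical in
-- The two factors are the changes of basis between the cycles of `S` and those of `S'`. Both being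
-- integral, their determinants are units of `ℤ`.
theorem cycleMatrix_mul {S S' : Finset G.E} (hS : G.IsSpanningTree S)
    (hS' : G.IsSpanningTree S') :
    hS.cycleMatrix.submatrix (Subtype.val : {e // e ∉ S'} → G.E) id *
      hS'.cycleMatrix.submatrix (Subtype.val : {e // e ∉ S} → G.E) id = 1 := by
  have h : ∀ e : {e // e ∉ S'}, hS.sec (fun e' => ofInt (hS'.cycle e) e') = ofInt (hS'.cycle e) :=
    fun e => hS.eq_sec (hS'.div_cycle e)
  ext e e'
  have h1 := congrArg (fun ω : G.Flow => ω e) (h e')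
  simp only [sec_apply', ofInt_apply, hS'.cycle_apply] at h1
  rw [Matrix.mul_apply, Matrix.one_apply]
  exact_mod_cast h1

open Classical in
-- If `C` is a spanning tree, the minor on the edges outside `C` has an integral inverse, so it is
-- ±1. Otherwise some nonzero divergence-free flow is supported on `C`, and its coordinates outside
-- `S` form a kernel vector of the minor.
theorem det_cycleMatrix_sq {S : Finset G.E} (hS : G.IsSpanningTree S) (C : Finset G.E)
    (f : {e // e ∉ S} ≃ {e // e ∉ C}) :
    (hS.cycleMatrix.submatrix (fun e => (f e : G.E)) id).det ^ 2 =
      if G.IsSpanningTree C then 1 else 0 := by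
  split_ifs with hC
  · have h := hS.cycleMatrix_mul hC
    have h2 : hS.cycleMatrix.submatrix (fun e => (f e : G.E)) id *
        (hC.cycleMatrix.submatrix (Subtype.val : {e // e ∉ S} → G.E) f) = 1 := by
      ext e e'
      have := congrFun (congrFun h (f e)) (f e')
      simp only [Matrix.mul_apply, Matrix.one_apply, Matrix.submatrix_apply, id,
        EmbeddingLike.apply_eq_iff_eq] at this ⊢
      exact this
    have h3 := congrArg Matrix.det h2
    rw [Matrix.det_mul, Matrix.det_one] at h3
    rcases Int.isUnit_iff.1 (IsUnit.of_mul_eq_one _ h3) with h | h <;> rw [h] <;> norm_num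
  · have hcard : C.card = S.card := by
      have h1 := Fintype.card_congr f
      rw [Fintype.card_subtype_compl, Fintype.card_subtype_compl, Fintype.card_coe,
        Fintype.card_coe] at h1
      have := Finset.card_le_univ S
      have := Finset.card_le_univ C
      omega
    have hex : ∃ ω : G.Flow, G.div ω = 0 ∧ (∀ e ∉ C, ω e = 0) ∧ ω ≠ 0 := by
      by_contra hcon
      push Not at hcon
      exact hC (isSpanningTree_of_forall (by rw [hcard, hS.2]) hcon)
    obtain ⟨ω, hd, hz, hne⟩ := hex
    rw [sq_eq_zero_iff]
    have hcast : (((hS.cycleMatrix.submatrix (fun e => (f e : G.E)) id).map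
        (Int.cast : ℤ → ℝ)).det) = 0 := by
      refine Matrix.exists_mulVec_eq_zero_iff.1 ⟨fun e => ω e, ?_, ?_⟩
      · intro h0
        apply hne
        rw [← hS.eq_sec hd, h0, map_zero]
      · ext e
        have := congrFun (hS.cycleMatrix_mulVec fun e => ω e) (f e)
        rw [hS.eq_sec hd, hz _ (f e).2] at this
        exact this
    have h5 := Int.cast_det (R := ℝ) (hS.cycleMatrix.submatrix (fun e => (f e : G.E)) id)
    exact_mod_cast h5.trans hcast

open Classical in
/-- The number of spanning trees is the Gram determinant of the fundamental cycles. -/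
theorem det_cycleMatrix {S : Finset G.E} (hS : G.IsSpanningTree S) :
    (hS.cycleMatrix.transpose * hS.cycleMatrix).det = G.numSpanningTrees := by
  have hk : Fintype.card {e // e ∉ S} = Fintype.card G.E - S.card := by
    rw [Fintype.card_subtype_compl, Fintype.card_coe]
  have hle := Finset.card_le_univ S
  have hex : ∀ C : Finset G.E, C.card = Fintype.card {e // e ∉ S} →
      Nonempty ({e // e ∉ S} ≃ {e // e ∉ Cᶜ}) := fun C hC =>
    ⟨Fintype.equivOfCardEq (by simp [← hC])⟩
  -- Cauchy–Binet runs over sets `C` of rows, while the minors are known for the edges outside a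
  -- set; the latter is therefore applied to `Cᶜ`. The `else` branch is only a default value for
  -- sets of the wrong size.
  let emb : Finset G.E → {e // e ∉ S} → G.E := fun C e =>
    if h : C.card = Fintype.card {e // e ∉ S} then ((hex C h).some e : G.E) else e
  have hemb : ∀ C (h : C.card = Fintype.card {e // e ∉ S}) e, emb C e = (hex C h).some e :=
    fun C h e => dif_pos h
  rw [det_transpose_mul_self _ emb]
  · have : ∀ C ∈ Finset.powersetCard (Fintype.card {e // e ∉ S}) (Finset.univ : Finset G.E),
        (hS.cycleMatrix.submatrix (emb C) id).det ^ 2 = if G.IsSpanningTree Cᶜ then 1 else 0 := by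
      intro C hC
      have h := (Finset.mem_powersetCard.1 hC).2
      rw [← hS.det_cycleMatrix_sq _ (hex C h).some]
      congr 3
      ext e
      exact hemb C h e
    rw [Finset.sum_congr rfl this, ← Finset.sum_filter, Finset.sum_const, nsmul_eq_mul, mul_one,
      numSpanningTrees, Set.ncard_eq_toFinset_card']
    congr 1
    refine Finset.card_bij (fun C _ => Cᶜ) ?_ ?_ ?_
    · intro C hC
      simpa using (Finset.mem_filter.1 hC).2
    · intro C _ C' _ h
      exact compl_injective h
    · intro C hC
      have hC' : G.IsSpanningTree C := by simpa using hC
      refine ⟨Cᶜ, ?_, compl_compl C⟩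
      rw [Finset.mem_filter, Finset.mem_powersetCard, compl_compl, Finset.card_compl, hk]
      have h1 := hC'.2
      have h2 := hS.2
      refine ⟨⟨Finset.subset_univ _, by congr 1; omega⟩, hC'⟩
  · intro C hC e e' h
    rw [hemb C hC, hemb C hC] at h
    exact (hex C hC).some.injective (Subtype.ext h)
  · intro C hC
    ext e
    simp only [Finset.mem_image, Finset.mem_univ, true_and, hemb C hC]
    constructor
    · rintro ⟨e', rfl⟩
      simpa using ((hex C hC).some e').2
    · intro he
      exact ⟨(hex C hC).some.symm ⟨e, by simpa using he⟩, by simp⟩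

theorem numSpanningTrees_pos {S : Finset G.E} (hS : G.IsSpanningTree S) :
    0 < G.numSpanningTrees :=
  (Set.ncard_pos (Set.toFinite _)).2 ⟨S, hS⟩

open MeasureTheory

open Classical in
/-- The basis of the space of divergence-free flows made of the fundamental cycles. -/
def basis {S : Finset G.E} (hS : G.IsSpanningTree S) :
    Module.Basis {e // e ∉ S} ℝ (LinearMap.ker G.div) :=
  (Pi.basisFun ℝ _).map hS.secEquiv

open Classical in
theorem basis_apply {S : Finset G.E} (hS : G.IsSpanningTree S) (e : {e // e ∉ S}) :
    (hS.basis e : G.Flow) = ofInt (hS.cycle e) := by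
  simp only [basis, Module.Basis.map_apply, Pi.basisFun_apply]
  change hS.sec _ = _
  rw [sec_eq, Finset.sum_eq_single e]
  · simp
  · intro e' _ h
    simp [h]
  · simp

open Classical in
-- The coordinate measure is the Haar measure giving volume 1 to the parallelepiped of the
-- fundamental cycles.
theorem map_secEquiv {S : Finset G.E} (hS : G.IsSpanningTree S) :
    (volume : Measure ({e // e ∉ S} → ℝ)).map hS.secEquiv = hS.basis.addHaar := by
  have := Module.Basis.map_addHaar (Pi.basisFun ℝ {e // e ∉ S})
    hS.secEquiv.toContinuousLinearEquiv
  rw [Module.Basis.addHaar_def, Module.Basis.parallelepiped_basisFun,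
    addHaarMeasure_eq_volume_pi] at this
  exact this

open Classical in
-- The square of the change-of-basis determinant is the Gram determinant of the fundamental cycles,
-- which counts spanning trees.
theorem det_sq {S : Finset G.E} (hS : G.IsSpanningTree S)
    (o : OrthonormalBasis {e // e ∉ S} ℝ (LinearMap.ker G.div)) :
    (o.toBasis.det hS.basis) ^ 2 = G.numSpanningTrees := by
  have h := Matrix.gram_eq_conjTranspose_mul o hS.basis
  have hm : (Matrix.of fun i j => o.repr (hS.basis j) i) = o.toBasis.toMatrix hS.basis := by
    ext i j
    simp [Module.Basis.toMatrix_apply]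
  rw [hm] at h
  have h2 := congrArg Matrix.det h
  rw [Matrix.det_mul, Matrix.det_conjTranspose, star_trivial, ← sq] at h2
  rw [Module.Basis.det_apply, ← h2]
  have h3 : Matrix.gram ℝ hS.basis =
      (hS.cycleMatrix.transpose * hS.cycleMatrix).map (Int.cast : ℤ → ℝ) := by
    ext i j
    rw [Matrix.gram_apply, Submodule.coe_inner, basis_apply, basis_apply, PiLp.inner_apply]
    simp [Matrix.mul_apply, cycleMatrix, mul_comm]
  rw [h3, ← Int.cast_det, hS.det_cycleMatrix]
  simp

open Classical in
-- The covolume of the lattice of fundamental cycles is exactly the factor by which `vol` divides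
-- Lebesgue measure.
theorem volume_ker {S : Finset G.E} (hS : G.IsSpanningTree S) :
    (volume : Measure (LinearMap.ker G.div)) =
      ENNReal.ofReal √(G.numSpanningTrees : ℝ) •
        (volume : Measure ({e // e ∉ S} → ℝ)).map hS.secEquiv := by
  have hfr : Module.finrank ℝ (LinearMap.ker G.div) = Fintype.card {e // e ∉ S} := by
    rw [← hS.secEquiv.finrank_eq, Module.finrank_pi]
  let o : OrthonormalBasis {e // e ∉ S} ℝ (LinearMap.ker G.div) :=
    (stdOrthonormalBasis ℝ (LinearMap.ker G.div)).reindex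
      (Fintype.equivOfCardEq (by rw [Fintype.card_fin, hfr]))
  rw [map_secEquiv, ← o.addHaar_eq_volume, Module.Basis.addHaar_def hS.basis]
  nth_rewrite 1 [Measure.addHaarMeasure_unique o.toBasis.addHaar hS.basis.parallelepiped]
  congr 1
  rw [Module.Basis.coe_parallelepiped, Measure.addHaar_parallelepiped, ← Real.sqrt_sq_eq_abs,
    hS.det_sq]

end IsSpanningTree

open MeasureTheory

/-- The base point in `lebesgue` is an arbitrary choice. Any other one differs from it by a
divergence-free flow, and the measure on the kernel is translation invariant. -/
theorem lebesgue_apply (ω₀ : G.Flow) (A : Set G.Flow) :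
    G.lebesgue (G.div ω₀) A =
      (volume : Measure (LinearMap.ker G.div)) {x | ω₀ + (x : G.Flow) ∈ A} := by
  have h : ∃ ω : G.Flow, G.div ω = G.div ω₀ := ⟨ω₀, rfl⟩
  rw [lebesgue, dif_pos h]
  have hemb : MeasurableEmbedding (fun x : LinearMap.ker G.div => h.choose + (x : G.Flow)) :=
    (measurableEmbedding_addLeft _).comp
      (MeasurableEmbedding.subtype_coe (Submodule.closed_of_finiteDimensional _).measurableSet)
  rw [hemb.map_apply]
  let d : LinearMap.ker G.div :=
    ⟨h.choose - ω₀, by rw [LinearMap.mem_ker, map_sub, h.choose_spec, sub_self]⟩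
  rw [← measure_preimage_add volume d {x : LinearMap.ker G.div | ω₀ + (x : G.Flow) ∈ A}]
  congr 1
  ext x
  simp only [Set.mem_preimage, Set.mem_ofPred_eq, Submodule.coe_add, d]
  rw [← add_assoc, add_sub_cancel]

open Classical in
/-- The volume, computed in the coordinates given by the edges outside a spanning tree. -/
theorem IsSpanningTree.vol_apply {S : Finset G.E} (hS : G.IsSpanningTree S) (ω₀ : G.Flow)
    (A : Set G.Flow) :
    G.vol (G.div ω₀) A =
      (volume : Measure ({e // e ∉ S} → ℝ)) {x | ω₀ + hS.sec x ∈ A} := by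
  have hpos : ENNReal.ofReal √(G.numSpanningTrees : ℝ) ≠ 0 := by
    have := hS.numSpanningTrees_pos
    simp only [ne_eq, ENNReal.ofReal_eq_zero, not_le]
    positivity
  rw [vol, Measure.smul_apply, lebesgue_apply, hS.volume_ker, Measure.smul_apply, smul_eq_mul,
    smul_eq_mul, ← mul_assoc, ENNReal.inv_mul_cancel hpos ENNReal.ofReal_ne_top, one_mul]
  exact hS.secEquiv.toContinuousLinearEquiv.toHomeomorph.measurableEmbedding.map_apply _ _

end FinGraph

end Honey

end

/-! ### Merging leaves of a graph and disintegrating the volume -/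

noncomputable section

namespace Honey

namespace FinGraph

open MeasureTheory

variable {G : FinGraph}

/-- The graph obtained by merging vertices. -/
abbrev quot (G : FinGraph) {V' : Type} (q : G.V → V') : FinGraph where
  V := V'
  E := G.E
  src e := q (G.src e)
  tgt e := q (G.tgt e)

open Classical in
-- Summation by parts against the indicator of the fibre of `q` over `v'`.
theorem div_quot [Fintype G.V] {V' : Type} (q : G.V → V') (ω : G.Flow) (v' : V') :
    (G.quot q).div ω v' = ∑ v, if q v = v' then G.div ω v else 0 := by
  have h := sum_mul_div (fun v => if q v = v' then (1 : ℝ) else 0) ω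
  simp only [ite_mul, one_mul, zero_mul] at h
  rw [h, div_apply]
  refine Finset.sum_congr rfl fun e _ => ?_
  simp only [quot]
  split_ifs <;> simp

theorem div_quot_eq_zero [Finite G.V] {V' : Type} (q : G.V → V') {ω : G.Flow} (h : G.div ω = 0) :
    (G.quot q).div ω = 0 := by
  classical
  have := Fintype.ofFinite G.V
  ext v'
  rw [div_quot]
  exact Finset.sum_eq_zero fun v _ => by simp [h]

theorem IsConn.quot (h : G.IsConn) {V' : Type} {q : G.V → V'} (hq : Function.Surjective q) :
    (G.quot q).IsConn := by
  have hne := h.nonempty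
  rw [IsConn, SimpleGraph.connected_iff]
  refine ⟨fun a b => ?_, hne.map q⟩
  obtain ⟨a, rfl⟩ := hq a
  obtain ⟨b, rfl⟩ := hq b
  have := eq_of_spanned_reachable (S := Set.univ)
    (fun v => ((G.quot q).spanned Set.univ).connectedComponentMk (q v))
    (fun e _ => SimpleGraph.ConnectedComponent.sound
      (spanned_reachable (G := G.quot q) (Set.mem_univ e))) (h.preconnected a b)
  exact SimpleGraph.ConnectedComponent.exact this

/-- A merging of the leaves `v k` with the vertices `w k`, where `e k` is the edge at `v k`. -/
structure LeafMerging (G : FinGraph) {V' : Type} (q : G.V → V') (n : ℕ) where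
  v : Fin n → G.V
  w : Fin n → G.V
  e : Fin n → G.E
  σ : Fin n → ℝ
  v_injective : Function.Injective v
  e_injective : Function.Injective e
  w_notMem : ∀ k l, w k ≠ v l
  surjective : Function.Surjective q
  merge : ∀ a b, q a = q b ↔ a = b ∨ (∃ k, a = v k ∧ b = w k) ∨ ∃ k, a = w k ∧ b = v k
  sq_eq : ∀ k, σ k = 1 ∨ σ k = -1
  div_leaf : ∀ k (ω : G.Flow), G.div ω (v k) = σ k * ω (e k)

namespace LeafMerging

variable {V' : Type} {q : G.V → V'} {n : ℕ}

theorem sq (m : LeafMerging G q n) (k : Fin n) : m.σ k * m.σ k = 1 := by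
  rcases m.sq_eq k with h | h <;> simp [h]

theorem merge_eq (m : LeafMerging G q n) (k : Fin n) : q (m.v k) = q (m.w k) :=
  (m.merge _ _).2 (Or.inr (Or.inl ⟨k, rfl, rfl⟩))

/-- The divergence of the merged graph at a class is the sum over its members. With no flow through
the leaf edges the leaves contribute nothing, so each other member has divergence zero as well. -/
theorem div_eq_zero [Finite G.V] (m : LeafMerging G q n) {ω : G.Flow}
    (h : (G.quot q).div ω = 0) (he : ∀ k, ω (m.e k) = 0) : G.div ω = 0 := by
  classical
  have := Fintype.ofFinite G.V
  have hv : ∀ k, G.div ω (m.v k) = 0 := fun k => by rw [m.div_leaf, he, mul_zero]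
  ext a
  by_cases ha : ∃ k, a = m.v k
  · obtain ⟨k, rfl⟩ := ha
    exact hv k
  have h0 := congrFun h (q a)
  rw [div_quot] at h0
  refine Eq.trans ?_ h0
  rw [Finset.sum_eq_single a]
  · simp
  · intro b _ hb
    split_ifs with hq
    · rcases (m.merge _ _).1 hq with h2 | ⟨j, h2, h3⟩ | ⟨j, h2, h3⟩
      · exact absurd h2 hb
      · rw [h2, hv]
      · exact absurd ⟨j, h3⟩ ha
    · rfl
  · simp

/-- Every class has a representative that is not one of the `n` leaves. The reverse inequality
follows later from a count of dimensions. -/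
theorem card_le [Finite G.V] (m : LeafMerging G q n) : Nat.card V' + n ≤ Nat.card G.V := by
  classical
  have := Fintype.ofFinite G.V
  have hs : Function.Surjective fun a : {a : G.V // a ∉ Finset.univ.image m.v} => q a := by
    intro b
    obtain ⟨a, rfl⟩ := m.surjective b
    by_cases ha : ∃ k, m.v k = a
    · obtain ⟨k, rfl⟩ := ha
      exact ⟨⟨m.w k, by simpa using fun l h => m.w_notMem k l h.symm⟩, (m.merge_eq k).symm⟩
    · exact ⟨⟨a, by simpa using ha⟩, rfl⟩
  have h1 := Nat.card_le_card_of_surjective _ hs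
  rw [Nat.card_eq_fintype_card (α := {a : G.V // a ∉ Finset.univ.image m.v}),
    Fintype.card_subtype_compl, Fintype.card_coe,
    Finset.card_image_of_injective _ m.v_injective, Finset.card_univ, Fintype.card_fin] at h1
  have h2 : n ≤ Fintype.card G.V := by
    simpa using Fintype.card_le_of_injective _ m.v_injective
  rw [Nat.card_eq_fintype_card (α := G.V)]
  omega

/-- Otherwise some divergence-free flow would take the value 1 on the leaf edge, and its divergence
at the leaf would be ±1. -/
theorem mem_of_isSpanningTree (m : LeafMerging G q n) {S : Finset G.E} (hS : G.IsSpanningTree S)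
    (k : Fin n) : m.e k ∈ S := by
  classical
  by_contra h
  have h1 := m.div_leaf k (hS.sec (Pi.single ⟨m.e k, h⟩ 1))
  rw [hS.div_sec, hS.sec_apply _ ⟨m.e k, h⟩] at h1
  rcases m.sq_eq k with h2 | h2 <;> simp [h2] at h1

open Classical in
/-- The spanning tree of the merged graph obtained by removing the edges at the leaves. -/
def tree (m : LeafMerging G q n) (S : Finset G.E) : Finset G.E :=
  S \ Finset.univ.image m.e

/-- A divergence-free flow of the merged graph is determined by its `n` leaf values up to a
divergence-free flow of `G`. With `card_le`, this forces merging to remove exactly `n` vertices, so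
the reduced tree has the right cardinality; a divergence-free flow supported on it vanishes on the
leaf edges, hence is divergence-free on `G` and supported on `S`. -/
theorem isSpanningTree_tree [Finite G.V] (m : LeafMerging G q n) (hG : G.IsConn)
    {S : Finset G.E} (hS : G.IsSpanningTree S) : (G.quot q).IsSpanningTree (m.tree S) := by
  classical
  have hsub : Finset.univ.image m.e ⊆ S := by
    intro e he
    simp only [Finset.mem_image, Finset.mem_univ, true_and] at he
    obtain ⟨k, rfl⟩ := he
    exact m.mem_of_isSpanningTree hS k
  have hcard : (m.tree S).card + n = S.card := by
    have h1 := Finset.card_sdiff_add_card_eq_card hsub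
    rw [Finset.card_image_of_injective _ m.e_injective, Finset.card_univ, Fintype.card_fin] at h1
    exact h1
  have hV' : Finite V' := Finite.of_surjective _ m.surjective
  have : Finite (G.quot q).V := hV'
  obtain ⟨S'', hS''⟩ := (hG.quot m.surjective).exists_isSpanningTree
  have h1 := hS''.finrank_ker
  have h2 := hS.finrank_ker
  have h3 : Module.finrank ℝ (LinearMap.ker (G.quot q).div) ≤
      n + Module.finrank ℝ (LinearMap.ker G.div) := by
    let P : LinearMap.ker (G.quot q).div →ₗ[ℝ] (Fin n → ℝ) :=
      { toFun := fun ω k => ω.1 (m.e k)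
        map_add' := fun _ _ => rfl
        map_smul' := fun _ _ => rfl }
    rw [← P.finrank_range_add_finrank_ker]
    refine Nat.add_le_add ?_ ?_
    · simpa using Submodule.finrank_le (LinearMap.range P)
    · let J : LinearMap.ker P →ₗ[ℝ] LinearMap.ker G.div :=
        { toFun := fun ω => ⟨ω.1.1, m.div_eq_zero ω.1.2 fun k => congrFun ω.2 k⟩
          map_add' := fun _ _ => rfl
          map_smul' := fun _ _ => rfl }
      refine LinearMap.finrank_le_finrank_of_injective (f := J) fun a b h => ?_
      have := congrArg (fun x : LinearMap.ker G.div => x.1) h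
      exact Subtype.ext (Subtype.ext this)
  have h4 : Nat.card (G.quot q).V = Nat.card V' := rfl
  have h5 : Fintype.card (G.quot q).E = Fintype.card G.E := rfl
  have h6 := m.card_le
  have h7 := hS.2
  refine isSpanningTree_of_forall (by omega) fun ω hd hz => ?_
  have he : ∀ k, ω (m.e k) = 0 := fun k => hz _ (by simp [tree])
  refine hS.eq_zero (m.div_eq_zero hd he) fun e h => hz e fun h' => h ?_
  exact (Finset.mem_sdiff.1 h').1

open Classical in
/-- The edges outside the tree of the merged graph. -/
def edgeEquiv (m : LeafMerging G q n) {S : Finset G.E} (hS : G.IsSpanningTree S) :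
    Fin n ⊕ {e // e ∉ S} ≃ {e // e ∉ m.tree S} :=
  Equiv.ofBijective
    (Sum.elim (fun k => ⟨m.e k, by simp [tree]⟩) fun e => ⟨e, fun h =>
      e.2 (Finset.mem_sdiff.1 h).1⟩) (by
    constructor
    · rintro (k | e) (l | e') h
      · exact congrArg _ (m.e_injective (Subtype.ext_iff.1 h))
      · have h' : m.e k = e' := Subtype.ext_iff.1 h
        exact absurd (m.mem_of_isSpanningTree hS k) (by rw [h']; exact e'.2)
      · have h' : (e : G.E) = m.e l := Subtype.ext_iff.1 h
        exact absurd (m.mem_of_isSpanningTree hS l) (by rw [← h']; exact e.2)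
      · exact congrArg _ (Subtype.ext (by have := Subtype.ext_iff.1 h; exact this))
    · rintro ⟨e, he⟩
      by_cases h : e ∈ S
      · have : ∃ k, m.e k = e := by simpa [tree, h] using he
        obtain ⟨k, rfl⟩ := this
        exact ⟨Sum.inl k, rfl⟩
      · exact ⟨Sum.inr ⟨e, h⟩, rfl⟩)

open Classical in
/-- Coordinates on the divergence-free flows of the merged graph. -/
def coordEquiv (m : LeafMerging G q n) {S : Finset G.E} (hS : G.IsSpanningTree S) :
    (Fin n → ℝ) × ({e // e ∉ S} → ℝ) ≃ᵐ ({e // e ∉ m.tree S} → ℝ) :=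
  (MeasurableEquiv.sumPiEquivProdPi fun _ : Fin n ⊕ {e // e ∉ S} => ℝ).symm.trans
    (MeasurableEquiv.piCongrLeft (fun _ => ℝ) (m.edgeEquiv hS))

open Classical in
theorem measurePreserving_coordEquiv (m : LeafMerging G q n) {S : Finset G.E}
    (hS : G.IsSpanningTree S) : MeasurePreserving (m.coordEquiv hS) volume volume :=
  (volume_measurePreserving_sumPiEquivProdPi_symm _).trans
    (volume_measurePreserving_piCongrLeft (fun _ => ℝ) (m.edgeEquiv hS))

theorem coordEquiv_leaf (m : LeafMerging G q n) {S : Finset G.E} (hS : G.IsSpanningTree S)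
    (y : Fin n → ℝ) (x : {e // e ∉ S} → ℝ) (k : Fin n) (h : m.e k ∉ m.tree S) :
    m.coordEquiv hS (y, x) ⟨m.e k, h⟩ = y k :=
  Equiv.piCongrLeft_apply_apply (fun _ => ℝ) (m.edgeEquiv hS) _ (Sum.inl k)

theorem coordEquiv_of_notMem (m : LeafMerging G q n) {S : Finset G.E} (hS : G.IsSpanningTree S)
    (y : Fin n → ℝ) (x : {e // e ∉ S} → ℝ) (e : {e // e ∉ S}) (h : (e : G.E) ∉ m.tree S) :
    m.coordEquiv hS (y, x) ⟨e, h⟩ = x e :=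
  Equiv.piCongrLeft_apply_apply (fun _ => ℝ) (m.edgeEquiv hS) _ (Sum.inr e)

/-- Disintegration of the volume of a merged graph along the values of the flow at the leaves. -/
theorem exists_disintegration [Finite G.V] (m : LeafMerging G q n) (hG : G.IsConn)
    {A : Set G.Flow} (hA : MeasurableSet A) (ω₀ : G.Flow) (c : Fin n → ℝ) :
    ∃ F : (Fin n → ℝ) → ℝ≥0∞, Measurable F ∧
      (G.quot q).vol ((G.quot q).div ω₀) A = ∫⁻ u, F u ∧
      (∀ u, (∀ ω ∈ A, (G.quot q).div ω = (G.quot q).div ω₀ →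
        ¬ ∀ k, G.div ω (m.v k) = c k - u k) → F u = 0) ∧
      ∀ u (ω₁ : G.Flow), (G.quot q).div ω₁ = (G.quot q).div ω₀ →
        (∀ k, G.div ω₁ (m.v k) = c k - u k) →
        F u = G.vol (G.div ω₁) {ω ∈ A | ∀ k, G.div ω (m.v k) = c k - u k} := by
  classical
  obtain ⟨S, hS⟩ := hG.exists_isSpanningTree
  have hS' := m.isSpanningTree_tree hG hS
  have hnot : ∀ k, m.e k ∉ m.tree S := fun k => by simp [tree]
  have hnot' : ∀ e : {e // e ∉ S}, (e : G.E) ∉ m.tree S := fun e h =>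
    e.2 (Finset.mem_sdiff.1 h).1
  -- Coordinates around `ω₀`: the first factor moves the flow on the leaf edges, the second the flow
  -- on the edges outside `S`.
  set Φ : (Fin n → ℝ) × ({e // e ∉ S} → ℝ) → G.Flow :=
    fun p => ω₀ + hS'.sec (m.coordEquiv hS p) with hΦ
  have hΦm : Measurable Φ := by
    have : Measurable hS'.sec := (LinearMap.continuous_of_finiteDimensional hS'.sec).measurable
    exact (this.comp (m.coordEquiv hS).measurable).const_add ω₀
  have hΦdiv : ∀ p, (G.quot q).div (Φ p) = (G.quot q).div ω₀ := fun p => by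
    have := map_add (G.quot q).div ω₀ (hS'.sec (m.coordEquiv hS p))
    rw [hS'.div_sec, add_zero] at this
    exact this
  have hΦe : ∀ y x k, Φ (y, x) (m.e k) = ω₀ (m.e k) + y k := fun y x k => by
    have h1 := hS'.sec_apply (m.coordEquiv hS (y, x)) ⟨m.e k, hnot k⟩
    rw [coordEquiv_leaf] at h1
    rw [hΦ, PiLp.add_apply, ← h1]
  -- `T u` is the displacement on the leaf edges that makes the divergence at `v k` equal to `c k -
  -- u k`. As `σ k = ±1`, each component is a reflection or a translation of the line, so Lebesgue
  -- measure is preserved.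
  let T : (Fin n → ℝ) → Fin n → ℝ := fun u k => m.σ k * (c k - u k) - ω₀ (m.e k)
  have hT : MeasurePreserving T volume volume := by
    refine volume_preserving_pi (f := fun k t => m.σ k * (c k - t) - ω₀ (m.e k)) fun k => ?_
    rcases m.sq_eq k with h | h
    · have h1 := Measure.measurePreserving_sub_left (volume : Measure ℝ) (c k - ω₀ (m.e k))
      convert! h1 using 2
      rw [h]; ring
    · have h1 := measurePreserving_add_right (volume : Measure ℝ) (-c k - ω₀ (m.e k))
      convert! h1 using 2
      rw [h]; ring
  have hTu : ∀ u (ω : G.Flow), (∀ k, G.div ω (m.v k) = c k - u k) ↔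
      ∀ k, ω (m.e k) = ω₀ (m.e k) + T u k := by
    intro u ω
    refine forall_congr' fun k => ?_
    rw [m.div_leaf]
    have := m.sq k
    simp only [T]
    constructor
    · intro h
      rw [← h, ← mul_assoc, this]; ring
    · intro h
      rw [h, add_sub_cancel, ← mul_assoc, this, one_mul]
  have hmeas : MeasurableSet (Φ ⁻¹' A) := hΦm hA
  have hF : Measurable fun y : Fin n → ℝ =>
      (volume : Measure ({e // e ∉ S} → ℝ)) (Prod.mk y ⁻¹' (Φ ⁻¹' A)) :=
    measurable_measure_prodMk_left hmeas
  refine ⟨fun u => volume (Prod.mk (T u) ⁻¹' (Φ ⁻¹' A)), hF.comp hT.measurable, ?_, ?_, ?_⟩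
  -- Tonelli in the product coordinates, then the change of variables `T`.
  · rw [hS'.vol_apply]
    have h1 := (m.measurePreserving_coordEquiv hS).measure_preimage_equiv
      {x | ω₀ + hS'.sec x ∈ A}
    refine h1.symm.trans ?_
    rw [Measure.volume_eq_prod]
    refine (Measure.prod_apply hmeas).trans ?_
    exact (hT.lintegral_comp hF).symm
  · intro u hu
    have : Prod.mk (T u) ⁻¹' (Φ ⁻¹' A) = ∅ := by
      ext x
      simp only [Set.mem_preimage, Set.mem_empty_iff_false, iff_false]
      intro hx
      exact hu _ hx (hΦdiv _) ((hTu u _).2 (hΦe _ _))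
    simp only [this, measure_empty]
  · intro u ω₁ hω₁ hu
    rw [hS.vol_apply]
    -- The two volumes are computed from different base points, `ω₀` and `ω₁`. Their difference in
    -- the coordinates outside `S` is absorbed by translation invariance.
    let x₁ : {e // e ∉ S} → ℝ := fun e => ω₁ e - ω₀ e
    have key : ∀ x, Φ (T u, x₁ + x) = ω₁ + hS.sec x := by
      intro x
      have hd : (G.quot q).div (ω₁ + hS.sec x - ω₀) = 0 := by
        have h1 := map_sub (G.quot q).div (ω₁ + hS.sec x) ω₀
        have h2 := map_add (G.quot q).div ω₁ (hS.sec x)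
        have h3 := div_quot_eq_zero q (hS.div_sec x)
        exact h1.trans (by rw [h2, h3, hω₁, add_zero, sub_self])
      have h1 := hS'.eq_sec hd
      have h2 : m.coordEquiv hS (T u, x₁ + x) =
          fun e : {e // e ∉ m.tree S} => (ω₁ + hS.sec x - ω₀) e := by
        funext e
        obtain ⟨(k | e'), rfl⟩ := (m.edgeEquiv hS).surjective e
        · refine (m.coordEquiv_leaf hS (T u) (x₁ + x) k (hnot k)).trans ?_
          change _ = ω₁ (m.e k) + hS.sec x (m.e k) - ω₀ (m.e k)
          have h3 := (hTu u ω₁).1 hu k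
          have h4 := m.div_leaf k (hS.sec x)
          rw [hS.div_sec, Pi.zero_apply] at h4
          have h5 : hS.sec x (m.e k) = 0 := by
            have := m.sq k
            have h6 : m.σ k * (m.σ k * hS.sec x (m.e k)) = 0 := by rw [← h4, mul_zero]
            rwa [← mul_assoc, this, one_mul] at h6
          rw [h3, h5]; ring
        · refine (m.coordEquiv_of_notMem hS (T u) (x₁ + x) e' (hnot' e')).trans ?_
          change _ = ω₁ e' + hS.sec x e' - ω₀ e'
          rw [hS.sec_apply]
          simp only [Pi.add_apply, x₁]; ring
      change ω₀ + hS'.sec (m.coordEquiv hS (T u, x₁ + x)) = _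
      rw [h2]
      have h3 : hS'.sec (fun e : {e // e ∉ m.tree S} => (ω₁ + hS.sec x - ω₀) e) =
        ω₁ + hS.sec x - ω₀ := h1
      have h4 := congrArg (fun z : G.Flow => ω₀ + z) h3
      exact h4.trans (add_sub_cancel ω₀ (ω₁ + hS.sec x))
    beta_reduce
    rw [← measure_preimage_add volume x₁ (Prod.mk (T u) ⁻¹' (Φ ⁻¹' A))]
    refine congrArg _ (Set.ext fun x => ?_)
    simp only [Set.mem_preimage, Set.mem_ofPred_eq]
    rw [key x]
    refine (and_iff_left ?_).symm
    rw [hTu, ← key x]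
    exact hΦe _ _

end LeafMerging

end FinGraph

end Honey

end

/-! ### Invariance of the volume under graph isomorphisms -/

noncomputable section

namespace Honey

namespace FinGraph

open MeasureTheory

theorem volOf_empty (G : FinGraph) : G.volOf ∅ = 0 :=
  dif_neg Set.not_nonempty_empty

theorem volOf_eq {G : FinGraph} {A : Set G.Flow} {ω₀ : G.Flow} (h₀ : ω₀ ∈ A)
    (h : ∀ ω ∈ A, G.div ω = G.div ω₀) : G.volOf A = G.vol (G.div ω₀) A := by
  have hne : A.Nonempty := ⟨ω₀, h₀⟩
  rw [volOf, dif_pos hne, h _ hne.some_mem]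

/-- Isomorphisms of finite graphs, which may reverse the reference orientation of some edges;
`σ e = -1` for these edges. -/
structure FlipIso (G H : FinGraph) where
  eV : G.V ≃ H.V
  eE : G.E ≃ H.E
  σ : G.E → ℝ
  spec : ∀ e, (σ e = 1 ∧ H.src (eE e) = eV (G.src e) ∧ H.tgt (eE e) = eV (G.tgt e)) ∨
    (σ e = -1 ∧ H.src (eE e) = eV (G.tgt e) ∧ H.tgt (eE e) = eV (G.src e))

namespace FlipIso

variable {G H : FinGraph} (Φ : FlipIso G H)

theorem sq (e : G.E) : Φ.σ e * Φ.σ e = 1 := by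
  rcases Φ.spec e with h | h <;> simp [h.1]

theorem sym2_eq (e : G.E) : s(H.src (Φ.eE e), H.tgt (Φ.eE e)) =
    Sym2.map Φ.eV s(G.src e, G.tgt e) := by
  rcases Φ.spec e with h | h
  · rw [h.2.1, h.2.2, Sym2.map_mk]
  · rw [h.2.1, h.2.2, Sym2.map_mk, Sym2.eq_swap]

/-- The induced isometry between the spaces of flows. -/
def flow : G.Flow ≃ₗᵢ[ℝ] H.Flow where
  toFun ω := WithLp.toLp 2 fun e => Φ.σ (Φ.eE.symm e) * ω (Φ.eE.symm e)
  map_add' ω ω' := by ext e; simp [mul_add]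
  map_smul' r ω := by ext e; simp [mul_left_comm]
  invFun ω := WithLp.toLp 2 fun e => Φ.σ e * ω (Φ.eE e)
  left_inv ω := by
    ext e
    simp [← mul_assoc, Φ.sq]
  right_inv ω := by
    ext e
    simp [← mul_assoc, Φ.sq]
  norm_map' ω := by
    simp only [LinearEquiv.coe_mk, LinearMap.coe_mk, AddHom.coe_mk]
    rw [EuclideanSpace.norm_eq, EuclideanSpace.norm_eq]
    congr 1
    rw [← Equiv.sum_comp Φ.eE]
    refine Finset.sum_congr rfl fun e _ => ?_
    rcases Φ.spec e with h | h <;> simp [h.1]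

theorem flow_apply (ω : G.Flow) (e : G.E) : Φ.flow ω (Φ.eE e) = Φ.σ e * ω e := by
  change Φ.σ (Φ.eE.symm (Φ.eE e)) * ω (Φ.eE.symm (Φ.eE e)) = _
  rw [Equiv.symm_apply_apply]

theorem div_flow (ω : G.Flow) (v : G.V) : H.div (Φ.flow ω) (Φ.eV v) = G.div ω v := by
  classical
  rw [div_apply, div_apply, ← Equiv.sum_comp Φ.eE]
  refine Finset.sum_congr rfl fun e _ => ?_
  rw [flow_apply]
  rcases Φ.spec e with ⟨h1, h2, h3⟩ | ⟨h1, h2, h3⟩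
  · simp [h1, h2, h3]
  · rw [h1, h2, h3]
    simp only [EmbeddingLike.apply_eq_iff_eq]
    split_ifs <;> simp

theorem div_flow_eq_iff (ω ω' : G.Flow) :
    H.div (Φ.flow ω) = H.div (Φ.flow ω') ↔ G.div ω = G.div ω' := by
  constructor
  · intro h
    ext v
    rw [← Φ.div_flow, ← Φ.div_flow, h]
  · intro h
    ext v
    obtain ⟨v, rfl⟩ := Φ.eV.surjective v
    rw [Φ.div_flow, Φ.div_flow, h]

theorem isSpanningTree_iff (S : Finset G.E) :
    H.IsSpanningTree (S.map Φ.eE.toEmbedding) ↔ G.IsSpanningTree S := by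
  unfold IsSpanningTree
  rw [Finset.card_map, Nat.card_congr Φ.eV.symm]
  refine and_congr_left fun _ => ?_
  have : SimpleGraph.fromEdgeSet ((fun e => s(G.src e, G.tgt e)) '' (S : Set G.E)) =
      (SimpleGraph.fromEdgeSet ((fun e => s(H.src e, H.tgt e)) ''
        ((S.map Φ.eE.toEmbedding : Finset H.E) : Set H.E))).comap Φ.eV := by
    ext a b
    rw [SimpleGraph.comap_adj, SimpleGraph.fromEdgeSet_adj, SimpleGraph.fromEdgeSet_adj,
      Finset.coe_map, Set.image_image]
    simp only [Equiv.coe_toEmbedding, Φ.sym2_eq, Set.mem_image, Finset.mem_coe, ne_eq,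
      EmbeddingLike.apply_eq_iff_eq]
    refine and_congr_left fun _ => exists_congr fun e => and_congr_right fun _ => ?_
    rw [← Sym2.map_mk, (Sym2.map.injective Φ.eV.injective).eq_iff]
  rw [this]
  exact (SimpleGraph.Iso.connected_iff (SimpleGraph.Iso.comap Φ.eV _)).symm

theorem numSpanningTrees_eq {G H : FinGraph} (Φ : FlipIso G H) : H.numSpanningTrees = G.numSpanningTrees := by
  unfold numSpanningTrees
  symm
  refine Set.ncard_congr (fun S _ => S.map Φ.eE.toEmbedding) ?_ ?_ ?_
  · intro S hS
    exact (Φ.isSpanningTree_iff S).2 hS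
  · intro S S' _ _ h
    exact Finset.map_injective _ h
  · intro S hS
    refine ⟨S.map Φ.eE.symm.toEmbedding, ?_, ?_⟩
    · refine (Φ.isSpanningTree_iff _).1 ?_
      rw [Finset.map_map]
      simpa using hS
    · rw [Finset.map_map]
      simp

/-- The isometry between the spaces of divergence-free flows. -/
def kerFlow : LinearMap.ker G.div ≃ₗᵢ[ℝ] LinearMap.ker H.div where
  toFun ω := ⟨Φ.flow ω, by
    have := (Φ.div_flow_eq_iff ω 0).2 (by rw [map_zero]; exact ω.2)
    rw [LinearMap.mem_ker, this, map_zero, map_zero]⟩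
  map_add' ω ω' := by ext1; simp
  map_smul' r ω := by ext1; simp
  invFun ω := ⟨Φ.flow.symm ω, by
    have := (Φ.div_flow_eq_iff (Φ.flow.symm ω) 0).1 (by
      rw [LinearIsometryEquiv.apply_symm_apply, map_zero, map_zero]; exact ω.2)
    rw [LinearMap.mem_ker, this, map_zero]⟩
  left_inv ω := by ext1; simp
  right_inv ω := by ext1; simp
  norm_map' ω := Φ.flow.norm_map ω

theorem vol_image (ω₀ : G.Flow) (A : Set G.Flow) :
    H.vol (H.div (Φ.flow ω₀)) (Φ.flow '' A) = G.vol (G.div ω₀) A := by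
  rw [vol, vol, Measure.smul_apply, Measure.smul_apply, Φ.numSpanningTrees_eq, lebesgue_apply,
    lebesgue_apply]
  congr 1
  have h := Φ.kerFlow.measurePreserving.measure_preimage_equiv (f := Φ.kerFlow.toMeasurableEquiv)
    {x | Φ.flow ω₀ + (x : H.Flow) ∈ Φ.flow '' A}
  rw [← h]
  refine congrArg _ (Set.ext fun x => ?_)
  change Φ.flow ω₀ + Φ.flow x ∈ Φ.flow '' A ↔ ω₀ + (x : G.Flow) ∈ A
  rw [← map_add, Φ.flow.injective.mem_set_image]

theorem volOf_image {A : Set G.Flow} (h : ∀ ω ∈ A, ∀ ω' ∈ A, G.div ω = G.div ω') :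
    H.volOf (Φ.flow '' A) = G.volOf A := by
  rcases A.eq_empty_or_nonempty with rfl | ⟨ω₀, h₀⟩
  · rw [Set.image_empty, volOf_empty, volOf_empty]
  · rw [volOf_eq h₀ fun ω hω => h ω hω ω₀ h₀, volOf_eq (Set.mem_image_of_mem _ h₀), vol_image]
    rintro _ ⟨ω, hω, rfl⟩
    exact (Φ.div_flow_eq_iff _ _).2 (h ω hω ω₀ h₀)

end FlipIso

end FinGraph

end Honey

end

/-! ### Local geometry of triangular honeycombs -/

noncomputable section

namespace Honey

/-! ## Coordinates of the triangle -/

theorem sqrt_three_sq : √3 * √3 = 3 := Real.mul_self_sqrt (by norm_num)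

theorem sqrt_three_pos : 0 < √3 := by positivity

theorem dir_zero : dir 0 = (-1 / 2 : ℝ) + (√3 / 2 : ℝ) * Complex.I := by
  rw [dir, show (2 * Real.pi * Complex.I * (((0 : Fin 3) : ℕ) + 1) / 3 : ℂ) =
    ((Real.pi - Real.pi / 3 : ℝ) : ℂ) * Complex.I by push_cast [Fin.val_zero]; ring,
    Complex.exp_mul_I, ← Complex.ofReal_cos, ← Complex.ofReal_sin, Real.cos_pi_sub,
    Real.sin_pi_sub, Real.cos_pi_div_three, Real.sin_pi_div_three]
  push_cast; ring

theorem dir_one : dir 1 = (-1 / 2 : ℝ) + (-√3 / 2 : ℝ) * Complex.I := by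
  rw [dir, show (2 * Real.pi * Complex.I * (((1 : Fin 3) : ℕ) + 1) / 3 : ℂ) =
    ((Real.pi / 3 + Real.pi : ℝ) : ℂ) * Complex.I by push_cast [Fin.val_one]; ring,
    Complex.exp_mul_I, ← Complex.ofReal_cos, ← Complex.ofReal_sin, Real.cos_add_pi,
    Real.sin_add_pi, Real.cos_pi_div_three, Real.sin_pi_div_three]
  push_cast; ring

theorem dir_two : dir 2 = 1 := by
  rw [dir, show (2 * Real.pi * Complex.I * (((2 : Fin 3) : ℕ) + 1) / 3 : ℂ) =
    2 * Real.pi * Complex.I by push_cast [Fin.val_two]; ring, Complex.exp_two_pi_mul_I]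

/-- The horizontal coordinate of `dir l`. -/
def dirRe (l : Fin 3) : ℝ := ![-1 / 2, -1 / 2, 1] l

/-- The vertical coordinate of `dir l`. -/
def dirIm (l : Fin 3) : ℝ := ![√3 / 2, -√3 / 2, 0] l

theorem dir_re (l : Fin 3) : (dir l).re = dirRe l := by
  fin_cases l <;> simp [dir_zero, dir_one, dir_two, dirRe]

theorem dir_im (l : Fin 3) : (dir l).im = dirIm l := by
  fin_cases l <;> simp [dir_zero, dir_one, dir_two, dirIm]

/-- The derivative of the `k`-th coordinate in the direction `dir l`. -/
def slope (k l : Fin 3) : ℝ := if k = l then 0 else if k = l + 1 then -1 else 1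

theorem slope_self (l : Fin 3) : slope l l = 0 := by simp [slope]

theorem slope_add_one (l : Fin 3) : slope (l + 1) l = -1 := by
  fin_cases l <;> simp [slope]

theorem slope_add_two (l : Fin 3) : slope (l + 2) l = 1 := by
  fin_cases l <;> simp [slope]

theorem coord_add_mul_dir (k l : Fin 3) (v : ℂ) (r : ℝ) :
    coord k (v + r * dir l) = coord k v + r * slope k l := by
  have h3 : √3 ≠ 0 := sqrt_three_pos.ne'
  fin_cases k <;> fin_cases l <;>
    simp [coord, slope, dir_zero, dir_one, dir_two] <;> field_simp <;> ring

theorem add_mul_dir_re (l : Fin 3) (v : ℂ) (r : ℝ) :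
    (v + r * dir l).re = v.re + r * dirRe l := by
  rw [Complex.add_re, Complex.re_ofReal_mul, dir_re]

theorem re_eq_coord (v : ℂ) : v.re = coord 1 v + coord 2 v / 2 := by
  have h3 : √3 ≠ 0 := sqrt_three_pos.ne'
  simp [coord]; field_simp; ring

theorem im_eq_coord (v : ℂ) : v.im = √3 / 2 * coord 2 v := by
  have h3 : √3 ≠ 0 := sqrt_three_pos.ne'
  simp [coord]

theorem coord_sum_cyclic (i : Fin 3) (v : ℂ) :
    coord i v + coord (i + 1) v + coord (i + 2) v = 1 := by
  have := coord_sum v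
  fin_cases i
  · change coord 0 v + coord 1 v + coord 2 v = 1
    linarith
  · change coord 1 v + coord 2 v + coord 0 v = 1
    linarith
  · change coord 2 v + coord 0 v + coord 1 v = 1
    linarith

theorem coord_ext {v w : ℂ} (i j : Fin 3) (hij : i ≠ j) (hi : coord i v = coord i w)
    (hj : coord j v = coord j w) : v = w := by
  have h : ∀ k, coord k v = coord k w := by
    have hv := coord_sum v
    have hw := coord_sum w
    intro k
    fin_cases i <;> fin_cases j <;> fin_cases k <;> simp_all
  rw [eq_coord v, eq_coord w, h 1, h 2]

theorem coord_nonneg_of_mem {v : ℂ} (h : v ∈ triangle) (k : Fin 3) : 0 ≤ coord k v := by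
  have h3 : √3 ≠ 0 := sqrt_three_pos.ne'
  obtain ⟨x, y, hx, -, hy, -, hxy, rfl⟩ := h
  rw [exp_pi_div_three]
  fin_cases k
  · have : (1 - (x + y / 2) - y * (√3 / 2) / √3) = 1 - x - y := by field_simp; ring
    simp [coord]
    rw [show y * 2⁻¹ = y / 2 by ring]
    linarith
  · have : (x + y / 2) - y * (√3 / 2) / √3 = x := by field_simp; ring
    simp [coord]
    rw [show y * 2⁻¹ = y / 2 by ring]
    linarith
  · have : 2 * (y * (√3 / 2)) / √3 = y := by field_simp
    simp [coord]
    linarith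

theorem mem_triangle_iff (v : ℂ) : v ∈ triangle ↔ ∀ k, 0 ≤ coord k v := by
  refine ⟨coord_nonneg_of_mem, fun h => ⟨coord 1 v, coord 2 v, ?_⟩⟩
  have := coord_sum v
  have h0 := h 0
  have h1 := h 1
  have h2 := h 2
  exact ⟨h1, by linarith, h2, by linarith, by linarith, eq_coord v⟩

theorem coord_lineMap (k : Fin 3) (v w : ℂ) (a b : ℝ) (hab : a + b = 1) :
    coord k (a • v + b • w) = a * coord k v + b * coord k w := by
  have ha : a = 1 - b := by linarith
  subst ha
  fin_cases k <;> simp [coord] <;> ring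

/-! ## Angles between edges -/

theorem det_dir (a b : ℝ) (l m : Fin 3) :
    (a * dir l : ℂ).re * (b * dir m : ℂ).im - (a * dir l : ℂ).im * (b * dir m : ℂ).re =
      a * b * (√3 / 2) * (if m = l then 0 else if m = l + 1 then 1 else -1) := by
  simp only [Complex.re_ofReal_mul, Complex.im_ofReal_mul, dir_re, dir_im]
  fin_cases l <;> fin_cases m <;> simp [dirRe, dirIm] <;> ring

theorem inner_dir (l m : Fin 3) (h : l ≠ m) : inner ℝ (dir l) (dir m) = -1 / 2 := by
  have h3 := sqrt_three_sq
  rw [Complex.inner, Complex.mul_re, Complex.conj_re, Complex.conj_im, dir_re, dir_re, dir_im,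
    dir_im]
  fin_cases l <;> fin_cases m <;> simp [dirRe, dirIm] at h ⊢ <;> linarith

theorem norm_dir (l : Fin 3) : ‖dir l‖ = 1 := by
  rw [dir, show (2 * Real.pi * Complex.I * ((l : ℕ) + 1) / 3 : ℂ) =
    ((2 * Real.pi * ((l : ℕ) + 1) / 3 : ℝ) : ℂ) * Complex.I by push_cast; ring]
  exact Complex.norm_exp_ofReal_mul_I _

theorem cos_angle_dir (a b : ℝ) (l m : Fin 3) (h : l ≠ m) :
    Real.cos (InnerProductGeometry.angle (a * dir l : ℂ) (b * dir m)) =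
      -(a * b) / (2 * (|a| * |b|)) := by
  rw [InnerProductGeometry.cos_angle, norm_mul, norm_mul, norm_dir, norm_dir,
    ← Complex.real_smul, ← Complex.real_smul, inner_smul_left, inner_smul_right, inner_dir l m h]
  simp only [Complex.norm_real, Real.norm_eq_abs, mul_one, conj_trivial]
  rcases eq_or_ne (|a| * |b|) 0 with h0 | h0
  · simp [h0]
  · field_simp

/-- The cosine of the angle gives the sign of `a * b`; the sign of the determinant then gives the
cyclic order of the types. The same argument handles the angle π/3. -/
theorem HasAngle.two_pi_div_three {a b : ℝ} {l m : Fin 3}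
    (h : HasAngle (a * dir l) (b * dir m) (2 * Real.pi / 3)) : 0 < a * b ∧ m = l + 1 := by
  obtain ⟨h1, h2⟩ := h
  rw [det_dir] at h1
  have hlm : l ≠ m := by
    rintro rfl
    simp at h1
  have h3 := cos_angle_dir a b l m hlm
  rw [h2, show 2 * Real.pi / 3 = Real.pi - Real.pi / 3 by ring, Real.cos_pi_sub,
    Real.cos_pi_div_three] at h3
  have hne : a * b ≠ 0 := fun h0 => by simp [h0] at h1
  have habs : 0 < |a| * |b| := by rw [← abs_mul]; exact abs_pos.2 hne
  have hpos : 0 < a * b := by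
    rw [eq_div_iff (by positivity)] at h3
    linarith
  refine ⟨hpos, ?_⟩
  by_contra hm
  rw [if_neg hlm.symm, if_neg hm] at h1
  nlinarith [sqrt_three_pos, mul_pos hpos sqrt_three_pos]

theorem HasAngle.pi_div_three {a b : ℝ} {l m : Fin 3}
    (h : HasAngle (a * dir l) (b * dir m) (Real.pi / 3)) : a * b < 0 ∧ m = l + 2 := by
  obtain ⟨h1, h2⟩ := h
  rw [det_dir] at h1
  have hlm : l ≠ m := by
    rintro rfl
    simp at h1
  have h3 := cos_angle_dir a b l m hlm
  rw [h2, Real.cos_pi_div_three] at h3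
  have hne : a * b ≠ 0 := fun h0 => by simp [h0] at h1
  have habs : 0 < |a| * |b| := by rw [← abs_mul]; exact abs_pos.2 hne
  have hneg : a * b < 0 := by
    rw [eq_div_iff (by positivity)] at h3
    linarith
  refine ⟨hneg, ?_⟩
  rw [if_neg hlm.symm] at h1
  split_ifs at h1 with hm
  · nlinarith [sqrt_three_pos, mul_pos_of_neg_of_neg hneg (neg_neg_of_pos sqrt_three_pos)]
  · revert hlm hm
    fin_cases l <;> fin_cases m <;> simp

/-! ## The local structure of triangular honeycombs -/

/-- The pairs of colours of consecutive edges around a vertex. -/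
def Consecutive (c c' : ℕ) : Prop :=
  (c, c') ∈ ({(0, 0), (1, 1), (0, 1), (1, 3), (3, 0)} : Set (ℕ × ℕ))

namespace TriHoneycomb

variable {n : ℕ} (h : TriHoneycomb n)

open Classical in
/-- The colour of an edge. -/
def col (e : Sym2 ℂ) : ℕ := if he : e ∈ h.edges then h.color ⟨e, he⟩ else 0

open Classical in
/-- The type of an edge. -/
def typ (e : Sym2 ℂ) : Fin 3 := if he : e ∈ h.edges then h.type ⟨e, he⟩ else 0

theorem col_eq {e : Sym2 ℂ} (he : e ∈ h.edges) : h.col e = h.color ⟨e, he⟩ := dif_pos he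

theorem typ_eq {e : Sym2 ℂ} (he : e ∈ h.edges) : h.typ e = h.type ⟨e, he⟩ := dif_pos he

variable {h}

theorem ne_of_edge {v w : ℂ} (he : s(v, w) ∈ h.edges) : v ≠ w := fun heq =>
  h.nontrivial _ he (by simp [heq])

theorem mem_verts_left {v w : ℂ} (he : s(v, w) ∈ h.edges) : v ∈ h.verts := ⟨_, he, by simp⟩

theorem mem_verts_right {v w : ℂ} (he : s(v, w) ∈ h.edges) : w ∈ h.verts := ⟨_, he, by simp⟩

theorem exists_edge {v : ℂ} (hv : v ∈ h.verts) : ∃ w, s(v, w) ∈ h.edges := by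
  obtain ⟨e, he, hve⟩ := hv
  obtain ⟨w, rfl⟩ := Sym2.mem_iff_exists.1 hve
  exact ⟨w, he⟩

theorem verts_finite : h.verts.Finite := by
  have : h.verts ⊆ ⋃ e ∈ (h.edges : Set (Sym2 ℂ)), {v | v ∈ e} := by
    rintro v ⟨e, he, hv⟩
    exact Set.mem_biUnion he hv
  refine (Set.Finite.biUnion h.edges.finite_toSet fun e _ => ?_).subset this
  induction e with
  | _ a b =>
    refine (Set.toFinite {a, b}).subset fun v hv => ?_
    simpa using hv

instance : Finite h.verts := verts_finite

theorem edge_dir {v w : ℂ} (he : s(v, w) ∈ h.edges) :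
    ∃ r : ℝ, r ≠ 0 ∧ w = v + r * dir (h.typ s(v, w)) := by
  obtain ⟨r, hr⟩ := h.type_spec ⟨_, he⟩ v (by simp) w (by simp)
  rw [h.typ_eq he]
  refine ⟨r, ?_, hr⟩
  rintro rfl
  exact ne_of_edge he (by simpa using hr.symm)

theorem mem_triangle_of_verts {v : ℂ} (hv : v ∈ h.verts) : v ∈ triangle := by
  obtain ⟨w, he⟩ := exists_edge hv
  exact h.subset _ he ⟨v, w, rfl, left_mem_segment ℝ v w⟩

/-- The inequality `0 < a * b` says that all edges at `v` point to the same side along their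
reference directions, which is what makes `sign` well defined. -/
theorem consecutive_of_edges {v w w' : ℂ} {a b : ℝ} {l m : Fin 3} (he : s(v, w) ∈ h.edges)
    (he' : s(v, w') ∈ h.edges) (hne : w ≠ w') (hw : w = v + a * dir l) (hw' : w' = v + b * dir m) :
    0 < a * b ∧ ((m = l + 1 ∧ Consecutive (h.col s(v, w)) (h.col s(v, w'))) ∨
      (l = m + 1 ∧ Consecutive (h.col s(v, w')) (h.col s(v, w)))) := by
  have hx : w - v = a * dir l := by rw [hw]; ring
  have hx' : w' - v = b * dir m := by rw [hw']; ring
  have key := h.vertex v w w' he he' hne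
  rw [hx, hx'] at key
  rw [h.col_eq he, h.col_eq he']
  rcases key with ⟨h1, h2⟩ | ⟨h1, h2⟩
  · obtain ⟨h3, h4⟩ := h1.two_pi_div_three
    exact ⟨h3, Or.inl ⟨h4, h2⟩⟩
  · obtain ⟨h3, h4⟩ := h1.two_pi_div_three
    exact ⟨by rwa [mul_comm], Or.inr ⟨h4, h2⟩⟩

theorem sign_eq_or (v : ℂ) : h.sign v = 1 ∨ h.sign v = -1 := by
  unfold sign
  split_ifs <;> simp

theorem sign_spec {v w : ℂ} (he : s(v, w) ∈ h.edges) :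
    ∃ r : ℝ, 0 < r ∧ w = v + ((-h.sign v * r : ℝ) : ℂ) * dir (h.typ s(v, w)) := by
  obtain ⟨a, ha, hw⟩ := edge_dir he
  rcases lt_or_gt_of_ne ha with ha | ha
  · refine ⟨-a, by linarith, ?_⟩
    have : h.sign v = 1 := by
      refine if_pos fun w' he' => ?_
      rcases eq_or_ne w w' with rfl | hne
      · refine ⟨-a, by linarith, ?_⟩
        rw [← h.typ_eq he]
        push_cast
        linear_combination hw
      · obtain ⟨b, hb, hw'⟩ := edge_dir he'
        have := (consecutive_of_edges he he' hne hw hw').1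
        refine ⟨-b, by nlinarith, ?_⟩
        rw [← h.typ_eq he']
        push_cast
        linear_combination hw'
    rw [this]
    push_cast
    linear_combination hw
  · refine ⟨a, ha, ?_⟩
    have : h.sign v = -1 := by
      refine if_neg fun hall => ?_
      obtain ⟨r, hr, hw'⟩ := hall w he
      rw [← h.typ_eq he] at hw'
      have h1 : ((a + r : ℝ) : ℂ) * dir (h.typ s(v, w)) = 0 := by
        push_cast
        linear_combination hw' - hw
      have h2 := congrArg norm h1
      rw [norm_mul, norm_dir, mul_one, Complex.norm_real, norm_zero, Real.norm_eq_abs,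
        abs_eq_zero] at h2
      linarith
    rw [this]
    push_cast
    linear_combination hw

/-- The same reference direction is followed forwards from one end and backwards from the other. -/
theorem sign_neighbor {v w : ℂ} (he : s(v, w) ∈ h.edges) : h.sign w = -h.sign v := by
  have he' : s(w, v) ∈ h.edges := by rwa [Sym2.eq_swap]
  obtain ⟨r, hr, h1⟩ := sign_spec he
  obtain ⟨t, ht, h2⟩ := sign_spec he'
  rw [Sym2.eq_swap] at h2
  have h3 : ((h.sign v * r + h.sign w * t : ℝ) : ℂ) * dir (h.typ s(v, w)) = 0 := by
    push_cast at h1 h2 ⊢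
    linear_combination h1 + h2
  have h4 := congrArg norm h3
  rw [norm_mul, norm_dir, mul_one, Complex.norm_real, norm_zero, Real.norm_eq_abs,
    abs_eq_zero] at h4
  rcases h.sign_eq_or v with h5 | h5 <;> rcases h.sign_eq_or w with h6 | h6 <;>
    rw [h5, h6] at h4 <;> linarith

theorem coord_typ_eq {v w : ℂ} (he : s(v, w) ∈ h.edges) :
    coord (h.typ s(v, w)) w = coord (h.typ s(v, w)) v := by
  obtain ⟨r, -, hw⟩ := edge_dir he
  have := coord_add_mul_dir (h.typ s(v, w)) (h.typ s(v, w)) v r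
  rwa [← hw, slope_self, mul_zero, add_zero] at this

theorem height_eq {v : ℂ} {e : Sym2 ℂ} (he : e ∈ h.edges) (hv : v ∈ e) :
    h.height ⟨e, he⟩ = coord (h.typ e) v := by
  rw [height, ← h.typ_eq he]
  have h1 := Sym2.out_fst_mem e
  obtain ⟨w, rfl⟩ := Sym2.mem_iff_exists.1 hv
  rw [Sym2.mem_iff] at h1
  rcases h1 with h1 | h1 <;> rw [h1]
  exact coord_typ_eq he

/-- The edges at a vertex. -/
def star (h : TriHoneycomb n) (v : ℂ) : Set (Sym2 ℂ) := {e | e ∈ h.edges ∧ v ∈ e}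

theorem consecutive_of_star {v : ℂ} {e e' : Sym2 ℂ} (he : e ∈ h.star v) (he' : e' ∈ h.star v)
    (hne : e ≠ e') : (h.typ e' = h.typ e + 1 ∧ Consecutive (h.col e) (h.col e')) ∨
      (h.typ e = h.typ e' + 1 ∧ Consecutive (h.col e') (h.col e)) := by
  obtain ⟨he, hv⟩ := he
  obtain ⟨he', hv'⟩ := he'
  obtain ⟨w, rfl⟩ := Sym2.mem_iff_exists.1 hv
  obtain ⟨w', rfl⟩ := Sym2.mem_iff_exists.1 hv'
  obtain ⟨a, -, ha⟩ := edge_dir he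
  obtain ⟨b, -, hb⟩ := edge_dir he'
  exact (consecutive_of_edges he he' (fun h => hne (by rw [h])) ha hb).2

theorem typ_injOn_star (v : ℂ) : Set.InjOn h.typ (h.star v) := by
  intro e he e' he' heq
  by_contra hne
  rcases consecutive_of_star he he' hne with ⟨h1, -⟩ | ⟨h1, -⟩ <;>
  · rw [heq] at h1
    revert h1
    generalize h.typ e' = l
    fin_cases l <;> simp

/-- Types are distinct around a vertex, and there are only three of them. -/
theorem exists_star_typ {v : ℂ} (hd : h.degree v = 3) (l : Fin 3) :
    ∃ e ∈ h.star v, h.typ e = l := by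
  have h1 : (h.typ '' h.star v).ncard = 3 := by
    rw [(typ_injOn_star v).ncard_image]
    exact hd
  have h2 : h.typ '' h.star v = Set.univ := by
    refine Set.eq_of_subset_of_ncard_le (Set.subset_univ _) ?_ (Set.toFinite _)
    rw [h1, Set.ncard_univ, Nat.card_eq_fintype_card, Fintype.card_fin]
  have h3 : l ∈ h.typ '' h.star v := by rw [h2]; trivial
  exact h3

theorem degree_eq_one_iff {v : ℂ} (hv : v ∈ h.verts) : h.degree v = 1 ↔ ∃ i, v ∈ side i := by
  have h1 : v ∈ h.support := by
    obtain ⟨w, he⟩ := exists_edge hv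
    exact Set.mem_biUnion he ⟨v, w, rfl, left_mem_segment ℝ v w⟩
  have h2 := Set.ext_iff.1 h.boundary_eq v
  simp only [Set.mem_inter_iff, h1, true_and, Set.mem_iUnion] at h2
  rw [h2]
  exact ⟨fun h => ⟨hv, h⟩, fun h => h.2⟩

theorem mem_verts_of_support {v : ℂ} {i : Fin 3} (hv : v ∈ h.support) (hi : v ∈ side i) :
    v ∈ h.verts := by
  have h2 := (Set.ext_iff.1 h.boundary_eq v).1 ⟨hv, Set.mem_iUnion.2 ⟨i, hi⟩⟩
  exact h2.1

/-- The edge must enter the triangle, so its `i`-th coordinate cannot decrease away from the side.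
Given the type, this fixes the sign. -/
theorem side_spec {v w : ℂ} {i : Fin 3} (hi : v ∈ side i) (he : s(v, w) ∈ h.edges) :
    (h.col s(v, w) = 0 ∧ h.typ s(v, w) = i + 1 ∧ h.sign v = -1) ∨
      (h.col s(v, w) = 1 ∧ h.typ s(v, w) = i + 2 ∧ h.sign v = 1) := by
  have h1 := h.side_type i ⟨_, he⟩ v (by simp) hi
  rw [← h.col_eq he, ← h.typ_eq he] at h1
  obtain ⟨r, hr, hw⟩ := sign_spec he
  have h2 := coord_nonneg_of_mem (mem_triangle_of_verts (mem_verts_right he)) i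
  rw [hw, coord_add_mul_dir, hi.2] at h2
  rcases h1 with ⟨hc, ht⟩ | ⟨hc, ht⟩
  · refine Or.inl ⟨hc, ht, ?_⟩
    rw [ht, show i = (i + 1) + 2 by fin_cases i <;> rfl] at h2
    rw [show i + 1 + 2 + 1 = i + 1 by fin_cases i <;> rfl, slope_add_two] at h2
    rcases h.sign_eq_or v with h5 | h5
    · rw [h5] at h2; linarith
    · exact h5
  · refine Or.inr ⟨hc, ht, ?_⟩
    rw [ht, show i = (i + 2) + 1 by fin_cases i <;> rfl] at h2
    rw [show i + 2 + 1 + 2 = i + 2 by fin_cases i <;> rfl, slope_add_one] at h2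
    rcases h.sign_eq_or v with h5 | h5
    · exact h5
    · rw [h5] at h2; linarith

/-- The colour and the type of an edge at `v` determine the side; in particular no vertex is a
corner of the triangle. -/
theorem side_unique {v : ℂ} (hv : v ∈ h.verts) {i j : Fin 3} (hi : v ∈ side i)
    (hj : v ∈ side j) : i = j := by
  obtain ⟨w, he⟩ := exists_edge hv
  rcases side_spec hi he with ⟨h1, h2, -⟩ | ⟨h1, h2, -⟩ <;>
  rcases side_spec hj he with ⟨h3, h4, -⟩ | ⟨h3, h4, -⟩
  · rw [h2] at h4; exact add_right_cancel h4
  · omega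
  · omega
  · rw [h2] at h4; exact add_right_cancel h4

theorem coord_pos_of_ne {v : ℂ} (hv : v ∈ h.verts) {i j : Fin 3} (hi : v ∈ side i)
    (hij : j ≠ i) : 0 < coord j v :=
  (coord_nonneg_of_mem hi.1 j).lt_of_ne' fun h0 => hij (side_unique hv ⟨hi.1, h0⟩ hi)

/-- No edge is contained in a side of the triangle. -/
theorem not_mem_side_of_edge {v w : ℂ} {i : Fin 3} (he : s(v, w) ∈ h.edges) (hi : v ∈ side i) :
    w ∉ side i := by
  intro hw
  obtain ⟨r, hr, h1⟩ := edge_dir he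
  have h2 := hw.2
  rw [h1, coord_add_mul_dir, hi.2, zero_add] at h2
  rcases side_spec hi he with ⟨-, ht, -⟩ | ⟨-, ht, -⟩
  · rw [ht, show i = (i + 1) + 2 by fin_cases i <;> rfl,
      show i + 1 + 2 + 1 = i + 1 by fin_cases i <;> rfl, slope_add_two] at h2
    exact hr (by linarith)
  · rw [ht, show i = (i + 2) + 1 by fin_cases i <;> rfl,
      show i + 2 + 1 + 2 = i + 2 by fin_cases i <;> rfl, slope_add_one] at h2
    exact hr (by linarith)

/-- The edge at a boundary vertex is unique. -/
theorem edge_unique {v : ℂ} {i : Fin 3} (hi : v ∈ side i) {e e' : Sym2 ℂ} (he : e ∈ h.star v)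
    (he' : e' ∈ h.star v) : e = e' := by
  have hd : h.degree v = 1 := (degree_eq_one_iff ⟨e, he⟩).2 ⟨i, hi⟩
  obtain ⟨a, ha⟩ := Set.ncard_eq_one.1 hd
  have h1 : e ∈ ({a} : Set (Sym2 ℂ)) := ha ▸ he
  have h2 : e' ∈ ({a} : Set (Sym2 ℂ)) := ha ▸ he'
  rw [Set.mem_singleton_iff.1 h1, Set.mem_singleton_iff.1 h2]

theorem degree_eq_three {v : ℂ} (hv : v ∈ h.verts) (hi : ∀ i, v ∉ side i) : h.degree v = 3 :=
  (h.degree_eq v hv).resolve_left fun h1 => by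
    obtain ⟨i, hi'⟩ := (degree_eq_one_iff hv).1 h1
    exact hi i hi'

end TriHoneycomb

end Honey

end

noncomputable section

namespace Honey

namespace TriHoneycomb

variable {n : ℕ} {h : TriHoneycomb n}

/-! ## Crossings -/

/-- Turns the angle condition into a relation between types. In particular parallel edges never have
meeting interiors. -/
theorem crossing_spec {e e' : Sym2 ℂ} (he : e ∈ h.edges) (he' : e' ∈ h.edges) (hne : e ≠ e')
    (hm : (segInterior e ∩ segInterior e').Nonempty) :
    (h.col e = 0 ∧ h.col e' = 1 ∧ h.typ e' = h.typ e + 2) ∨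
      (h.col e' = 0 ∧ h.col e = 1 ∧ h.typ e = h.typ e' + 2) := by
  have key : ∀ f f' : {e // e ∈ h.edges}, (∃ v w v' w', f.1 = s(v, w) ∧ f'.1 = s(v', w') ∧
      HasAngle (w - v) (w' - v') (Real.pi / 3)) → h.typ f'.1 = h.typ f.1 + 2 := by
    rintro ⟨f, hf⟩ ⟨f', hf'⟩ ⟨v, w, v', w', rfl, rfl, ha⟩
    obtain ⟨a, -, hw⟩ := edge_dir hf
    obtain ⟨b, -, hw'⟩ := edge_dir hf'
    have hx : w - v = a * dir (h.typ s(v, w)) := by linear_combination hw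
    have hx' : w' - v' = b * dir (h.typ s(v', w')) := by linear_combination hw'
    rw [hx, hx'] at ha
    exact ha.pi_div_three.2
  obtain ⟨f, f', hff, hc, hc', hang⟩ :=
    h.crossing ⟨e, he⟩ ⟨e', he'⟩ (fun h => hne (Subtype.ext_iff.1 h)) hm
  have ht := key f f' hang
  rw [← h.col_eq f.2] at hc
  rw [← h.col_eq f'.2] at hc'
  rcases hff with ⟨rfl, rfl⟩ | ⟨rfl, rfl⟩
  · exact Or.inl ⟨hc, hc', ht⟩
  · exact Or.inr ⟨hc, hc', ht⟩

/-- A point of a side of `T` in the interior of a segment of `T`. -/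
theorem _root_.Honey.mem_side_of_openSegment {a b z : ℂ} (ha : a ∈ triangle) (hb : b ∈ triangle)
    (hz : z ∈ openSegment ℝ a b) {i : Fin 3} (hi : coord i z = 0) : a ∈ side i ∧ b ∈ side i := by
  obtain ⟨s, t, hs, ht, hst, rfl⟩ := hz
  rw [coord_lineMap _ _ _ _ _ hst] at hi
  have h1 := coord_nonneg_of_mem ha i
  have h2 := coord_nonneg_of_mem hb i
  have h3 := mul_nonneg hs.le h1
  have h4 := mul_nonneg ht.le h2
  have h5 : s * coord i a = 0 := by linarith
  have h6 : t * coord i b = 0 := by linarith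
  exact ⟨⟨ha, (mul_eq_zero.1 h5).resolve_left hs.ne'⟩, ⟨hb, (mul_eq_zero.1 h6).resolve_left ht.ne'⟩⟩

theorem openSegment_overlap {v a b w d : ℂ} {t r : ℝ} (ha : a = v + t * d)
    (hw : w = v + r * d) (hv : v ∈ openSegment ℝ a b) (htr : 0 < t * r) :
    ∃ z, z ∈ openSegment ℝ a b ∧ z ∈ openSegment ℝ v w := by
  have hne : r + t ≠ 0 := by
    intro h0
    have : t = -r := by linarith
    rw [this] at htr
    nlinarith [mul_self_nonneg r]
  have hr : 0 < t / (r + t) := by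
    have : 0 < (t / (r + t)) * (r + t) ^ 2 := by
      have : t / (r + t) * (r + t) ^ 2 = t * r + t * t := by field_simp
      rw [this]; nlinarith [mul_self_nonneg t]
    exact pos_of_mul_pos_left this (by positivity)
  have ht : 0 < r / (r + t) := by
    have : 0 < (r / (r + t)) * (r + t) ^ 2 := by
      have : r / (r + t) * (r + t) ^ 2 = t * r + r * r := by field_simp; ring
      rw [this]; nlinarith [mul_self_nonneg r]
    exact pos_of_mul_pos_left this (by positivity)
  have hsum : t / (r + t) + r / (r + t) = 1 := by field_simp; ring
  -- The parameter `r t / (r + t)` has the common sign of `r` and `t` and is smaller than both in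
  -- absolute value, so it lies strictly between `v` and each far endpoint.
  refine ⟨v + ((r * t / (r + t) : ℝ) : ℂ) * d, ?_, ?_⟩
  · obtain ⟨x, y, hx, hy, hxy, hvv⟩ := hv
    refine ⟨t / (r + t) * x + r / (r + t), t / (r + t) * y, by positivity, by positivity, ?_, ?_⟩
    · linear_combination (t / (r + t)) * hxy + hsum
    · rw [add_smul, mul_smul, mul_smul, add_right_comm, ← smul_add, hvv, ha]
      simp only [Complex.real_smul]
      have hs : ((t / (r + t) : ℝ) : ℂ) + ((r / (r + t) : ℝ) : ℂ) = 1 := by exact_mod_cast hsum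
      have hm : ((r * t / (r + t) : ℝ) : ℂ) = ((r / (r + t) : ℝ) : ℂ) * t := by
        push_cast; ring
      rw [hm]
      linear_combination v * hs
  · refine ⟨r / (r + t), t / (r + t), ht, hr, by rw [add_comm, hsum], ?_⟩
    simp only [Complex.real_smul]
    rw [hw]
    have hs : ((t / (r + t) : ℝ) : ℂ) + ((r / (r + t) : ℝ) : ℂ) = 1 := by exact_mod_cast hsum
    have hm : ((r * t / (r + t) : ℝ) : ℂ) = ((t / (r + t) : ℝ) : ℂ) * r := by
      push_cast; ring
    rw [hm]
    linear_combination v * hs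

/-- A vertex that lies on an edge is an endpoint of the edge. -/
theorem mem_of_mem_segSet {v : ℂ} (hv : v ∈ h.verts) {e : Sym2 ℂ} (he : e ∈ h.edges)
    (hve : v ∈ segSet e) : v ∈ e := by
  by_contra hcon
  obtain ⟨a, b, rfl, hseg⟩ := hve
  have hva : v ≠ a := fun h => hcon (by simp [h])
  have hvb : v ≠ b := fun h => hcon (by simp [h])
  have hopen : v ∈ openSegment ℝ a b := mem_openSegment_of_ne_left_right hva.symm hvb.symm hseg
  have haT := mem_triangle_of_verts (mem_verts_left he)
  have hbT := mem_triangle_of_verts (mem_verts_right he)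
  by_cases hs : ∃ i, v ∈ side i
  · obtain ⟨i, hi⟩ := hs
    obtain ⟨h1, h2⟩ := mem_side_of_openSegment haT hbT hopen hi.2
    exact not_mem_side_of_edge he h1 h2
  · push Not at hs
    -- An interior vertex has an edge of every type, hence one parallel to `s(a, b)`. Starting
    -- inside `s(a, b)`, it would overlap it, and parallel edges may not cross.
    obtain ⟨e', ⟨he', hve'⟩, htyp⟩ := exists_star_typ (degree_eq_three hv hs) (h.typ s(a, b))
    obtain ⟨w, rfl⟩ := Sym2.mem_iff_exists.1 hve'
    obtain ⟨r, hr, hw⟩ := edge_dir he'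
    obtain ⟨ρ, hρ, hb⟩ := edge_dir he
    rw [htyp] at hw
    have hne : s(a, b) ≠ s(v, w) := fun heq => hcon (by rw [heq]; simp)
    suffices hz : ∃ z, z ∈ openSegment ℝ a b ∧ z ∈ openSegment ℝ v w by
      obtain ⟨z, hz1, hz2⟩ := hz
      have hcr := crossing_spec he he' hne ⟨z, ⟨a, b, rfl, hz1⟩, ⟨v, w, rfl, hz2⟩⟩
      rw [htyp] at hcr
      have : ∀ l : Fin 3, l ≠ l + 2 := by decide
      rcases hcr with ⟨-, -, h1⟩ | ⟨-, -, h1⟩ <;> exact this _ h1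
    obtain ⟨x, y, hx, hy, hxy, hvv⟩ := hopen
    have hv' : v = a + ((y * ρ : ℝ) : ℂ) * dir (h.typ s(a, b)) := by
      rw [← hvv]
      conv_lhs => rw [hb]
      simp only [Complex.real_smul]
      have hc : (x : ℂ) + y = 1 := by exact_mod_cast hxy
      push_cast
      linear_combination a * hc
    have ha2 : a = v + ((-(y * ρ) : ℝ) : ℂ) * dir (h.typ s(a, b)) := by
      push_cast at hv' ⊢
      linear_combination -hv'
    have hb2 : b = v + ((x * ρ : ℝ) : ℂ) * dir (h.typ s(a, b)) := by
      have hc : (x : ℂ) + y = 1 := by exact_mod_cast hxy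
      push_cast at hv' ⊢
      linear_combination hb - hv' - ρ * dir (h.typ s(a, b)) * hc
    have hop : v ∈ openSegment ℝ a b := ⟨x, y, hx, hy, hxy, hvv⟩
    -- The overlap is sought towards whichever of `a`, `b` lies on the same side of `v` as `w`.
    rcases lt_or_gt_of_ne (mul_ne_zero hρ hr) with hlt | hlt
    · exact openSegment_overlap ha2 hw hop (by nlinarith)
    · obtain ⟨z, hz1, hz2⟩ :=
        openSegment_overlap hb2 hw (by rwa [openSegment_symm]) (by nlinarith)
      exact ⟨z, by rwa [openSegment_symm], hz2⟩

/-! ## Left and right endpoints -/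

theorem dirRe_ne_zero (l : Fin 3) : dirRe l ≠ 0 := by
  fin_cases l <;> simp [dirRe]

/-- None of the three directions is vertical, so every edge is a graph over an interval of
abscissas. -/
theorem re_ne_of_edge {v w : ℂ} (he : s(v, w) ∈ h.edges) : v.re ≠ w.re := by
  obtain ⟨r, hr, hw⟩ := edge_dir he
  intro heq
  have h1 := congrArg Complex.re hw
  rw [add_mul_dir_re, ← heq] at h1
  exact mul_ne_zero hr (dirRe_ne_zero _) (by linarith)

/-- The left endpoint of a segment. -/
def _root_.Honey.lft (e : Sym2 ℂ) : ℂ :=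
  if (Quot.out e).1.re ≤ (Quot.out e).2.re then (Quot.out e).1 else (Quot.out e).2

/-- The right endpoint of a segment. -/
def _root_.Honey.rgt (e : Sym2 ℂ) : ℂ :=
  if (Quot.out e).1.re ≤ (Quot.out e).2.re then (Quot.out e).2 else (Quot.out e).1

theorem _root_.Honey.sym2_lft_rgt (e : Sym2 ℂ) : s(lft e, rgt e) = e := by
  have h1 : s((Quot.out e).1, (Quot.out e).2) = e := Quot.out_eq e
  unfold lft rgt
  split_ifs
  · exact h1
  · rw [Sym2.eq_swap]
    exact h1

theorem lft_re_lt {e : Sym2 ℂ} (he : e ∈ h.edges) : (lft e).re < (rgt e).re := by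
  have h1 : s(lft e, rgt e) ∈ h.edges := by rwa [sym2_lft_rgt]
  refine lt_of_le_of_ne ?_ (re_ne_of_edge h1)
  unfold lft rgt
  split_ifs with hle
  · exact hle
  · exact (not_le.1 hle).le

theorem lft_mem (e : Sym2 ℂ) : lft e ∈ e := by
  have := Sym2.mem_mk_left (lft e) (rgt e)
  rwa [sym2_lft_rgt] at this

theorem rgt_mem (e : Sym2 ℂ) : rgt e ∈ e := by
  have := Sym2.mem_mk_right (lft e) (rgt e)
  rwa [sym2_lft_rgt] at this

theorem sign_rgt {e : Sym2 ℂ} (he : e ∈ h.edges) : h.sign (rgt e) = -h.sign (lft e) :=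
  sign_neighbor (by rwa [sym2_lft_rgt])

theorem mem_iff_lft_rgt {e : Sym2 ℂ} {v : ℂ} : v ∈ e ↔ v = lft e ∨ v = rgt e := by
  have := Sym2.mem_iff (a := v) (b := lft e) (c := rgt e)
  rwa [sym2_lft_rgt] at this

theorem lft_ne_rgt {e : Sym2 ℂ} (he : e ∈ h.edges) : lft e ≠ rgt e := fun heq =>
  (lft_re_lt he).ne (by rw [heq])

/-! ## Conserved charges -/

/-- A function of the colour and the type of the edges which sums to zero around the vertices. -/
def IsCharge (q : ℕ → Fin 3 → ℝ) : Prop :=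
  ∀ c : Fin 3 → ℕ, (∀ l, Consecutive (c l) (c (l + 1))) → q (c 0) 0 + q (c 1) 1 + q (c 2) 2 = 0

/-- The vertices of a honeycomb. -/
def vfin (h : TriHoneycomb n) : Finset ℂ := h.verts_finite.toFinset

theorem mem_vfin {v : ℂ} : v ∈ h.vfin ↔ v ∈ h.verts := h.verts_finite.mem_toFinset

open Classical in
/-- The edges at a vertex. -/
def starFin (h : TriHoneycomb n) (v : ℂ) : Finset (Sym2 ℂ) := h.edges.filter fun e => v ∈ e

theorem mem_starFin {v : ℂ} {e : Sym2 ℂ} : e ∈ h.starFin v ↔ e ∈ h.star v := by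
  simp [starFin, star]

/-- The total charge of the edges at a vertex. -/
def vertexCharge (h : TriHoneycomb n) (q : ℕ → Fin 3 → ℝ) (v : ℂ) : ℝ :=
  ∑ e ∈ h.starFin v, q (h.col e) (h.typ e)

theorem vertexCharge_boundary (q : ℕ → Fin 3 → ℝ) {v w : ℂ} {i : Fin 3} (hi : v ∈ side i)
    (he : s(v, w) ∈ h.edges) : h.vertexCharge q v = q (h.col s(v, w)) (h.typ s(v, w)) := by
  have hs : s(v, w) ∈ h.star v := ⟨he, by simp⟩
  have : h.starFin v = {s(v, w)} := by
    ext e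
    rw [mem_starFin, Finset.mem_singleton]
    exact ⟨fun h1 => edge_unique hi h1 hs, fun h1 => h1 ▸ hs⟩
  rw [vertexCharge, this, Finset.sum_singleton]

/-- The edges at an interior vertex, indexed by their types. -/
theorem exists_starFin_eq {v : ℂ} (hd : h.degree v = 3) : ∃ E : Fin 3 → Sym2 ℂ,
    Function.Injective E ∧ (∀ l, h.typ (E l) = l) ∧ (∀ l, E l ∈ h.star v) ∧
      h.starFin v = Finset.univ.image E ∧ ∀ l, Consecutive (h.col (E l)) (h.col (E (l + 1))) := by
  choose E hE hl using fun l => exists_star_typ hd l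
  have hinj : Function.Injective E := fun l m hlm => by rw [← hl l, ← hl m, hlm]
  refine ⟨E, hinj, hl, hE, ?_, fun l => ?_⟩
  · ext e
    rw [mem_starFin, Finset.mem_image]
    constructor
    · intro he
      exact ⟨h.typ e, Finset.mem_univ _, typ_injOn_star v (hE _) he (hl _)⟩
    · rintro ⟨l, -, rfl⟩
      exact hE l
  · have hne : E l ≠ E (l + 1) := fun heq => by
      have := hinj heq
      revert this
      fin_cases l <;> simp
    rcases consecutive_of_star (hE l) (hE (l + 1)) hne with ⟨-, h2⟩ | ⟨h1, -⟩
    · exact h2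
    · rw [hl, hl] at h1
      exfalso
      revert h1
      fin_cases l <;> simp

theorem vertexCharge_eq_zero {q : ℕ → Fin 3 → ℝ} (hq : IsCharge q) {v : ℂ}
    (hd : h.degree v = 3) : h.vertexCharge q v = 0 := by
  obtain ⟨E, hinj, hl, -, himg, hc⟩ := exists_starFin_eq hd
  rw [vertexCharge, himg, Finset.sum_image fun _ _ _ _ h => hinj h, Fin.sum_univ_three, hl, hl, hl]
  exact hq (fun l => h.col (E l)) hc

/-- A set of vertices closed under adjacency. -/
def IsClosedSet (h : TriHoneycomb n) (A : Set ℂ) : Prop :=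
  ∀ v w, s(v, w) ∈ h.edges → (v ∈ A ↔ w ∈ A)

theorem IsClosedSet.compl {A : Set ℂ} (hA : h.IsClosedSet A) : h.IsClosedSet Aᶜ :=
  fun v w he => not_congr (hA v w he)

open Classical in
/-- The edges with left endpoint in a set of vertices. -/
def edgesIn (h : TriHoneycomb n) (A : Set ℂ) : Finset (Sym2 ℂ) :=
  h.edges.filter fun e => lft e ∈ A

open Classical in
/-- The boundary vertices in a set of vertices. -/
def bdryIn (h : TriHoneycomb n) (A : Set ℂ) : Finset ℂ :=
  h.vfin.filter fun v => v ∈ A ∧ ∃ i, v ∈ side i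

theorem mem_edgesIn {A : Set ℂ} {e : Sym2 ℂ} : e ∈ h.edgesIn A ↔ e ∈ h.edges ∧ lft e ∈ A := by
  simp [edgesIn]

theorem mem_bdryIn {A : Set ℂ} {v : ℂ} :
    v ∈ h.bdryIn A ↔ v ∈ h.verts ∧ v ∈ A ∧ ∃ i, v ∈ side i := by
  simp [bdryIn, mem_vfin]

theorem mem_edgesIn_iff {A : Set ℂ} (hA : h.IsClosedSet A) {e : Sym2 ℂ} {v : ℂ} (hv : v ∈ e) :
    e ∈ h.edgesIn A ↔ e ∈ h.edges ∧ v ∈ A := by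
  rw [mem_edgesIn]
  refine and_congr_right fun he => ?_
  rcases mem_iff_lft_rgt.1 hv with rfl | rfl
  · rfl
  · exact hA _ _ (by rwa [sym2_lft_rgt])

/-- Summation by parts. -/
theorem sum_edgesIn {A : Set ℂ} (hA : h.IsClosedSet A) {q : ℕ → Fin 3 → ℝ} (hq : IsCharge q)
    (F : ℂ → ℝ) :
    ∑ e ∈ h.edgesIn A, h.sign (lft e) * q (h.col e) (h.typ e) * (F (lft e) - F (rgt e)) =
      ∑ v ∈ h.bdryIn A, F v * h.sign v * h.vertexCharge q v := by
  classical
  -- The two endpoints have opposite signs, so the difference of `F` along an edge is a sum over its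
  -- endpoints with the vertex signs. After exchanging the sums, charge conservation cancels the
  -- interior vertices.
  have h1 : ∀ e ∈ h.edgesIn A,
      h.sign (lft e) * q (h.col e) (h.typ e) * (F (lft e) - F (rgt e)) =
        ∑ v ∈ h.vfin, if v ∈ e then F v * h.sign v * q (h.col e) (h.typ e) else 0 := by
    intro e he
    have he' := (mem_edgesIn.1 he).1
    rw [← Finset.sum_filter]
    have : h.vfin.filter (fun v => v ∈ e) = {lft e, rgt e} := by
      ext v
      simp only [Finset.mem_filter, mem_vfin, Finset.mem_insert, Finset.mem_singleton,
        mem_iff_lft_rgt]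
      refine ⟨fun h => h.2, fun h => ⟨⟨e, he', mem_iff_lft_rgt.2 h⟩, h⟩⟩
    rw [this, Finset.sum_pair (lft_ne_rgt he'), sign_rgt he']
    ring
  rw [Finset.sum_congr rfl h1, Finset.sum_comm]
  rw [bdryIn, Finset.sum_filter]
  refine Finset.sum_congr rfl fun v hv => ?_
  rw [mem_vfin] at hv
  by_cases hvA : v ∈ A
  · have h2 : ∑ e ∈ h.edgesIn A, (if v ∈ e then F v * h.sign v * q (h.col e) (h.typ e) else 0) =
        F v * h.sign v * h.vertexCharge q v := by
      rw [← Finset.sum_filter, vertexCharge, Finset.mul_sum]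
      refine Finset.sum_congr ?_ fun _ _ => rfl
      ext e
      rw [Finset.mem_filter, mem_starFin]
      constructor
      · rintro ⟨h1, h2⟩
        exact ⟨(mem_edgesIn.1 h1).1, h2⟩
      · rintro ⟨h1, h2⟩
        exact ⟨(mem_edgesIn_iff hA h2).2 ⟨h1, hvA⟩, h2⟩
    rw [h2]
    split_ifs with h3
    · rfl
    · have hd : h.degree v = 3 := degree_eq_three hv fun i hi => h3 ⟨hvA, i, hi⟩
      rw [vertexCharge_eq_zero hq hd, mul_zero]
  · rw [if_neg fun h3 => hvA h3.1]
    refine Finset.sum_eq_zero fun e he => if_neg fun hve => hvA ?_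
    exact ((mem_edgesIn_iff hA hve).1 he).2

end TriHoneycomb

end Honey

end

noncomputable section

namespace Honey

/-! ## Heights of segments above the horizontal axis -/

/-- The height of the line through a segment above a point of the horizontal axis. -/
def hgt (e : Sym2 ℂ) (x : ℝ) : ℝ :=
  (lft e).im + ((rgt e).im - (lft e).im) / ((rgt e).re - (lft e).re) * (x - (lft e).re)

theorem hgt_lft (e : Sym2 ℂ) : hgt e (lft e).re = (lft e).im := by
  simp [hgt]

theorem hgt_rgt {e : Sym2 ℂ} (he : (lft e).re < (rgt e).re) : hgt e (rgt e).re = (rgt e).im := by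
  have : (rgt e).re - (lft e).re ≠ 0 := by linarith
  rw [hgt, div_mul_cancel₀ _ this]; ring

theorem continuous_hgt (e : Sym2 ℂ) : Continuous (hgt e) := by
  unfold hgt
  fun_prop

theorem lineMap_hgt {e : Sym2 ℂ} (he : (lft e).re < (rgt e).re) (x : ℝ) :
    (((rgt e).re - x) / ((rgt e).re - (lft e).re)) • lft e +
      ((x - (lft e).re) / ((rgt e).re - (lft e).re)) • rgt e = ⟨x, hgt e x⟩ := by
  have : (rgt e).re - (lft e).re ≠ 0 := by linarith
  apply Complex.ext
  · simp only [Complex.add_re, Complex.smul_re, smul_eq_mul]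
    field_simp; ring
  · simp only [hgt, Complex.add_im, Complex.smul_im, smul_eq_mul]
    field_simp; ring

theorem hgt_mem_segSet {e : Sym2 ℂ} (he : (lft e).re < (rgt e).re) {x : ℝ}
    (h1 : (lft e).re ≤ x) (h2 : x ≤ (rgt e).re) : (⟨x, hgt e x⟩ : ℂ) ∈ segSet e := by
  have h0 : 0 < (rgt e).re - (lft e).re := by linarith
  refine ⟨lft e, rgt e, (sym2_lft_rgt e).symm, _, _, div_nonneg ?_ h0.le, div_nonneg ?_ h0.le, ?_,
    lineMap_hgt he x⟩
  · linarith
  · linarith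
  · field_simp; ring

theorem hgt_mem_segInterior {e : Sym2 ℂ} (he : (lft e).re < (rgt e).re) {x : ℝ}
    (h1 : (lft e).re < x) (h2 : x < (rgt e).re) : (⟨x, hgt e x⟩ : ℂ) ∈ segInterior e := by
  have h0 : 0 < (rgt e).re - (lft e).re := by linarith
  refine ⟨lft e, rgt e, (sym2_lft_rgt e).symm, _, _, div_pos ?_ h0, div_pos ?_ h0, ?_,
    lineMap_hgt he x⟩
  · linarith
  · linarith
  · field_simp; ring

open Classical in
/-- The indicator of the points above a segment. -/
def up (P : ℂ) (f : Sym2 ℂ) : ℝ :=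
  if (lft f).re < P.re ∧ P.re ≤ (rgt f).re ∧ hgt f P.re < P.im then 1 else 0

open Classical in
/-- The indicator of the points below a segment. -/
def dn (p : ℂ) (e : Sym2 ℂ) : ℝ :=
  if (lft e).re ≤ p.re ∧ p.re < (rgt e).re ∧ p.im < hgt e p.re then 1 else 0

/-- Two disjoint segments keep their relative position. -/
theorem up_add_dn {e f : Sym2 ℂ} (he : (lft e).re < (rgt e).re) (hf : (lft f).re < (rgt f).re)
    (hne : ∀ x, (lft e).re ≤ x → x ≤ (rgt e).re → (lft f).re ≤ x → x ≤ (rgt f).re →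
      hgt e x ≠ hgt f x) :
    up (lft e) f + dn (lft f) e = up (rgt e) f + dn (rgt f) e := by
  classical
  unfold up dn
  rw [← hgt_lft e, ← hgt_lft f, ← hgt_rgt he, ← hgt_rgt hf]
  generalize (lft e).re = a at *
  generalize (rgt e).re = b at *
  generalize (lft f).re = c at *
  generalize (rgt f).re = d at *
  -- Intermediate value theorem: on the common interval of abscissas the order of two disjoint
  -- segments cannot change.
  have key : ∀ x y, a ≤ x → x ≤ b → c ≤ x → x ≤ d → a ≤ y → y ≤ b → c ≤ y → y ≤ d → x ≤ y →
      (hgt f x < hgt e x ↔ hgt f y < hgt e y) := by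
    intro x y h1 h2 h3 h4 h5 h6 h7 h8 hxy
    by_contra hcon
    have hz : (0 : ℝ) ∈ (fun t => hgt e t - hgt f t) '' Set.Icc x y := by
      have hc : ContinuousOn (fun t => hgt e t - hgt f t) (Set.Icc x y) :=
        ((continuous_hgt e).sub (continuous_hgt f)).continuousOn
      by_cases h9 : hgt f x < hgt e x
      · have h10 : ¬ hgt f y < hgt e y := fun h => hcon ⟨fun _ => h, fun _ => h9⟩
        exact intermediate_value_Icc' hxy hc ⟨by linarith, by linarith⟩
      · have h10 : hgt f y < hgt e y := by
          by_contra h; exact hcon ⟨fun h' => absurd h' h9, fun h' => absurd h' h⟩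
        exact intermediate_value_Icc hxy hc ⟨by linarith, by linarith⟩
    obtain ⟨z, ⟨hz1, hz2⟩, hz3⟩ := hz
    exact hne z (h1.trans hz1) (hz2.trans h6) (h3.trans hz1) (hz2.trans h8) (by linarith)
  -- `up` and `dn` use complementary half-open intervals, so the left end `max a c` of the overlap
  -- is counted exactly once even when `a = c`; `hr` treats the right end `min b d` likewise.
  have hl : (if c < a ∧ a ≤ d ∧ hgt f a < hgt e a then (1 : ℝ) else 0) +
      (if a ≤ c ∧ c < b ∧ hgt f c < hgt e c then 1 else 0) =
        if a ≤ d ∧ c < b ∧ hgt f (max a c) < hgt e (max a c) then 1 else 0 := by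
    rcases le_or_gt a c with h | h
    · rw [max_eq_right h, if_neg (fun h' => absurd h'.1 (not_lt.2 h)), zero_add]
      refine if_congr ⟨fun h' => ⟨h.trans hf.le, h'.2⟩, fun h' => ⟨h, h'.2⟩⟩ rfl rfl
    · rw [max_eq_left h.le, if_neg (fun h' => absurd h'.1 (not_le.2 h)) (c := a ≤ c ∧ _), add_zero]
      refine if_congr ⟨fun h' => ⟨h'.2.1, h.trans he, h'.2.2⟩, fun h' => ⟨h, h'.1, h'.2.2⟩⟩ rfl rfl
  have hr : (if c < b ∧ b ≤ d ∧ hgt f b < hgt e b then (1 : ℝ) else 0) +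
      (if a ≤ d ∧ d < b ∧ hgt f d < hgt e d then 1 else 0) =
        if a ≤ d ∧ c < b ∧ hgt f (min b d) < hgt e (min b d) then 1 else 0 := by
    rcases le_or_gt b d with h | h
    · rw [min_eq_left h, if_neg (fun h' => absurd h'.2.1 (not_lt.2 h)) (c := a ≤ d ∧ d < b ∧ _),
        add_zero]
      refine if_congr ⟨fun h' => ⟨he.le.trans h, h'.1, h'.2.2⟩, fun h' => ⟨h'.2.1, h, h'.2.2⟩⟩ rfl rfl
    · rw [min_eq_right h.le, if_neg (fun h' => absurd h'.2.1 (not_le.2 h)), zero_add]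
      refine if_congr ⟨fun h' => ⟨h'.1, hf.trans h, h'.2.2⟩, fun h' => ⟨h'.1, h, h'.2.2⟩⟩ rfl rfl
  rw [hl, hr]
  by_cases hov : a ≤ d ∧ c < b
  · refine if_congr (and_congr_right fun _ => and_congr_right fun _ => ?_) rfl rfl
    apply key
    · exact le_max_left _ _
    · exact max_le he.le hov.2.le
    · exact le_max_right _ _
    · exact max_le hov.1 hf.le
    · exact le_min he.le hov.1
    · exact min_le_left _ _
    · exact le_min hov.2.le hf.le
    · exact min_le_right _ _
    · exact le_min (max_le he.le hov.2.le) (max_le hov.1 hf.le)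
  · rw [if_neg fun h' => hov ⟨h'.1, h'.2.1⟩, if_neg fun h' => hov ⟨h'.1, h'.2.1⟩]

/-- The points of the bottom side are below the points of the triangle. -/
theorem im_le_of_side_two {P z : ℂ} (hP : P ∈ side 2) (hz : z ∈ triangle) : P.im ≤ z.im := by
  have h1 := coord_nonneg_of_mem hz 2
  have h2 := hP.2
  rw [im_eq_coord, im_eq_coord, h2]
  have := sqrt_three_pos
  nlinarith

/-- The points of the upper sides are above the points of the triangle. -/
theorem im_le_of_side_ne_two {P z : ℂ} {i : Fin 3} (hi : i ≠ 2) (hP : P ∈ side i)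
    (hz : z ∈ triangle) (hre : z.re = P.re) : z.im ≤ P.im := by
  have h1 := coord_nonneg_of_mem hz i
  have h2 := hP.2
  rw [re_eq_coord, re_eq_coord] at hre
  have h3 := coord_sum P
  have h4 := coord_sum z
  have h5 := sqrt_three_pos
  have h6 : coord 2 z ≤ coord 2 P := by
    fin_cases i
    · simp only [Fin.zero_eta] at h1 h2; linarith
    · simp only [Fin.mk_one] at h1 h2; linarith
    · exact absurd rfl hi
  rw [im_eq_coord, im_eq_coord]
  nlinarith

/-! ### The intersection number of two unions of components -/

namespace TriHoneycomb

variable {n : ℕ} {h : TriHoneycomb n}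

open Classical in
/-- The edge at a boundary vertex. -/
def bedge (h : TriHoneycomb n) (v : ℂ) : Sym2 ℂ :=
  if hv : v ∈ h.verts then s(v, (exists_edge hv).choose) else s(v, v)

theorem bedge_mem {v : ℂ} (hv : v ∈ h.verts) : h.bedge v ∈ h.star v := by
  rw [bedge, dif_pos hv]
  exact ⟨(exists_edge hv).choose_spec, by simp⟩

theorem vertexCharge_bedge (q : ℕ → Fin 3 → ℝ) {v : ℂ} (hv : v ∈ h.verts)
    (hi : ∃ i, v ∈ side i) : h.vertexCharge q v = q (h.col (h.bedge v)) (h.typ (h.bedge v)) := by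
  obtain ⟨i, hi⟩ := hi
  rw [bedge, dif_pos hv]
  exact vertexCharge_boundary q hi (exists_edge hv).choose_spec

theorem bedge_spec {v : ℂ} {i : Fin 3} (hv : v ∈ h.verts) (hi : v ∈ side i) :
    (h.col (h.bedge v) = 0 ∧ h.typ (h.bedge v) = i + 1 ∧ h.sign v = -1) ∨
      (h.col (h.bedge v) = 1 ∧ h.typ (h.bedge v) = i + 2 ∧ h.sign v = 1) := by
  rw [bedge, dif_pos hv]
  exact side_spec hi (exists_edge hv).choose_spec

theorem edgesIn_ne_of_mem {A : Set ℂ} (hA : h.IsClosedSet A) {e f : Sym2 ℂ}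
    (he : e ∈ h.edgesIn A) (hf : f ∈ h.edgesIn Aᶜ) {v : ℂ} (hve : v ∈ e) (hvf : v ∈ f) : False :=
  ((mem_edgesIn_iff hA.compl hvf).1 hf).2 ((mem_edgesIn_iff hA hve).1 he).2

/-- A common point that is an endpoint of one edge would be a vertex on the other, hence a common
endpoint, which is impossible between different components. So edges without an interior crossing
are disjoint. -/
theorem hgt_ne {A : Set ℂ} (hA : h.IsClosedSet A) {e f : Sym2 ℂ} (he : e ∈ h.edgesIn A)
    (hf : f ∈ h.edgesIn Aᶜ) (hno : ¬ (segInterior e ∩ segInterior f).Nonempty) (x : ℝ)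
    (h1 : (lft e).re ≤ x) (h2 : x ≤ (rgt e).re) (h3 : (lft f).re ≤ x) (h4 : x ≤ (rgt f).re) :
    hgt e x ≠ hgt f x := by
  intro heq
  have he' := (mem_edgesIn.1 he).1
  have hf' := (mem_edgesIn.1 hf).1
  have hlr := lft_re_lt he'
  have hlr' := lft_re_lt hf'
  have hse := hgt_mem_segSet hlr h1 h2
  have hsf := hgt_mem_segSet hlr' h3 h4
  have hendE : ∀ v ∈ e, v = ⟨x, hgt e x⟩ → False := by
    rintro v hv rfl
    rw [heq] at hv
    exact edgesIn_ne_of_mem hA he hf hv (mem_of_mem_segSet ⟨e, he', hv⟩ hf' hsf)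
  have hendF : ∀ v ∈ f, v = ⟨x, hgt f x⟩ → False := by
    rintro v hv rfl
    rw [← heq] at hv
    exact edgesIn_ne_of_mem hA he hf (mem_of_mem_segSet ⟨f, hf', hv⟩ he' hse) hv
  have g1 : (lft e).re < x := lt_of_le_of_ne h1 fun h0 =>
    hendE _ (lft_mem e) (Complex.ext h0 (by rw [← h0, hgt_lft]))
  have g2 : x < (rgt e).re := lt_of_le_of_ne h2 fun h0 =>
    hendE _ (rgt_mem e) (Complex.ext h0.symm (by rw [h0, hgt_rgt hlr]))
  have g3 : (lft f).re < x := lt_of_le_of_ne h3 fun h0 =>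
    hendF _ (lft_mem f) (Complex.ext h0 (by rw [← h0, hgt_lft]))
  have g4 : x < (rgt f).re := lt_of_le_of_ne h4 fun h0 =>
    hendF _ (rgt_mem f) (Complex.ext h0.symm (by rw [h0, hgt_rgt hlr']))
  refine hno ⟨⟨x, hgt e x⟩, hgt_mem_segInterior hlr g1 g2, ?_⟩
  rw [heq]
  exact hgt_mem_segInterior hlr' g3 g4

/-- The position of a boundary vertex with respect to an edge of another component. -/
theorem boundary_ne_hgt {f : Sym2 ℂ} (hf : f ∈ h.edges) {P : ℂ} (hP : P ∈ h.verts)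
    (hPf : P ∉ f) (h3 : (lft f).re ≤ P.re) (h4 : P.re ≤ (rgt f).re) : hgt f P.re ≠ P.im := by
  intro heq
  have hsf := hgt_mem_segSet (lft_re_lt hf) h3 h4
  rw [heq] at hsf
  exact hPf (mem_of_mem_segSet hP hf hsf)

theorem segSet_subset_triangle {f : Sym2 ℂ} (hf : f ∈ h.edges) {x : ℝ}
    (h3 : (lft f).re ≤ x) (h4 : x ≤ (rgt f).re) : (⟨x, hgt f x⟩ : ℂ) ∈ triangle :=
  h.subset f hf (hgt_mem_segSet (lft_re_lt hf) h3 h4)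

open Classical in
-- A point of the two upper sides is above every edge that it does not meet, and a point of the
-- bottom side is below. So `up` depends only on abscissas there and is a difference between the
-- ends of `f`, ready for a second summation by parts.
theorem up_boundary {f : Sym2 ℂ} (hf : f ∈ h.edges) {P : ℂ} (hP : P ∈ h.verts) (hPf : P ∉ f)
    (hi : ∃ i, P ∈ side i) : up P f = if P ∈ side 2 then 0 else
      (if (lft f).re < P.re then 1 else 0) - (if (rgt f).re < P.re then 1 else 0) := by
  have hlr := lft_re_lt hf
  unfold up
  by_cases hr : (lft f).re < P.re ∧ P.re ≤ (rgt f).re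
  · have hne := boundary_ne_hgt hf hP hPf hr.1.le hr.2
    have hT := segSet_subset_triangle hf hr.1.le hr.2
    split_ifs with h1 h2 h3 h4 h5 h6 h7 h8
    · exact absurd (im_le_of_side_two h2 hT) (not_le.2 h1.2.2)
    · linarith [hr.2]
    · norm_num
    · exact absurd hr.1 h3
    · exact absurd hr.1 h3
    · rfl
    · linarith [hr.2]
    · obtain ⟨i, hi⟩ := hi
      have hi2 : i ≠ 2 := by rintro rfl; contradiction
      exact absurd ⟨hr.1, hr.2, lt_of_le_of_ne (im_le_of_side_ne_two hi2 hi hT rfl) hne⟩ h1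
    · exact absurd hr.1 ‹_›
    · exact absurd hr.1 ‹_›
  · rw [if_neg fun h' => hr ⟨h'.1, h'.2.1⟩]
    split_ifs with h1 h2 h3 h3
    · rfl
    · norm_num
    · exact absurd ⟨h2, not_lt.1 h3⟩ hr
    · linarith
    · norm_num

open Classical in
theorem dn_boundary {e : Sym2 ℂ} (he : e ∈ h.edges) {p : ℂ} (hp : p ∈ h.verts) (hpe : p ∉ e)
    (hi : ∃ i, p ∈ side i) : dn p e = if p ∈ side 2 then
      (if (lft e).re ≤ p.re then 1 else 0) - (if (rgt e).re ≤ p.re then 1 else 0) else 0 := by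
  have hlr := lft_re_lt he
  unfold dn
  by_cases hr : (lft e).re ≤ p.re ∧ p.re < (rgt e).re
  · have hne := boundary_ne_hgt he hp hpe hr.1 hr.2.le
    have hT := segSet_subset_triangle he hr.1 hr.2.le
    by_cases h2 : p ∈ side 2
    · have hlt : p.im < hgt e p.re := lt_of_le_of_ne (im_le_of_side_two h2 hT) hne.symm
      rw [if_pos ⟨hr.1, hr.2, hlt⟩, if_pos h2, if_pos hr.1, if_neg (not_le.2 hr.2), sub_zero]
    · obtain ⟨i, hi⟩ := hi
      have hi2 : i ≠ 2 := by rintro rfl; contradiction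
      rw [if_neg h2, if_neg fun h' =>
        absurd (im_le_of_side_ne_two hi2 hi hT rfl) (not_le.2 h'.2.2)]
  · rw [if_neg fun h' => hr ⟨h'.1, h'.2.1⟩]
    split_ifs with h1 h2 h3 h3
    · norm_num
    · exact absurd ⟨h2, not_le.1 h3⟩ hr
    · linarith
    · norm_num
    · rfl

open Classical in
/-- The contribution of a pair of boundary vertices to the intersection number. -/
def theta (P p : ℂ) : ℝ :=
  (if P ∈ side 2 then 0 else if p.re < P.re then 1 else 0) +
    (if p ∈ side 2 then if P.re ≤ p.re then 1 else 0 else 0)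

/-- The intersection number of two disjoint unions of components, computed on the boundary. -/
theorem sum_theta_eq_zero {A : Set ℂ} (hA : h.IsClosedSet A) {W : ℕ → Fin 3 → ℕ → Fin 3 → ℝ}
    (hW : ∀ c' l', IsCharge fun c l => W c l c' l') (hW' : ∀ c l, IsCharge (W c l))
    (hcross : ∀ e ∈ h.edgesIn A, ∀ f ∈ h.edgesIn Aᶜ, (segInterior e ∩ segInterior f).Nonempty →
      W (h.col e) (h.typ e) (h.col f) (h.typ f) = 0) :
    ∑ P ∈ h.bdryIn A, ∑ p ∈ h.bdryIn Aᶜ, h.sign P * h.sign p *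
      W (h.col (h.bedge P)) (h.typ (h.bedge P)) (h.col (h.bedge p)) (h.typ (h.bedge p)) *
        theta P p = 0 := by
  classical
  -- Each term vanishes: `W` is zero on a crossing pair, and otherwise the relative position is the
  -- same at both ends of the overlap.
  have h0 : ∑ e ∈ h.edgesIn A, ∑ f ∈ h.edgesIn Aᶜ, h.sign (lft e) * h.sign (lft f) *
      W (h.col e) (h.typ e) (h.col f) (h.typ f) *
        ((up (lft e) f - up (rgt e) f) + (dn (lft f) e - dn (rgt f) e)) = 0 := by
    refine Finset.sum_eq_zero fun e he => Finset.sum_eq_zero fun f hf => ?_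
    by_cases hm : (segInterior e ∩ segInterior f).Nonempty
    · rw [hcross e he f hf hm]; ring
    · have := up_add_dn (lft_re_lt (mem_edgesIn.1 he).1) (lft_re_lt (mem_edgesIn.1 hf).1)
        (hgt_ne hA he hf hm)
      rw [show (up (lft e) f - up (rgt e) f) + (dn (lft f) e - dn (rgt f) e) = 0 by linarith,
        mul_zero]
  -- Summation over `e` leaves the values of `up` at boundary points of `A`; `up_boundary` makes
  -- these differences along `f`, and summation over `f` leaves boundary points of `Aᶜ`. `hdn` is
  -- the same with the two parts exchanged.
  have hup : ∑ e ∈ h.edgesIn A, ∑ f ∈ h.edgesIn Aᶜ, h.sign (lft e) * h.sign (lft f) *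
      W (h.col e) (h.typ e) (h.col f) (h.typ f) * (up (lft e) f - up (rgt e) f) =
      ∑ P ∈ h.bdryIn A, ∑ p ∈ h.bdryIn Aᶜ, h.sign P * h.sign p *
      W (h.col (h.bedge P)) (h.typ (h.bedge P)) (h.col (h.bedge p)) (h.typ (h.bedge p)) *
        (if P ∈ side 2 then 0 else if p.re < P.re then 1 else 0) := by
    rw [Finset.sum_comm]
    have h1 : ∀ f ∈ h.edgesIn Aᶜ, ∑ e ∈ h.edgesIn A, h.sign (lft e) * h.sign (lft f) *
        W (h.col e) (h.typ e) (h.col f) (h.typ f) * (up (lft e) f - up (rgt e) f) =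
        ∑ P ∈ h.bdryIn A, h.sign P * (h.sign (lft f) *
          W (h.col (h.bedge P)) (h.typ (h.bedge P)) (h.col f) (h.typ f) * up P f) := by
      intro f _
      have := sum_edgesIn hA (hW (h.col f) (h.typ f)) fun P => up P f
      calc _ = h.sign (lft f) * ∑ e ∈ h.edgesIn A, h.sign (lft e) *
            W (h.col e) (h.typ e) (h.col f) (h.typ f) * (up (lft e) f - up (rgt e) f) := by
            rw [Finset.mul_sum]
            exact Finset.sum_congr rfl fun e _ => by ring
        _ = _ := by
            rw [this, Finset.mul_sum]
            refine Finset.sum_congr rfl fun P hP => ?_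
            obtain ⟨hP1, -, hP3⟩ := mem_bdryIn.1 hP
            rw [vertexCharge_bedge _ hP1 hP3]
            ring
    rw [Finset.sum_congr rfl h1, Finset.sum_comm]
    refine Finset.sum_congr rfl fun P hP => ?_
    obtain ⟨hP1, hP2, hP3⟩ := mem_bdryIn.1 hP
    have h2 : ∀ f ∈ h.edgesIn Aᶜ, up P f = if P ∈ side 2 then 0 else
        (if (lft f).re < P.re then 1 else 0) - (if (rgt f).re < P.re then 1 else 0) := by
      intro f hf
      exact up_boundary (mem_edgesIn.1 hf).1 hP1
        (fun hPf => ((mem_edgesIn_iff hA.compl hPf).1 hf).2 hP2) hP3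
    by_cases hs : P ∈ side 2
    · simp only [hs, if_true, mul_zero, Finset.sum_const_zero] at h2 ⊢
      exact Finset.sum_eq_zero fun f hf => by rw [h2 f hf, mul_zero, mul_zero]
    · simp only [hs, if_false] at h2 ⊢
      rw [← Finset.mul_sum]
      have h3 := sum_edgesIn hA.compl (hW' (h.col (h.bedge P)) (h.typ (h.bedge P)))
        fun z => if z.re < P.re then 1 else 0
      rw [Finset.sum_congr rfl fun f hf => by rw [h2 f hf], h3, Finset.mul_sum]
      refine Finset.sum_congr rfl fun p hp => ?_
      obtain ⟨hp1, -, hp3⟩ := mem_bdryIn.1 hp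
      rw [vertexCharge_bedge _ hp1 hp3]
      ring
  have hdn : ∑ e ∈ h.edgesIn A, ∑ f ∈ h.edgesIn Aᶜ, h.sign (lft e) * h.sign (lft f) *
      W (h.col e) (h.typ e) (h.col f) (h.typ f) * (dn (lft f) e - dn (rgt f) e) =
      ∑ P ∈ h.bdryIn A, ∑ p ∈ h.bdryIn Aᶜ, h.sign P * h.sign p *
      W (h.col (h.bedge P)) (h.typ (h.bedge P)) (h.col (h.bedge p)) (h.typ (h.bedge p)) *
        (if p ∈ side 2 then if P.re ≤ p.re then 1 else 0 else 0) := by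
    have h1 : ∀ e ∈ h.edgesIn A, ∑ f ∈ h.edgesIn Aᶜ, h.sign (lft e) * h.sign (lft f) *
        W (h.col e) (h.typ e) (h.col f) (h.typ f) * (dn (lft f) e - dn (rgt f) e) =
        ∑ p ∈ h.bdryIn Aᶜ, h.sign p * (h.sign (lft e) *
          W (h.col e) (h.typ e) (h.col (h.bedge p)) (h.typ (h.bedge p)) * dn p e) := by
      intro e _
      have := sum_edgesIn hA.compl (hW' (h.col e) (h.typ e)) fun p => dn p e
      calc _ = h.sign (lft e) * ∑ f ∈ h.edgesIn Aᶜ, h.sign (lft f) *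
            W (h.col e) (h.typ e) (h.col f) (h.typ f) * (dn (lft f) e - dn (rgt f) e) := by
            rw [Finset.mul_sum]
            exact Finset.sum_congr rfl fun e _ => by ring
        _ = _ := by
            rw [this, Finset.mul_sum]
            refine Finset.sum_congr rfl fun P hP => ?_
            obtain ⟨hP1, -, hP3⟩ := mem_bdryIn.1 hP
            rw [vertexCharge_bedge _ hP1 hP3]
            ring
    rw [Finset.sum_congr rfl h1, Finset.sum_comm]
    rw [Finset.sum_comm (s := h.bdryIn A)]
    refine Finset.sum_congr rfl fun p hp => ?_
    obtain ⟨hp1, hp2, hp3⟩ := mem_bdryIn.1 hp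
    have h2 : ∀ e ∈ h.edgesIn A, dn p e = if p ∈ side 2 then
        (if (lft e).re ≤ p.re then 1 else 0) - (if (rgt e).re ≤ p.re then 1 else 0) else 0 := by
      intro e he
      exact dn_boundary (mem_edgesIn.1 he).1 hp1
        (fun hpe => hp2 ((mem_edgesIn_iff hA hpe).1 he).2) hp3
    by_cases hs : p ∈ side 2
    · simp only [hs, if_true] at h2 ⊢
      rw [← Finset.mul_sum]
      have h3 := sum_edgesIn hA (hW (h.col (h.bedge p)) (h.typ (h.bedge p)))
        fun z => if z.re ≤ p.re then 1 else 0
      rw [Finset.sum_congr rfl fun f hf => by rw [h2 f hf], h3, Finset.mul_sum]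
      refine Finset.sum_congr rfl fun P hP => ?_
      obtain ⟨hP1, -, hP3⟩ := mem_bdryIn.1 hP
      rw [vertexCharge_bedge _ hP1 hP3]
      ring
    · simp only [hs, if_false, mul_zero, Finset.sum_const_zero] at h2 ⊢
      exact Finset.sum_eq_zero fun f hf => by rw [h2 f hf, mul_zero, mul_zero]
  simp only [mul_add, Finset.sum_add_distrib] at h0
  rw [hup, hdn] at h0
  simp only [theta, mul_add, Finset.sum_add_distrib]
  exact h0

end TriHoneycomb

end Honey

end

/-! ### Connectedness of triangular honeycombs -/

noncomputable section

namespace Honey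

namespace TriHoneycomb

variable {n : ℕ} {h : TriHoneycomb n}

/-- The colour of an edge seen by the charges of the colour `c`. -/
def eps (c a : ℕ) : ℝ := if a = c then 1 else if a = 3 then -1 else 0

/-- The type of an edge seen by the charges of the colour `c`: the edges of colour `3` are
rotated. -/
def shift (c a : ℕ) (k : Fin 3) : Fin 3 := if a = 3 then k + (if c = 0 then 1 else 2) else k

theorem consecutive_cases {c : Fin 3 → ℕ} (hc : ∀ l, Consecutive (c l) (c (l + 1))) :
    (c 0 = 0 ∧ c 1 = 0 ∧ c 2 = 0) ∨ (c 0 = 1 ∧ c 1 = 1 ∧ c 2 = 1) ∨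
    (c 0 = 0 ∧ c 1 = 1 ∧ c 2 = 3) ∨ (c 0 = 3 ∧ c 1 = 0 ∧ c 2 = 1) ∨
    (c 0 = 1 ∧ c 1 = 3 ∧ c 2 = 0) := by
  have h0 := hc 0
  have h1 := hc 1
  have h2 := hc 2
  simp only [Consecutive, Set.mem_insert_iff, Set.mem_singleton_iff, Prod.mk.injEq,
    show (0 : Fin 3) + 1 = 1 from rfl, show (1 : Fin 3) + 1 = 2 from rfl,
    show (2 : Fin 3) + 1 = 0 from rfl] at h0 h1 h2
  omega

/-- An edge of colour 3 and type `k` counts as minus a 0-edge of type `k + 1` and minus a 1-edge of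
type `k + 2`. At a vertex with colours 0, 1, 3 the terms of each colour cancel in pairs; at a
unicoloured vertex the sum is that of `G` or zero. -/
theorem isCharge_of_sum_eq_zero {c : ℕ} (hc : c = 0 ∨ c = 1) {G : Fin 3 → ℝ}
    (hG : G 0 + G 1 + G 2 = 0) : IsCharge fun a k => eps c a * G (shift c a k) := by
  intro a ha
  have e1 : (0 : Fin 3) + 2 = 2 := rfl
  have e2 : (1 : Fin 3) + 2 = 0 := rfl
  have e3 : (2 : Fin 3) + 2 = 1 := rfl
  have e4 : (1 : Fin 3) + 1 = 2 := rfl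
  have e5 : (2 : Fin 3) + 1 = 0 := rfl
  rcases hc with rfl | rfl <;>
  rcases consecutive_cases ha with ⟨h0, h1, h2⟩ | ⟨h0, h1, h2⟩ | ⟨h0, h1, h2⟩ | ⟨h0, h1, h2⟩ |
    ⟨h0, h1, h2⟩ <;>
  simp [h0, h1, h2, eps, shift, e1, e2, e3, e4, e5] <;> linarith

/-- The pairing of the charges of two colours. -/
def pairing (F : Fin 3 → ℝ) (c c' a : ℕ) (k : Fin 3) (a' : ℕ) (m : Fin 3) : ℝ :=
  eps c a * eps c' a' * F (shift c' a' m - shift c a k)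

theorem sum_sub_eq (F : Fin 3 → ℝ) (m : Fin 3) :
    F (m - 0) + F (m - 1) + F (m - 2) = F 0 + F 1 + F 2 := by
  have e1 : (0 : Fin 3) - 1 = 2 := rfl
  have e2 : (0 : Fin 3) - 2 = 1 := rfl
  have e3 : (1 : Fin 3) - 2 = 2 := rfl
  have e4 : (2 : Fin 3) - 1 = 1 := rfl
  fin_cases m <;> simp [e1, e2, e3, e4] <;> ring

theorem sum_sub_eq' (F : Fin 3 → ℝ) (m : Fin 3) :
    F (0 - m) + F (1 - m) + F (2 - m) = F 0 + F 1 + F 2 := by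
  have e1 : (0 : Fin 3) - 1 = 2 := rfl
  have e2 : (0 : Fin 3) - 2 = 1 := rfl
  have e3 : (1 : Fin 3) - 2 = 2 := rfl
  have e4 : (2 : Fin 3) - 1 = 1 := rfl
  fin_cases m <;> simp [e1, e2, e3, e4] <;> ring

theorem isCharge_pairing_left {F : Fin 3 → ℝ} (hF : F 0 + F 1 + F 2 = 0) {c : ℕ}
    (hc : c = 0 ∨ c = 1) (c' a' : ℕ) (m : Fin 3) :
    IsCharge fun a k => pairing F c c' a k a' m := by
  have h1 := isCharge_of_sum_eq_zero hc (G := fun k => eps c' a' * F (shift c' a' m - k)) (by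
    rw [← mul_add, ← mul_add, sum_sub_eq, hF, mul_zero])
  convert! h1 using 4
  rw [pairing]; ring

theorem isCharge_pairing_right {F : Fin 3 → ℝ} (hF : F 0 + F 1 + F 2 = 0) {c' : ℕ}
    (hc' : c' = 0 ∨ c' = 1) (c a : ℕ) (k : Fin 3) :
    IsCharge (pairing F c c' a k) := by
  have h1 := isCharge_of_sum_eq_zero hc' (G := fun m => eps c a * F (m - shift c a k)) (by
    rw [← mul_add, ← mul_add, sum_sub_eq', hF, mul_zero])
  convert! h1 using 4
  rw [pairing]; ring

open Classical in
/-- The boundary vertices of a given colour on a side. -/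
def ends (h : TriHoneycomb n) (A : Set ℂ) (c : ℕ) (i : Fin 3) : Finset ℂ :=
  (h.bdryIn A).filter fun P => P ∈ side i ∧ h.col (h.bedge P) = c

theorem mem_ends {A : Set ℂ} {c : ℕ} {i : Fin 3} {P : ℂ} : P ∈ h.ends A c i ↔
    P ∈ h.verts ∧ P ∈ A ∧ P ∈ side i ∧ h.col (h.bedge P) = c := by
  classical
  rw [ends, Finset.mem_filter, mem_bdryIn]
  constructor
  · rintro ⟨⟨h1, h2, -⟩, h3, h4⟩
    exact ⟨h1, h2, h3, h4⟩
  · rintro ⟨h1, h2, h3, h4⟩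
    exact ⟨⟨h1, h2, i, h3⟩, h3, h4⟩

theorem sum_bdryIn {A : Set ℂ} {c : ℕ} {g : ℂ → ℝ}
    (hg : ∀ P ∈ h.bdryIn A, h.col (h.bedge P) ≠ c → g P = 0) :
    ∑ P ∈ h.bdryIn A, g P = ∑ i, ∑ P ∈ h.ends A c i, g P := by
  classical
  simp only [ends, Finset.sum_filter]
  rw [Finset.sum_comm]
  refine Finset.sum_congr rfl fun P hP => ?_
  obtain ⟨h1, -, i, hi⟩ := mem_bdryIn.1 hP
  rw [Finset.sum_eq_single i]
  · by_cases hc : h.col (h.bedge P) = c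
    · rw [if_pos ⟨hi, hc⟩]
    · rw [if_neg fun h' => hc h'.2, hg P hP hc]
  · intro j _ hj
    exact if_neg fun h' => hj (side_unique h1 h'.1 hi)
  · simp

/-- The shift between the index of a side and the type of the edges of colour `c` that end on
it. -/
def endType (c : ℕ) : Fin 3 := if c = 0 then 1 else 2

/-- The sign of the boundary vertices of colour `c`. -/
def endSign (c : ℕ) : ℝ := if c = 0 then -1 else 1

theorem ends_spec {A : Set ℂ} {c : ℕ} {i : Fin 3} {P : ℂ} (hP : P ∈ h.ends A c i) :
    h.typ (h.bedge P) = i + endType c ∧ h.sign P = endSign c := by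
  obtain ⟨h1, -, h3, h4⟩ := mem_ends.1 hP
  rcases bedge_spec h1 h3 with ⟨h5, h6, h7⟩ | ⟨h5, h6, h7⟩ <;> rw [h5] at h4 <;> subst h4 <;>
    simp [endType, endSign, h6, h7]

theorem eps_self {c : ℕ} : eps c c = 1 := if_pos rfl

theorem shift_self {c : ℕ} (hc : c = 0 ∨ c = 1) (k : Fin 3) : shift c c k = k :=
  if_neg (by omega)

theorem endSign_mul_self (c : ℕ) : endSign c * endSign c = 1 := by
  unfold endSign; split_ifs <;> norm_num

theorem col_bedge {P : ℂ} {A : Set ℂ} (hP : P ∈ h.bdryIn A) :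
    h.col (h.bedge P) = 0 ∨ h.col (h.bedge P) = 1 := by
  obtain ⟨h1, -, i, hi⟩ := mem_bdryIn.1 hP
  rcases bedge_spec h1 hi with ⟨h5, -⟩ | ⟨h5, -⟩ <;> simp [h5]

theorem eps_bedge {P : ℂ} {A : Set ℂ} (hP : P ∈ h.bdryIn A) {c : ℕ}
    (hc : h.col (h.bedge P) ≠ c) : eps c (h.col (h.bedge P)) = 0 := by
  rcases col_bedge hP with h1 | h1 <;> rw [h1] at hc ⊢ <;> simp [eps, hc]

/-- A union of components has as many ends of a given colour on the three sides. -/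
theorem card_ends_eq {A : Set ℂ} (hA : h.IsClosedSet A) {c : ℕ} (hc : c = 0 ∨ c = 1)
    (i : Fin 3) : (h.ends A c i).card = (h.ends A c (i + 1)).card := by
  -- With the rotation `r`, an end on side `j` has weight `F (i + 1 - j)`: 1 on side `i + 1`, -1 on
  -- side `i` and 0 on the third side, up to the common sign of the ends.
  let F : Fin 3 → ℝ := ![1, -1, 0]
  let r : Fin 3 := i + 1 + endType c
  have hF : F (r - 0) + F (r - 1) + F (r - 2) = 0 := by
    rw [sum_sub_eq]; simp [F]
  have hq := isCharge_of_sum_eq_zero hc (G := fun k => F (r - k)) hF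
  have h1 := sum_edgesIn hA hq fun _ => 1
  simp only [sub_self, mul_zero, Finset.sum_const_zero, one_mul] at h1
  have h2 : ∀ P ∈ h.bdryIn A, h.sign P * h.vertexCharge
      (fun a k => eps c a * F (r - shift c a k)) P = h.sign P *
        (eps c (h.col (h.bedge P)) * F (r - shift c (h.col (h.bedge P)) (h.typ (h.bedge P)))) := by
    intro P hP
    obtain ⟨hP1, -, hP3⟩ := mem_bdryIn.1 hP
    rw [vertexCharge_bedge _ hP1 hP3]
  rw [Finset.sum_congr rfl h2, sum_bdryIn (c := c) fun P hP hne => by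
    rw [eps_bedge hP hne]; ring] at h1
  have h3 : ∀ j, ∑ P ∈ h.ends A c j, h.sign P * (eps c (h.col (h.bedge P)) *
      F (r - shift c (h.col (h.bedge P)) (h.typ (h.bedge P)))) =
        (h.ends A c j).card * (endSign c * F (i + 1 - j)) := by
    intro j
    rw [← nsmul_eq_mul, ← Finset.sum_const]
    refine Finset.sum_congr rfl fun P hP => ?_
    rw [(mem_ends.1 hP).2.2.2, (ends_spec hP).1, (ends_spec hP).2, eps_self, shift_self hc, one_mul]
    congr 2
    simp only [r]
    abel
  rw [Finset.sum_congr rfl fun j _ => h3 j] at h1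
  have h4 : ∑ j, (h.ends A c j).card * F (i + 1 - j) = 0 := by
    have h5 : endSign c * ∑ j, (h.ends A c j).card * F (i + 1 - j) = 0 := by
      rw [Finset.mul_sum, h1]
      exact Finset.sum_congr rfl fun j _ => by ring
    have h6 := endSign_mul_self c
    rcases mul_eq_zero.1 h5 with h7 | h7
    · rw [h7, zero_mul] at h6
      exact absurd h6 zero_ne_one
    · exact h7
  have e1 : (1 : Fin 3) - 2 = 2 := rfl
  have e2 : (1 : Fin 3) + 1 = 2 := rfl
  have e3 : (2 : Fin 3) + 1 = 0 := rfl
  have e4 : (2 : Fin 3) - 1 = 1 := rfl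
  have e5 : (0 : Fin 3) - 1 = 2 := rfl
  have e6 : (0 : Fin 3) - 2 = 1 := rfl
  have h7 : ((h.ends A c i).card : ℝ) = (h.ends A c (i + 1)).card := by
    rw [Fin.sum_univ_three] at h4
    fin_cases i <;> simp [F, e1, e2, e3, e4, e5, e6] at h4 ⊢ <;>
      (refine Nat.cast_injective (R := ℝ) ?_; linarith)
  exact_mod_cast h7

theorem card_ends_eq' {A : Set ℂ} (hA : h.IsClosedSet A) {c : ℕ} (hc : c = 0 ∨ c = 1)
    (i : Fin 3) : (h.ends A c i).card = (h.ends A c 0).card := by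
  have h0 := card_ends_eq hA hc 0
  have h1 := card_ends_eq hA hc 1
  fin_cases i
  · rfl
  · exact h0.symm
  · exact h1.symm.trans h0.symm

theorem re_of_side_zero {P : ℂ} (hP : P ∈ h.verts) (hi : P ∈ side 0) : 1 / 2 < P.re := by
  have h1 := coord_pos_of_ne hP hi (j := 1) (by decide)
  have h2 := coord_sum P
  rw [hi.2] at h2
  rw [re_eq_coord]
  linarith

theorem re_of_side_one {P : ℂ} (hP : P ∈ h.verts) (hi : P ∈ side 1) : P.re < 1 / 2 := by
  have h1 := coord_pos_of_ne hP hi (j := 0) (by decide)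
  have h2 := coord_sum P
  rw [hi.2] at h2
  rw [re_eq_coord, hi.2]
  linarith

/-- The contribution of a pair of vertices on different sides. -/
def kappa (i j : Fin 3) : ℝ := if i < j then 1 else 0

/-- Sides 0 and 1 are separated by the abscissa 1/2. If `P` is on an upper side and `p` on the
bottom, exactly one of the two tests in `theta` holds; in the opposite case neither applies. -/
theorem theta_eq_kappa {P p : ℂ} {i j : Fin 3} (hP : P ∈ h.verts) (hp : p ∈ h.verts)
    (hi : P ∈ side i) (hj : p ∈ side j) (hij : i ≠ j) : theta P p = kappa i j := by
  classical
  have hP2 : P ∈ side 2 ↔ i = 2 := ⟨fun h2 => side_unique hP hi h2, fun h2 => h2 ▸ hi⟩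
  have hp2 : p ∈ side 2 ↔ j = 2 := ⟨fun h2 => side_unique hp hj h2, fun h2 => h2 ▸ hj⟩
  unfold theta kappa
  simp only [hP2, hp2]
  fin_cases i <;> fin_cases j
  · exact absurd rfl hij
  · have h1 := re_of_side_zero hP hi
    have h2 := re_of_side_one hp hj
    have h3 : p.re < P.re := h2.trans h1
    simp [h3]
  · rcases le_or_gt P.re p.re with h3 | h3
    · simp [h3, h3.not_gt]
    · simp [h3, h3.not_ge]
  · have h1 := re_of_side_one hP hi
    have h2 := re_of_side_zero hp hj
    have h3 : ¬ p.re < P.re := by linarith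
    simp [h3]
  · exact absurd rfl hij
  · rcases le_or_gt P.re p.re with h3 | h3
    · simp [h3, h3.not_gt]
    · simp [h3, h3.not_ge]
  · simp
  · simp
  · exact absurd rfl hij

/-- The intersection number of the ends of two colours. -/
theorem card_mul_card_eq_zero {A : Set ℂ} (hA : h.IsClosedSet A) {F : Fin 3 → ℝ}
    (hF : F 0 + F 1 + F 2 = 0) {c c' : ℕ} (hc : c = 0 ∨ c = 1) (hc' : c' = 0 ∨ c' = 1)
    (hcross : ∀ e ∈ h.edgesIn A, ∀ f ∈ h.edgesIn Aᶜ, (segInterior e ∩ segInterior f).Nonempty →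
      pairing F c c' (h.col e) (h.typ e) (h.col f) (h.typ f) = 0)
    (hsame : ∀ i, ∀ P ∈ h.ends A c i, ∀ p ∈ h.ends Aᶜ c' i,
      F (endType c' - endType c) * theta P p = 0)
    (hne : F (1 + (endType c' - endType c)) + F (2 + (endType c' - endType c)) +
      F (1 + (endType c' - endType c)) ≠ 0) :
    (h.ends A c 0).card = 0 ∨ (h.ends Aᶜ c' 0).card = 0 := by
  have h1 := sum_theta_eq_zero hA (W := pairing F c c')
    (fun a' m => isCharge_pairing_left hF hc c' a' m)
    (fun a k => isCharge_pairing_right hF hc' c a k) hcross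
  rw [sum_bdryIn (c := c) fun P hP hne => Finset.sum_eq_zero fun p _ => by
    rw [pairing, eps_bedge hP hne]; ring] at h1
  have h2 : ∀ i, ∀ P ∈ h.ends A c i, ∑ p ∈ h.bdryIn Aᶜ, h.sign P * h.sign p *
      pairing F c c' (h.col (h.bedge P)) (h.typ (h.bedge P)) (h.col (h.bedge p))
        (h.typ (h.bedge p)) * theta P p = ∑ j, (h.ends Aᶜ c' j).card *
          (endSign c * endSign c' * F (j - i + (endType c' - endType c)) * kappa i j) := by
    intro i P hP
    rw [sum_bdryIn (c := c') fun p hp hne => by rw [pairing, eps_bedge hp hne]; ring]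
    refine Finset.sum_congr rfl fun j _ => ?_
    rw [← nsmul_eq_mul, ← Finset.sum_const]
    refine Finset.sum_congr rfl fun p hp => ?_
    obtain ⟨hP1, -, hP3, hP4⟩ := mem_ends.1 hP
    obtain ⟨hp1, -, hp3, hp4⟩ := mem_ends.1 hp
    rw [pairing, (ends_spec hP).1, (ends_spec hP).2, (ends_spec hp).1, (ends_spec hp).2, hP4, hp4,
      eps_self, eps_self, shift_self hc, shift_self hc', one_mul, one_mul,
      show j + endType c' - (i + endType c) = j - i + (endType c' - endType c) by abel]
    rcases eq_or_ne i j with rfl | hij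
    · rw [sub_self, zero_add, mul_assoc, hsame i P hP p hp]
      simp [kappa]
    · rw [theta_eq_kappa hP1 hp1 hP3 hp3 hij]
  have h3 : ∀ i, ∑ P ∈ h.ends A c i, ∑ p ∈ h.bdryIn Aᶜ, h.sign P * h.sign p *
      pairing F c c' (h.col (h.bedge P)) (h.typ (h.bedge P)) (h.col (h.bedge p))
        (h.typ (h.bedge p)) * theta P p = (h.ends A c 0).card * ∑ j, (h.ends Aᶜ c' 0).card *
          (endSign c * endSign c' * F (j - i + (endType c' - endType c)) * kappa i j) := by
    intro i
    rw [Finset.sum_congr rfl (h2 i), Finset.sum_const, nsmul_eq_mul, card_ends_eq' hA hc i]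
    simp only [card_ends_eq' hA.compl hc']
  rw [Finset.sum_congr rfl fun i _ => h3 i] at h1
  by_contra hcon
  push Not at hcon
  generalize endType c' - endType c = d at *
  have e1 : (2 : Fin 3) - 1 = 1 := rfl
  simp only [Fin.sum_univ_three, kappa] at h1
  simp [e1] at h1
  have hs : endSign c * endSign c' ≠ 0 := by
    have a1 := endSign_mul_self c
    have a2 := endSign_mul_self c'
    intro h0
    rcases mul_eq_zero.1 h0 with h0 | h0 <;> simp [h0] at a1 a2
  -- The pairs of sides with `i < j` are (0,1), (0,2), (1,2), with differences 1, 2, 1.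
  have h5 : ((h.ends A c 0).card : ℝ) * (h.ends Aᶜ c' 0).card * (endSign c * endSign c') *
      (F (1 + d) + F (2 + d) + F (1 + d)) = 0 := by linear_combination h1
  refine mul_ne_zero (mul_ne_zero (mul_ne_zero ?_ ?_) hs) hne h5
  · exact_mod_cast hcon.1
  · exact_mod_cast hcon.2

/-- Crossings only involve the colours 0 and 1, so the pairing of a colour with itself ignores them.
The choice `F 0 = 0` removes pairs of ends on a common side. -/
theorem card_ends_same {A : Set ℂ} (hA : h.IsClosedSet A) {c : ℕ} (hc : c = 0 ∨ c = 1) :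
    (h.ends A c 0).card = 0 ∨ (h.ends Aᶜ c 0).card = 0 := by
  refine card_mul_card_eq_zero hA (F := ![0, 1, -1]) (by simp) hc hc ?_ ?_ ?_
  · intro e he f hf hm
    have hne : e ≠ f := fun heq =>
      edgesIn_ne_of_mem hA he hf (lft_mem e) (by rw [← heq]; exact lft_mem e)
    rcases crossing_spec (mem_edgesIn.1 he).1 (mem_edgesIn.1 hf).1 hne hm with
      ⟨h1, h2, -⟩ | ⟨h1, h2, -⟩ <;> rcases hc with rfl | rfl <;> simp [pairing, eps, h1, h2]
  · intro i P _ p _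
    rw [sub_self]
    simp
  · rw [sub_self]
    simp

/-- On a side, the vertices of colour `0` come before the vertices of colour `1`. -/
theorem theta_eq_zero {A : Set ℂ} {i : Fin 3} {P p : ℂ} (hP : P ∈ h.ends A 0 i)
    (hp : p ∈ h.ends Aᶜ 1 i) : theta P p = 0 := by
  classical
  obtain ⟨hP1, hP2, hP3, hP4⟩ := mem_ends.1 hP
  obtain ⟨hp1, hp2, hp3, hp4⟩ := mem_ends.1 hp
  have hlt : coord (i + 1) P < coord (i + 1) p := by
    rcases lt_trichotomy (coord (i + 1) P) (coord (i + 1) p) with h1 | h1 | h1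
    · exact h1
    · have : P = p := coord_ext i (i + 1) (by fin_cases i <;> simp) (by rw [hP3.2, hp3.2]) h1
      exact absurd hP2 (by rw [this]; exact hp2)
    · have hb := bedge_mem hP1
      have hb' := bedge_mem hp1
      have h2 := h.side_mono i ⟨_, hb'.1⟩ ⟨_, hb.1⟩ p hb'.2 P hb.2 hp3 hP3 h1
      rw [← h.col_eq hb.1, ← h.col_eq hb'.1, hP4, hp4] at h2
      omega
  have hP5 : P ∈ side 2 ↔ i = 2 := ⟨fun h2 => side_unique hP1 hP3 h2, fun h2 => h2 ▸ hP3⟩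
  have hp5 : p ∈ side 2 ↔ i = 2 := ⟨fun h2 => side_unique hp1 hp3 h2, fun h2 => h2 ▸ hp3⟩
  have s1 := coord_sum P
  have s2 := coord_sum p
  have r1 := re_eq_coord P
  have r2 := re_eq_coord p
  have z1 := hP3.2
  have z2 := hp3.2
  unfold theta
  simp only [hP5, hp5]
  fin_cases i
  · replace hlt : coord 1 P < coord 1 p := hlt
    replace z1 : coord 0 P = 0 := z1
    replace z2 : coord 0 p = 0 := z2
    have : ¬ p.re < P.re := by linarith
    simp [this]
  · replace hlt : coord 2 P < coord 2 p := hlt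
    replace z1 : coord 1 P = 0 := z1
    replace z2 : coord 1 p = 0 := z2
    have : ¬ p.re < P.re := by linarith
    simp [this]
  · replace hlt : coord 0 P < coord 0 p := hlt
    replace z1 : coord 2 P = 0 := z1
    replace z2 : coord 2 p = 0 := z2
    have : ¬ P.re ≤ p.re := by linarith
    simp [this]

/-- A 0-edge and a 1-edge cross only with types differing by 2, so `F 2 = 0` removes the crossings;
pairs on a common side vanish since colour 0 precedes colour 1 there. -/
theorem card_ends_zero_one {A : Set ℂ} (hA : h.IsClosedSet A) :
    (h.ends A 0 0).card = 0 ∨ (h.ends Aᶜ 1 0).card = 0 := by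
  have e0 : (2 : Fin 3) - 1 = 1 := rfl
  refine card_mul_card_eq_zero hA (F := ![1, -1, 0]) (by simp) (Or.inl rfl) (Or.inr rfl) ?_ ?_ ?_
  · intro e he f hf hm
    have hne : e ≠ f := fun heq =>
      edgesIn_ne_of_mem hA he hf (lft_mem e) (by rw [← heq]; exact lft_mem e)
    rcases crossing_spec (mem_edgesIn.1 he).1 (mem_edgesIn.1 hf).1 hne hm with
      ⟨h1, h2, h3⟩ | ⟨h1, h2, h3⟩
    · rw [h3]
      simp [pairing, eps, h1, h2, shift]
    · simp [pairing, eps, h1, h2]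
  · intro i P hP p hp
    rw [theta_eq_zero hP hp, mul_zero]
  · have e1 : (1 : Fin 3) + 1 = 2 := rfl
    have e2 : (2 : Fin 3) + 1 = 0 := rfl
    simp [endType, e0, e1, e2]

/-- The leftmost vertex of `A` lies on the boundary: an interior vertex has edges in all three
directions, one of which goes left. -/
theorem exists_ends {A : Set ℂ} (hA : h.IsClosedSet A) (hne : ∃ v ∈ h.verts, v ∈ A) :
    (h.ends A 0 0).card ≠ 0 ∨ (h.ends A 1 0).card ≠ 0 := by
  classical
  have hne' : (h.vfin.filter fun v => v ∈ A).Nonempty := by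
    obtain ⟨v, hv, hvA⟩ := hne
    exact ⟨v, Finset.mem_filter.2 ⟨mem_vfin.2 hv, hvA⟩⟩
  obtain ⟨v, hv, hmin⟩ := Finset.exists_min_image _ (fun v : ℂ => v.re) hne'
  rw [Finset.mem_filter, mem_vfin] at hv
  have hside : ∃ i, v ∈ side i := by
    by_contra hcon
    push Not at hcon
    have hleft : ∃ l : Fin 3, -h.sign v * dirRe l < 0 := by
      rcases h.sign_eq_or v with h1 | h1
      · exact ⟨2, by rw [h1]; simp [dirRe]⟩
      · exact ⟨0, by rw [h1]; simp [dirRe]; norm_num⟩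
    obtain ⟨l, hl⟩ := hleft
    obtain ⟨e, ⟨he, hve⟩, htyp⟩ := exists_star_typ (degree_eq_three hv.1 hcon) l
    obtain ⟨w, rfl⟩ := Sym2.mem_iff_exists.1 hve
    obtain ⟨r, hr, hw⟩ := sign_spec he
    have h1 := congrArg Complex.re hw
    rw [add_mul_dir_re, htyp] at h1
    have h2 := hmin w (Finset.mem_filter.2 ⟨mem_vfin.2 (mem_verts_right he),
      (hA _ _ he).1 hv.2⟩)
    nlinarith
  obtain ⟨i, hi⟩ := hside
  have key : ∀ c, (c = 0 ∨ c = 1) → h.col (h.bedge v) = c → (h.ends A c 0).card ≠ 0 := by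
    intro c hc hcol
    rw [← card_ends_eq' hA hc i]
    exact Finset.card_ne_zero_of_mem (mem_ends.2 ⟨hv.1, hv.2, hi, hcol⟩)
  rcases bedge_spec hv.1 hi with ⟨h1, -⟩ | ⟨h1, -⟩
  · exact Or.inl (key 0 (Or.inl rfl) h1)
  · exact Or.inr (key 1 (Or.inr rfl) h1)

/-- The structure graph of a triangular honeycomb is connected. -/
theorem isClosedSet_trivial {A : Set ℂ} (hA : h.IsClosedSet A) (hne : ∃ v ∈ h.verts, v ∈ A)
    (hne' : ∃ v ∈ h.verts, v ∉ A) : False := by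
  have h1 := card_ends_same hA (c := 0) (Or.inl rfl)
  have h2 := card_ends_same hA (c := 1) (Or.inr rfl)
  have h3 := card_ends_zero_one hA
  have h4 := card_ends_zero_one hA.compl
  rw [compl_compl] at h4
  have h5 := exists_ends hA hne
  have h6 := exists_ends hA.compl hne'
  -- An end of either colour in `A` excludes both colours from `Aᶜ`, which nevertheless has an end.
  omega

theorem exists_mem_side (hn : n ≠ 0) (i : Fin 3) : ∃ v ∈ h.verts, v ∈ side i := by
  have h1 := h.encard_side i
  have h2 : (h.support ∩ side i).Nonempty := by
    rw [← Set.encard_ne_zero, h1]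
    exact_mod_cast hn
  obtain ⟨v, hv1, hv2⟩ := h2
  exact ⟨v, mem_verts_of_support hv1 hv2, hv2⟩

theorem graph_connected (hn : n ≠ 0) : h.graph.Connected := by
  rw [SimpleGraph.connected_iff]
  constructor
  · intro v w
    by_contra hvw
    let A : Set ℂ := {x | ∃ hx : x ∈ h.verts, h.graph.Reachable v ⟨x, hx⟩}
    have hA : h.IsClosedSet A := by
      have key : ∀ x y, s(x, y) ∈ h.edges → x ∈ A → y ∈ A := by
        rintro x y he ⟨hx, hr⟩
        refine ⟨mem_verts_right he, hr.trans (SimpleGraph.Adj.reachable ?_)⟩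
        exact he
      exact fun x y he => ⟨key x y he, key y x (by rwa [Sym2.eq_swap])⟩
    exact isClosedSet_trivial hA ⟨v, v.2, v.2, SimpleGraph.Reachable.refl v⟩
      ⟨w, w.2, fun ⟨_, hr⟩ => hvw hr⟩
  · obtain ⟨v, hv, -⟩ := exists_mem_side (h := h) hn 0
    exact ⟨⟨v, hv⟩⟩

end TriHoneycomb

end Honey

end

noncomputable section

namespace Honey

namespace TriHoneycomb

variable {n : ℕ} {h h' : TriHoneycomb n}

/-! ## The ordered boundary vertices -/

theorem mem_support_of_verts {v : ℂ} (hv : v ∈ h.verts) : v ∈ h.support := by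
  obtain ⟨w, he⟩ := exists_edge hv
  exact Set.mem_biUnion he ⟨v, w, rfl, left_mem_segment ℝ v w⟩

theorem support_inter_side (j : Fin 3) : h.support ∩ side j = {v | v ∈ h.verts ∧ v ∈ side j} := by
  ext v
  exact ⟨fun hv => ⟨mem_verts_of_support hv.1 hv.2, hv.2⟩,
    fun hv => ⟨mem_support_of_verts hv.1, hv.2⟩⟩

theorem coord_injOn_side (j : Fin 3) : Set.InjOn (coord (j + 1)) (side j) := by
  intro v hv w hw hvw
  exact coord_ext j (j + 1) (by fin_cases j <;> decide) (hv.2.trans hw.2.symm) hvw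

theorem exists_bvert (h : TriHoneycomb n) (j : Fin 3) : ∃ P : Fin n → ℂ,
    StrictAnti (fun k => coord (j + 1) (P k)) ∧ Set.range P = {v | v ∈ h.verts ∧ v ∈ side j} := by
  classical
  have h1 := h.encard_side j
  rw [support_inter_side] at h1
  have hfin : {v | v ∈ h.verts ∧ v ∈ side j}.Finite := verts_finite.subset fun _ hv => hv.1
  let s : Finset ℝ := hfin.toFinset.image (coord (j + 1))
  have hs : s.card = n := by
    rw [Finset.card_image_of_injOn, ← ENat.natCast_inj, ← h1, ← Set.encard_coe_eq_coe_finsetCard,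
      hfin.coe_toFinset]
    rw [hfin.coe_toFinset]
    exact (coord_injOn_side j).mono fun _ hv => hv.2
  have hx : ∀ k, ∃ v, (v ∈ h.verts ∧ v ∈ side j) ∧ coord (j + 1) v = s.orderEmbOfFin hs k := by
    intro k
    obtain ⟨v, hv, hv'⟩ := Finset.mem_image.1 (s.orderEmbOfFin_mem hs k)
    exact ⟨v, hfin.mem_toFinset.1 hv, hv'⟩
  choose P hP hP' using hx
  refine ⟨fun k => P k.rev, fun a b hab => ?_, ?_⟩
  · change coord (j + 1) (P b.rev) < coord (j + 1) (P a.rev)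
    rw [hP', hP']
    exact (s.orderEmbOfFin hs).strictMono (Fin.rev_lt_rev.2 hab)
  · ext v
    constructor
    · rintro ⟨k, rfl⟩
      exact hP _
    · intro hv
      have hmem : coord (j + 1) v ∈ Set.range (s.orderEmbOfFin hs) := by
        rw [Finset.range_orderEmbOfFin]
        exact Finset.mem_image_of_mem _ (hfin.mem_toFinset.2 hv)
      obtain ⟨k, hk⟩ := hmem
      refine ⟨k.rev, ?_⟩
      change P k.rev.rev = v
      rw [Fin.rev_rev]
      exact coord_injOn_side j (hP k).2 hv.2 ((hP' k).trans hk)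

/-- The boundary vertices on `∂_j T`, ordered by decreasing `(j + 1)`-coordinate. -/
def bvert (h : TriHoneycomb n) (j : Fin 3) : Fin n → ℂ := (h.exists_bvert j).choose

theorem bvert_strictAnti (h : TriHoneycomb n) (j : Fin 3) :
    StrictAnti (fun k => coord (j + 1) (h.bvert j k)) := (h.exists_bvert j).choose_spec.1

theorem range_bvert (h : TriHoneycomb n) (j : Fin 3) :
    Set.range (h.bvert j) = {v | v ∈ h.verts ∧ v ∈ side j} := (h.exists_bvert j).choose_spec.2

theorem bvert_mem (h : TriHoneycomb n) (j : Fin 3) (k : Fin n) : h.bvert j k ∈ h.verts := by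
  have : h.bvert j k ∈ Set.range (h.bvert j) := ⟨k, rfl⟩
  rw [range_bvert] at this
  exact this.1

theorem bvert_mem_side (h : TriHoneycomb n) (j : Fin 3) (k : Fin n) : h.bvert j k ∈ side j := by
  have : h.bvert j k ∈ Set.range (h.bvert j) := ⟨k, rfl⟩
  rw [range_bvert] at this
  exact this.2

theorem bvert_injective (h : TriHoneycomb n) (j : Fin 3) : Function.Injective (h.bvert j) :=
  fun _ _ hab => (h.bvert_strictAnti j).injective (congrArg (coord (j + 1)) hab)

theorem exists_bvert_eq {v : ℂ} {j : Fin 3} (hv : v ∈ h.verts) (hj : v ∈ side j) :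
    ∃ k, h.bvert j k = v := by
  have : v ∈ Set.range (h.bvert j) := by
    rw [range_bvert]
    exact ⟨hv, hj⟩
  exact this

theorem sideValues_eq (h : TriHoneycomb n) (j : Fin 3) :
    h.sideValues j = Set.range fun k => coord (j + 1) (h.bvert j k) := by
  rw [sideValues, support_inter_side, ← range_bvert, ← Set.range_comp]
  rfl

theorem sideValues_eq_range_iff {x : Fin n → ℝ} (hx : StrictAnti x) (j : Fin 3) :
    h.sideValues j = Set.range x ↔ ∀ k, coord (j + 1) (h.bvert j k) = x k := by
  rw [sideValues_eq, StrictAnti.range_inj (h.bvert_strictAnti j) hx, funext_iff]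

theorem coord_bvert_mem_Ioo (h : TriHoneycomb n) (j : Fin 3) (k : Fin n) :
    coord (j + 1) (h.bvert j k) ∈ Set.Ioo (0 : ℝ) 1 := by
  have h0 := (h.bvert_mem_side j k).2
  have h1 := coord_pos_of_ne (h.bvert_mem j k) (h.bvert_mem_side j k) (j := j + 1)
    (by fin_cases j <;> decide)
  have h2 := coord_pos_of_ne (h.bvert_mem j k) (h.bvert_mem_side j k) (j := j + 2)
    (by fin_cases j <;> decide)
  have h3 := coord_sum_cyclic j (h.bvert j k)
  exact ⟨h1, by linarith⟩

/-! ## Isomorphisms of structure graphs -/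

namespace StructIso

open Classical in
/-- The map induced on the vertices by an isomorphism. -/
def fn (φ : StructIso h h') (v : ℂ) : ℂ := if hv : v ∈ h.verts then (φ.iso ⟨v, hv⟩).1 else v

theorem fn_coe (φ : StructIso h h') (v : h.verts) : φ.fn v.1 = (φ.iso v).1 := dif_pos v.2

theorem fn_mem (φ : StructIso h h') {v : ℂ} (hv : v ∈ h.verts) : φ.fn v ∈ h'.verts := by
  rw [φ.fn_coe ⟨v, hv⟩]
  exact (φ.iso ⟨v, hv⟩).2

theorem symm_fn_fn (φ : StructIso h h') {v : ℂ} (hv : v ∈ h.verts) : φ.symm.fn (φ.fn v) = v := by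
  rw [φ.fn_coe ⟨v, hv⟩, fn_coe]
  change ((φ.iso.symm (φ.iso ⟨v, hv⟩)).1 : ℂ) = v
  rw [RelIso.symm_apply_apply]

theorem edge_mem (φ : StructIso h h') {v w : ℂ} (he : s(v, w) ∈ h.edges) :
    s(φ.fn v, φ.fn w) ∈ h'.edges := by
  rw [φ.fn_coe ⟨v, mem_verts_left he⟩, φ.fn_coe ⟨w, mem_verts_right he⟩]
  exact φ.iso.map_rel_iff.2 (show h.graph.Adj ⟨v, mem_verts_left he⟩ ⟨w, mem_verts_right he⟩ from he)

theorem map_mem (φ : StructIso h h') {e : Sym2 ℂ} (he : e ∈ h.edges) :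
    e.map φ.fn ∈ h'.edges := by
  induction e with
  | _ v w => exact φ.edge_mem he

theorem map_symm_map (φ : StructIso h h') {e : Sym2 ℂ} (he : e ∈ h.edges) :
    (e.map φ.fn).map φ.symm.fn = e := by
  induction e with
  | _ v w =>
    rw [Sym2.map_mk, Sym2.map_mk, φ.symm_fn_fn (mem_verts_left he),
      φ.symm_fn_fn (mem_verts_right he)]

/-- The induced bijection between the edges. -/
def edgeEquiv (φ : StructIso h h') : {e // e ∈ h.edges} ≃ {e // e ∈ h'.edges} where
  toFun e := ⟨e.1.map φ.fn, φ.map_mem e.2⟩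
  invFun e := ⟨e.1.map φ.symm.fn, φ.symm.map_mem e.2⟩
  left_inv e := Subtype.ext (φ.map_symm_map e.2)
  right_inv e := Subtype.ext (φ.symm.map_symm_map e.2)

theorem col_map (φ : StructIso h h') {e : Sym2 ℂ} (he : e ∈ h.edges) :
    h'.col (e.map φ.fn) = h.col e := by
  rw [h'.col_eq (φ.map_mem he), h.col_eq he]
  induction e with
  | _ v w =>
    have h1 := φ.fn_coe ⟨v, mem_verts_left he⟩
    have h2 := φ.fn_coe ⟨w, mem_verts_right he⟩
    have h3 : s((φ.iso ⟨v, mem_verts_left he⟩).1, (φ.iso ⟨w, mem_verts_right he⟩).1) ∈ h'.edges := by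
      rw [← h1, ← h2]
      exact φ.map_mem he
    rw [← φ.color_eq ⟨v, mem_verts_left he⟩ ⟨w, mem_verts_right he⟩ he h3]
    congr 2
    rw [Sym2.map_mk, ← h1, ← h2]

theorem fn_mem_side (φ : StructIso h h') {v : ℂ} (hv : v ∈ h.verts) (j : Fin 3) :
    φ.fn v ∈ side j ↔ v ∈ side j := by
  rw [φ.fn_coe ⟨v, hv⟩]
  exact φ.side_iff j ⟨v, hv⟩

/-- The induced map on indices is strictly increasing from `Fin n` to itself, hence the identity. -/
theorem fn_bvert (φ : StructIso h h') (j : Fin 3) (k : Fin n) :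
    φ.fn (h.bvert j k) = h'.bvert j k := by
  have h1 : ∀ k, ∃ l, h'.bvert j l = φ.fn (h.bvert j k) := fun k =>
    exists_bvert_eq (φ.fn_mem (h.bvert_mem j k))
      ((φ.fn_mem_side (h.bvert_mem j k) j).2 (h.bvert_mem_side j k))
  choose f hf using h1
  have h2 : StrictMono f := by
    intro a b hab
    rw [← (h'.bvert_strictAnti j).lt_iff_gt, hf, hf, φ.fn_coe ⟨_, h.bvert_mem j a⟩,
      φ.fn_coe ⟨_, h.bvert_mem j b⟩]
    exact (φ.order_iff j ⟨_, h.bvert_mem j b⟩ ⟨_, h.bvert_mem j a⟩ (h.bvert_mem_side j b)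
      (h.bvert_mem_side j a)).2 (h.bvert_strictAnti j hab)
  have h3 : f = id := by
    refine (StrictMono.range_inj h2 strictMono_id).1 ?_
    rw [Set.range_id, Set.range_eq_univ]
    exact Finite.injective_iff_surjective.1 h2.injective
  rw [← hf, h3, id]

/-- The sign at a boundary vertex is read off its colour, and signs alternate along edges.
Connectedness propagates the equality. -/
theorem sign_fn (φ : StructIso h h') (hn : n ≠ 0) {v : ℂ} (hv : v ∈ h.verts) :
    h'.sign (φ.fn v) = h.sign v := by
  obtain ⟨a, ha, ha0⟩ := exists_mem_side (h := h) hn 0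
  have key : ∀ x y : h.verts, h.graph.Reachable x y →
      h'.sign (φ.fn x) = h.sign x → h'.sign (φ.fn y) = h.sign y := by
    rintro x y ⟨p⟩
    induction p with
    | nil => exact id
    | cons hadj p ih =>
      intro hx
      refine ih ?_
      rw [sign_neighbor (h := h) hadj, ← hx, sign_neighbor (φ.edge_mem hadj)]
  refine key ⟨a, ha⟩ ⟨v, hv⟩ ((graph_connected hn).preconnected _ _) ?_
  obtain ⟨w, he⟩ := exists_edge ha
  have hc := φ.col_map he
  rw [Sym2.map_mk] at hc
  rcases side_spec ha0 he with ⟨h1, -, h2⟩ | ⟨h1, -, h2⟩ <;>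
  rcases side_spec ((φ.fn_mem_side ha 0).2 ha0) (φ.edge_mem he) with ⟨h3, -, h4⟩ | ⟨h3, -, h4⟩
  · rw [h2, h4]
  · omega
  · omega
  · rw [h2, h4]

end StructIso

end TriHoneycomb

/-! ## Disjoint unions of triangles -/

section Family

open TriHoneycomb

variable {N n : ℕ}

/-- The disjoint union of the structure graphs of the triangles. -/
abbrev unionGraph (t : Fin N → TriHoneycomb n) : FinGraph where
  V := Σ i, (t i).verts
  E := Σ i, {e // e ∈ (t i).edges}
  src e := ⟨e.1, (Quot.out e.2.1).1, e.2.1, e.2.2, Sym2.out_fst_mem _⟩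
  tgt e := ⟨e.1, (Quot.out e.2.1).2, e.2.1, e.2.2, Sym2.out_snd_mem _⟩

/-- The flow of a family of triangular honeycombs. -/
def unionFlow (t : Fin N → TriHoneycomb n) : (unionGraph t).Flow :=
  WithLp.toLp 2 fun e => (t e.1).sign (Quot.out e.2.1).1 * (t e.1).height e.2

theorem out_eq (e : Sym2 ℂ) : s((Quot.out e).1, (Quot.out e).2) = e := Quot.out_eq e

/-- The outflow at a vertex. -/
def TriHoneycomb.outflow (h : TriHoneycomb n) (v : ℂ) : ℝ :=
  h.sign v * h.vertexCharge (fun _ k => coord k v) v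

/-- Each type occurs once, and the three coordinates of a point sum to 1. -/
theorem TriHoneycomb.outflow_of_degree {h : TriHoneycomb n} {v : ℂ} (hd : h.degree v = 3) :
    h.outflow v = h.sign v := by
  obtain ⟨E, hinj, hl, -, himg, -⟩ := exists_starFin_eq hd
  have h1 : h.vertexCharge (fun _ k => coord k v) v = 1 := by
    rw [vertexCharge, himg, Finset.sum_image hinj.injOn]
    simp only [hl]
    rw [Fin.sum_univ_three]
    have := coord_sum v
    linarith
  rw [outflow, h1, mul_one]

/-- For colour 0 the height is the `(j + 1)`-coordinate and the sign is -1; for colour 1 the height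
is the `(j + 2)`-coordinate, that is 1 minus the former, and the sign is 1. -/
theorem TriHoneycomb.outflow_of_side {h : TriHoneycomb n} {v : ℂ} {j : Fin 3} (hv : v ∈ h.verts)
    (hj : v ∈ side j) : h.outflow v = h.col (h.bedge v) - coord (j + 1) v := by
  rw [outflow, vertexCharge_bedge _ hv ⟨j, hj⟩]
  have h1 := coord_sum_cyclic j v
  have h2 := hj.2
  rcases bedge_spec hv hj with ⟨hc, ht, hs⟩ | ⟨hc, ht, hs⟩
  · rw [hc, ht, hs]; push_cast; ring
  · rw [hc, ht, hs]; push_cast; linarith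

theorem div_unionFlow (t : Fin N → TriHoneycomb n) (i : Fin N) (v : (t i).verts) :
    (unionGraph t).div (unionFlow t) ⟨i, v⟩ = (t i).outflow v.1 := by
  classical
  rw [FinGraph.div_apply, Fintype.sum_sigma, Finset.sum_eq_single i]
  · have h1 : ∀ e : {e // e ∈ (t i).edges},
        ((if (unionGraph t).src ⟨i, e⟩ = ⟨i, v⟩ then unionFlow t ⟨i, e⟩ else 0) -
          (if (unionGraph t).tgt ⟨i, e⟩ = ⟨i, v⟩ then unionFlow t ⟨i, e⟩ else 0)) =
        if v.1 ∈ e.1 then (t i).sign v * coord ((t i).typ e.1) v else 0 := by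
      rintro ⟨e, he⟩
      have h2 := out_eq e
      have h3 : s((Quot.out e).1, (Quot.out e).2) ∈ (t i).edges := by rwa [h2]
      have h4 := ne_of_edge h3
      have h5 := sign_neighbor h3
      have h6 : ∀ x ∈ e, unionFlow t ⟨i, ⟨e, he⟩⟩ =
          (t i).sign (Quot.out e).1 * coord ((t i).typ e) x := by
        intro x hx
        rw [← height_eq he hx]
        rfl
      have hmem : v.1 ∈ e ↔ v.1 = (Quot.out e).1 ∨ v.1 = (Quot.out e).2 := by
        conv_lhs => rw [← h2]
        exact Sym2.mem_iff
      have h7 : (unionGraph t).src ⟨i, ⟨e, he⟩⟩ = ⟨i, v⟩ ↔ (Quot.out e).1 = v.1 := by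
        simp [Subtype.ext_iff]
      have h8 : (unionGraph t).tgt ⟨i, ⟨e, he⟩⟩ = ⟨i, v⟩ ↔ (Quot.out e).2 = v.1 := by
        simp [Subtype.ext_iff]
      simp only [h7, h8, hmem]
      by_cases ha : (Quot.out e).1 = v.1
      · have hb : (Quot.out e).2 ≠ v.1 := fun hb => h4 (ha.trans hb.symm)
        rw [if_pos ha, if_neg hb, if_pos (Or.inl ha.symm), sub_zero,
          h6 v.1 (hmem.2 (Or.inl ha.symm)), ha]
      · by_cases hb : (Quot.out e).2 = v.1
        · rw [if_neg ha, if_pos hb, if_pos (Or.inr hb.symm), h6 v.1 (hmem.2 (Or.inr hb.symm)),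
            ← hb, h5]
          ring
        · rw [if_neg ha, if_neg hb, if_neg, sub_zero]
          rintro (h | h)
          · exact ha h.symm
          · exact hb h.symm
    rw [Finset.sum_congr rfl fun e _ => h1 e, TriHoneycomb.outflow, TriHoneycomb.vertexCharge,
      TriHoneycomb.starFin, Finset.sum_filter, Finset.mul_sum]
    refine Eq.trans ?_ (Finset.sum_coe_sort (t i).edges _)
    refine Finset.sum_congr rfl fun e _ => ?_
    split_ifs <;> simp
  · intro i' _ hi'
    refine Finset.sum_eq_zero fun e _ => ?_
    have h7 : (unionGraph t).src ⟨i', e⟩ ≠ ⟨i, v⟩ := fun h => hi' (congrArg Sigma.fst h)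
    have h8 : (unionGraph t).tgt ⟨i', e⟩ ≠ ⟨i, v⟩ := fun h => hi' (congrArg Sigma.fst h)
    rw [if_neg h7, if_neg h8, sub_zero]
  · simp

/-- Reference orientations come from `Quot.out`, which an isomorphism need not respect; this is why
`FlipIso` carries signs. -/
theorem out_map {f : ℂ → ℂ} (e : Sym2 ℂ) :
    ((Quot.out (e.map f)).1 = f (Quot.out e).1 ∧ (Quot.out (e.map f)).2 = f (Quot.out e).2) ∨
      ((Quot.out (e.map f)).1 = f (Quot.out e).2 ∧ (Quot.out (e.map f)).2 = f (Quot.out e).1) := by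
  have h1 := out_eq (e.map f)
  have h2 : e.map f = s(f (Quot.out e).1, f (Quot.out e).2) := by
    conv_lhs => rw [← out_eq e]
    rfl
  conv_rhs at h1 => rw [h2]
  exact Sym2.eq_iff.1 h1

theorem TriHoneycomb.StructIso.out_fn_ne {h h' : TriHoneycomb n} (φ : h.StructIso h') {e : Sym2 ℂ}
    (he : e ∈ h.edges) : φ.fn (Quot.out e).1 ≠ φ.fn (Quot.out e).2 := by
  rw [← out_eq e] at he
  exact ne_of_edge (φ.edge_mem he)

/-- The isomorphism of disjoint unions induced by isomorphisms of the triangles. -/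
def unionIso {t t' : Fin N → TriHoneycomb n} (φ : ∀ i, (t i).StructIso (t' i)) :
    FinGraph.FlipIso (unionGraph t) (unionGraph t') where
  eV := Equiv.sigmaCongrRight fun i => (φ i).iso.toEquiv
  eE := Equiv.sigmaCongrRight fun i => (φ i).edgeEquiv
  σ e := open Classical in
    if (Quot.out (e.2.1.map (φ e.1).fn)).1 = (φ e.1).fn (Quot.out e.2.1).1 then 1 else -1
  spec e := by
    obtain ⟨i, e, he⟩ := e
    have hne := StructIso.out_fn_ne (φ i) he
    rcases out_map (f := (φ i).fn) e with ⟨h1, h2⟩ | ⟨h1, h2⟩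
    · refine Or.inl ⟨if_pos h1, ?_, ?_⟩
      · refine Sigma.ext rfl (heq_of_eq (Subtype.ext (h1.trans ?_)))
        exact (φ i).fn_coe ⟨_, _⟩
      · refine Sigma.ext rfl (heq_of_eq (Subtype.ext (h2.trans ?_)))
        exact (φ i).fn_coe ⟨_, _⟩
    · refine Or.inr ⟨if_neg fun h => hne ?_, ?_, ?_⟩
      · rw [← h, h1]
      · refine Sigma.ext rfl (heq_of_eq (Subtype.ext (h1.trans ?_)))
        exact (φ i).fn_coe ⟨_, _⟩
      · refine Sigma.ext rfl (heq_of_eq (Subtype.ext (h2.trans ?_)))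
        exact (φ i).fn_coe ⟨_, _⟩

theorem unionIso_eV {t t' : Fin N → TriHoneycomb n} (φ : ∀ i, (t i).StructIso (t' i)) (i : Fin N)
    (v : (t i).verts) : (unionIso φ).eV ⟨i, v⟩ = ⟨i, (φ i).iso v⟩ := rfl

theorem unionIso_eE {t t' : Fin N → TriHoneycomb n} (φ : ∀ i, (t i).StructIso (t' i)) (i : Fin N)
    (e : {e // e ∈ (t i).edges}) : (unionIso φ).eE ⟨i, e⟩ = ⟨i, (φ i).edgeEquiv e⟩ := rfl

theorem div_unionIso_flow {t t' : Fin N → TriHoneycomb n} (φ : ∀ i, (t i).StructIso (t' i))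
    (i : Fin N) (v : (t i).verts) : (unionGraph t').div ((unionIso φ).flow (unionFlow t))
      ⟨i, (φ i).iso v⟩ = (t i).outflow v.1 := by
  rw [← unionIso_eV, FinGraph.FlipIso.div_flow, div_unionFlow]

/-- The flow of `t`, seen on the graph of `t'`: the value at the image of the oriented edge
`(v, w)` is `s(v) L({v, w})`. -/
theorem eq_unionIso_flow_iff {t t' : Fin N → TriHoneycomb n} (φ : ∀ i, (t i).StructIso (t' i))
    (ω : (unionGraph t').Flow) : ω = (unionIso φ).flow (unionFlow t) ↔
      ∀ (i : Fin N) (v w : (t i).verts) (hvw : s(v.1, w.1) ∈ (t i).edges)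
        (e : {e // e ∈ (t' i).edges}),
        (Quot.out e.1).1 = ((φ i).iso v).1 → (Quot.out e.1).2 = ((φ i).iso w).1 →
          ω ⟨i, e⟩ = (t i).sign v.1 * (t i).height ⟨_, hvw⟩ := by
  have hflow : ∀ (i : Fin N) (v w : (t i).verts) (hvw : s(v.1, w.1) ∈ (t i).edges)
      (e : {e // e ∈ (t' i).edges}),
      (Quot.out e.1).1 = ((φ i).iso v).1 → (Quot.out e.1).2 = ((φ i).iso w).1 →
        (unionIso φ).flow (unionFlow t) ⟨i, e⟩ = (t i).sign v.1 * (t i).height ⟨_, hvw⟩ := by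
    intro i v w hvw e h1 h2
    have h3 : e = (φ i).edgeEquiv ⟨_, hvw⟩ := by
      refine Subtype.ext ?_
      change e.1 = s((φ i).fn v.1, (φ i).fn w.1)
      rw [(φ i).fn_coe v, (φ i).fn_coe w, ← h1, ← h2, out_eq]
    rw [h3, ← unionIso_eE, FinGraph.FlipIso.flow_apply]
    change (if (Quot.out (s(v.1, w.1).map (φ i).fn)).1 = (φ i).fn (Quot.out s(v.1, w.1)).1
      then (1 : ℝ) else -1) * ((t i).sign (Quot.out s(v.1, w.1)).1 * _) = _
    have h4 : s(v.1, w.1).map (φ i).fn = e.1 := by rw [h3]; rfl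
    rw [h4, h1, ← (φ i).fn_coe v]
    have h5 := sign_neighbor hvw
    rcases Sym2.eq_iff.1 (out_eq s(v.1, w.1)) with ⟨h6, -⟩ | ⟨h6, -⟩
    · rw [h6, if_pos rfl, one_mul]
    · rw [h6, if_neg, h5]
      · ring
      · exact ne_of_edge ((φ i).edge_mem hvw)
  constructor
  · rintro rfl
    exact hflow
  · intro h
    ext ⟨i, e⟩
    have h1 : s(((φ i).symm.iso ⟨_, e.1, e.2, Sym2.out_fst_mem _⟩).1,
        ((φ i).symm.iso ⟨_, e.1, e.2, Sym2.out_snd_mem _⟩).1) ∈ (t i).edges := by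
      refine (φ i).symm.iso.map_rel_iff.2 ?_
      change s((Quot.out e.1).1, (Quot.out e.1).2) ∈ _
      rw [out_eq]
      exact e.2
    have h2 : ∀ x : (t' i).verts, (φ i).iso ((φ i).symm.iso x) = x :=
      fun x => (φ i).iso.apply_symm_apply x
    rw [h i _ _ h1 e (by rw [h2]) (by rw [h2]), hflow i _ _ h1 e (by rw [h2]) (by rw [h2])]

end Family

end Honey

end

/-! ### Flows and divergences on glued surfaces -/

noncomputable section

namespace Honey

open TriHoneycomb

theorem TriHoneycomb.StructIso.eq_of_iso {n : ℕ} {h h' : TriHoneycomb n} {φ φ' : h.StructIso h'}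
    (heq : φ.iso = φ'.iso) : φ = φ' := by
  cases φ
  cases φ'
  cases heq
  rfl

section Family

variable {N n : ℕ}

/-- The `k`-th boundary vertex on the side `∂_j T^i`. -/
def bpt (t : Fin N → TriHoneycomb n) (i : Fin N) (j : Fin 3) (k : Fin n) : Σ i, (t i).verts :=
  ⟨i, (t i).bvert j k, (t i).bvert_mem j k⟩

theorem bpt_inj {t : Fin N → TriHoneycomb n} {i i' : Fin N} {j j' : Fin 3} {k k' : Fin n}
    (h : bpt t i j k = bpt t i' j' k') : i = i' ∧ j = j' ∧ k = k' := by
  obtain ⟨rfl, h2⟩ := Sigma.ext_iff.1 h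
  have h3 : (t i).bvert j k = (t i).bvert j' k' := congrArg Subtype.val (eq_of_heq h2)
  have h4 := side_unique ((t i).bvert_mem j k) ((t i).bvert_mem_side j k)
    (by rw [h3]; exact (t i).bvert_mem_side j' k')
  subst h4
  exact ⟨rfl, rfl, (t i).bvert_injective j h3⟩

theorem exists_bpt_eq {t : Fin N → TriHoneycomb n} {i : Fin N} {j : Fin 3} {v : (t i).verts}
    (hj : v.1 ∈ side j) : ∃ k, bpt t i j k = ⟨i, v⟩ := by
  obtain ⟨k, hk⟩ := exists_bvert_eq v.2 hj
  exact ⟨k, Sigma.ext rfl (heq_of_eq (Subtype.ext hk))⟩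

theorem unionIso_bpt {t t' : Fin N → TriHoneycomb n} (φ : ∀ i, (t i).StructIso (t' i)) (i : Fin N)
    (j : Fin 3) (k : Fin n) : (unionIso φ).eV (bpt t i j k) = bpt t' i j k := by
  refine Sigma.ext rfl (heq_of_eq (Subtype.ext ?_))
  change ((φ i).iso ⟨_, _⟩).1 = _
  rw [← StructIso.fn_coe]
  exact (φ i).fn_bvert j k

theorem col_bedge_fn {h h' : TriHoneycomb n} (φ : h.StructIso h') {v : ℂ} {j : Fin 3}
    (hv : v ∈ h.verts) (hj : v ∈ side j) : h'.col (h'.bedge (φ.fn v)) = h.col (h.bedge v) := by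
  obtain ⟨h1, h2⟩ := bedge_mem hv
  have h3 : (h.bedge v).map φ.fn ∈ h'.star (φ.fn v) := by
    refine ⟨φ.map_mem h1, Sym2.mem_map.2 ⟨v, h2, rfl⟩⟩
  rw [edge_unique ((φ.fn_mem_side hv j).2 hj) (bedge_mem (φ.fn_mem hv)) h3, φ.col_map h1]

/-- The divergence at the boundary vertices of the flow of `t`. -/
theorem div_unionIso_flow_bpt {t t' : Fin N → TriHoneycomb n} (φ : ∀ i, (t i).StructIso (t' i))
    (i : Fin N) (j : Fin 3) (k : Fin n) :
    (unionGraph t').div ((unionIso φ).flow (unionFlow t)) (bpt t' i j k) =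
      (t' i).col ((t' i).bedge ((t' i).bvert j k)) - coord (j + 1) ((t i).bvert j k) := by
  rw [← unionIso_bpt φ, FinGraph.FlipIso.div_flow, bpt, div_unionFlow,
    outflow_of_side ((t i).bvert_mem j k) ((t i).bvert_mem_side j k), ← (φ i).fn_bvert,
    col_bedge_fn (φ i) ((t i).bvert_mem j k) ((t i).bvert_mem_side j k)]

/-- The divergence at the interior vertices of the flow of `t`. -/
theorem div_unionIso_flow_inner (hn : n ≠ 0) {t t' : Fin N → TriHoneycomb n}
    (φ : ∀ i, (t i).StructIso (t' i)) (i : Fin N) (v : (t' i).verts) (hv : ∀ j, v.1 ∉ side j) :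
    (unionGraph t').div ((unionIso φ).flow (unionFlow t)) ⟨i, v⟩ = (t' i).sign v := by
  obtain ⟨w, rfl⟩ := (φ i).iso.surjective v
  rw [div_unionIso_flow, outflow_of_degree, ← (φ i).sign_fn hn w.2, (φ i).fn_coe]
  exact degree_eq_three w.2 fun j hj => hv j (((φ i).side_iff j w).2 hj)

/-- Transport of flows is functorial even though the reference orientation of the intermediate edge
is arbitrary: reversing it exchanges the two endpoint signs, which are opposite. -/
theorem unionIso_flow_trans {t t' t'' : Fin N → TriHoneycomb n}
    (φ : ∀ i, (t i).StructIso (t' i)) (ψ : ∀ i, (t' i).StructIso (t'' i)) :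
    (unionIso ψ).flow ((unionIso φ).flow (unionFlow t)) =
      (unionIso fun i => (φ i).trans (ψ i)).flow (unionFlow t) := by
  have h0 := (eq_unionIso_flow_iff φ _).1 rfl
  rw [eq_unionIso_flow_iff]
  intro i v w hvw e h1 h2
  have h3 : s(((φ i).iso v).1, ((φ i).iso w).1) ∈ (t' i).edges := (φ i).iso.map_rel_iff.2 hvw
  have h4 : e = (ψ i).edgeEquiv ⟨_, h3⟩ := by
    refine Subtype.ext ?_
    change e.1 = s((ψ i).fn _, (ψ i).fn _)
    rw [(ψ i).fn_coe, (ψ i).fn_coe, ← out_eq e.1, h1, h2]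
    rfl
  rw [h4, ← unionIso_eE, FinGraph.FlipIso.flow_apply]
  change (if (Quot.out (s(((φ i).iso v).1, ((φ i).iso w).1).map (ψ i).fn)).1 =
    (ψ i).fn (Quot.out s(((φ i).iso v).1, ((φ i).iso w).1)).1 then (1 : ℝ) else -1) * _ = _
  have h5 : s(((φ i).iso v).1, ((φ i).iso w).1).map (ψ i).fn = e.1 := by rw [h4]; rfl
  have h6 : (Quot.out e.1).1 = (ψ i).fn ((φ i).iso v).1 := by rw [h1, (ψ i).fn_coe]; rfl
  rw [h5, h6]
  rcases Sym2.eq_iff.1 (out_eq s(((φ i).iso v).1, ((φ i).iso w).1)) with ⟨h7, h8⟩ | ⟨h7, h8⟩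
  · rw [h7, if_pos rfl, one_mul, h0 i v w hvw ⟨_, h3⟩ h7 h8]
  · rw [h7, if_neg (ne_of_edge ((ψ i).edge_mem h3)),
      h0 i w v (by rwa [Sym2.eq_swap]) ⟨_, h3⟩ h7 h8, sign_neighbor hvw]
    rw [height_eq _ (v := v.1) (by simp), height_eq _ (v := v.1) (by simp), Sym2.eq_swap]
    ring

/-- Quotients of isomorphic graphs. -/
def FinGraph.FlipIso.quot {G H : FinGraph} (Φ : FinGraph.FlipIso G H) {r : G.V → G.V → Prop}
    {r' : H.V → H.V → Prop} (hr : ∀ a b, r a b ↔ r' (Φ.eV a) (Φ.eV b)) :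
    FinGraph.FlipIso (G.quot (Quot.mk r)) (H.quot (Quot.mk r')) where
  eV := Quot.congr Φ.eV hr
  eE := Φ.eE
  σ := Φ.σ
  spec e := by
    rcases Φ.spec e with ⟨h1, h2, h3⟩ | ⟨h1, h2, h3⟩
    · exact Or.inl ⟨h1, congrArg (Quot.mk r') h2, congrArg (Quot.mk r') h3⟩
    · exact Or.inr ⟨h1, congrArg (Quot.mk r') h2, congrArg (Quot.mk r') h3⟩

end Family

namespace SurfHoneycomb

variable {N p n : ℕ} {T : Surface N p}

theorem sideValues_eq_image_iff {h h' : TriHoneycomb n} {j j' : Fin 3} :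
    h'.sideValues j' = (fun x => 1 - x) '' h.sideValues j ↔
      ∀ k, coord (j' + 1) (h'.bvert j' k) = 1 - coord (j + 1) (h.bvert j k.rev) := by
  have h1 : StrictAnti fun k => 1 - coord (j + 1) (h.bvert j (Fin.rev k)) := by
    intro a b hab
    have := h.bvert_strictAnti j (Fin.rev_lt_rev.2 hab)
    change 1 - coord (j + 1) (h.bvert j b.rev) < 1 - coord (j + 1) (h.bvert j a.rev)
    change coord (j + 1) (h.bvert j a.rev) < coord (j + 1) (h.bvert j b.rev) at this
    linarith
  rw [← sideValues_eq_range_iff h1, h.sideValues_eq, ← Set.range_comp]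
  have h2 : Set.range ((fun x => 1 - x) ∘ fun k => coord (j + 1) (h.bvert j k)) =
      Set.range fun k => 1 - coord (j + 1) (h.bvert j (Fin.rev k)) := by
    refine Eq.trans ?_ (Fin.revPerm.surjective.range_comp
      ((fun x => 1 - x) ∘ fun k => coord (j + 1) (h.bvert j k))).symm
    rfl
  rw [h2]

theorem coord_partner (h : SurfHoneycomb T n) {i i' : Fin N} {j j' : Fin 3}
    (hg : T.glue (i, j) = (i', j')) (hne : (i', j') ≠ (i, j)) (k : Fin n) :
    coord (j' + 1) ((h.tri i').bvert j' k) = 1 - coord (j + 1) ((h.tri i).bvert j k.rev) :=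
  sideValues_eq_image_iff.1 (h.compat i j i' j' hg hne) k

theorem hasBoundary_iff {h : SurfHoneycomb T n} {γ : Fin p → Fin n → ℝ} : h.HasBoundary γ ↔
    ∀ r k, coord ((T.bdry r).2 + 1) ((h.tri (T.bdry r).1).bvert (T.bdry r).2 k) = γ r k := by
  refine forall_congr' fun r => ?_
  constructor
  · rintro ⟨h1, h2⟩
    exact (sideValues_eq_range_iff h1 _).1 h2
  · intro h1
    have h2 : StrictAnti (γ r) := by
      have := (h.tri (T.bdry r).1).bvert_strictAnti (T.bdry r).2
      rwa [funext h1] at this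
    exact ⟨h2, (sideValues_eq_range_iff h2 _).2 h1⟩

theorem vertRel_iff {h : SurfHoneycomb T n} {x y : Σ i, (h.tri i).verts} : h.VertRel x y ↔
    ∃ i j i' j' k, T.glue (i, j) = (i', j') ∧ (i', j') ≠ (i, j) ∧ x = bpt h.tri i j k ∧
      y = bpt h.tri i' j' k.rev := by
  constructor
  · rintro ⟨j, j', hg, hne, hx, hy, hxy⟩
    obtain ⟨k, hk⟩ := exists_bpt_eq hx
    obtain ⟨l, hl⟩ := exists_bpt_eq hy
    refine ⟨x.1, j, y.1, j', k, hg, hne, hk.symm, ?_⟩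
    have h1 := h.coord_partner hg hne l
    have hk' : (h.tri x.1).bvert j k = x.2.1 :=
      congrArg Subtype.val (eq_of_heq (Sigma.ext_iff.1 hk).2)
    have hl' : (h.tri y.1).bvert j' l = y.2.1 :=
      congrArg Subtype.val (eq_of_heq (Sigma.ext_iff.1 hl).2)
    rw [hl', hxy, ← hk'] at h1
    have h2 := ((h.tri x.1).bvert_strictAnti j).injective (sub_right_injective h1)
    rw [h2, Fin.rev_rev]
    exact hl.symm
  · rintro ⟨i, j, i', j', k, hg, hne, rfl, rfl⟩
    refine ⟨j, j', hg, hne, (h.tri i).bvert_mem_side j k, (h.tri i').bvert_mem_side j' k.rev, ?_⟩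
    have h1 := h.coord_partner hg hne k.rev
    rw [Fin.rev_rev] at h1
    exact h1

theorem vertRel_symm {h : SurfHoneycomb T n} {x y : Σ i, (h.tri i).verts} (hxy : h.VertRel x y) :
    h.VertRel y x := by
  obtain ⟨i, j, i', j', k, hg, hne, rfl, rfl⟩ := vertRel_iff.1 hxy
  refine vertRel_iff.2 ⟨i', j', i, j, k.rev, ?_, hne.symm, rfl, by rw [Fin.rev_rev]⟩
  rw [← hg, T.glue_glue]

/-- A boundary vertex lies on a single side, so the gluing gives it at most one partner. -/
theorem vertRel_unique {h : SurfHoneycomb T n} {x y z : Σ i, (h.tri i).verts}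
    (hxy : h.VertRel x y) (hxz : h.VertRel x z) : y = z := by
  obtain ⟨i, j, i', j', k, hg, hne, rfl, rfl⟩ := vertRel_iff.1 hxy
  obtain ⟨a, b, a', b', l, hg', hne', hab, rfl⟩ := vertRel_iff.1 hxz
  obtain ⟨rfl, rfl, rfl⟩ := bpt_inj hab
  rw [hg, Prod.mk.injEq] at hg'
  obtain ⟨rfl, rfl⟩ := hg'
  rfl

theorem not_vertRel_self {h : SurfHoneycomb T n} {x : Σ i, (h.tri i).verts} :
    ¬ h.VertRel x x := by
  intro hx
  obtain ⟨i, j, i', j', k, hg, hne, rfl, h2⟩ := vertRel_iff.1 hx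
  obtain ⟨rfl, rfl, -⟩ := bpt_inj h2
  exact hne rfl

/-- `VertRel` is a partial matching, so the classes of the quotient have at most two elements. -/
theorem quot_mk_eq_iff {h : SurfHoneycomb T n} {x y : Σ i, (h.tri i).verts} :
    Quot.mk h.VertRel x = Quot.mk h.VertRel y ↔ x = y ∨ h.VertRel x y := by
  rw [Quot.eq]
  have hE : Equivalence fun x y => x = y ∨ h.VertRel x y := by
    refine ⟨fun x => Or.inl rfl, ?_, ?_⟩
    · rintro x y (rfl | hxy)
      · exact Or.inl rfl
      · exact Or.inr (vertRel_symm hxy)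
    · rintro x y z (rfl | hxy) (rfl | hyz)
      · exact Or.inl rfl
      · exact Or.inr hyz
      · exact Or.inr hxy
      · exact Or.inl (vertRel_unique (vertRel_symm hxy) hyz)
  constructor
  · intro hxy
    exact hE.eqvGen_iff.1 (hxy.mono fun _ _ => Or.inr)
  · rintro (rfl | hxy)
    · exact Relation.EqvGen.refl _
    · exact Relation.EqvGen.rel _ _ hxy

theorem vertRel_iso_iff {h h' : SurfHoneycomb T n} (φ : StructIso h h')
    (x y : Σ i, (h.tri i).verts) :
    h.VertRel x y ↔ h'.VertRel ((unionIso φ).eV x) ((unionIso φ).eV y) := by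
  rw [vertRel_iff, vertRel_iff]
  simp only [← unionIso_bpt φ, EmbeddingLike.apply_eq_iff_eq]

/-- The isomorphism of structure graphs induced by isomorphisms of the triangles. -/
def structGraphIso {h h' : SurfHoneycomb T n} (φ : StructIso h h') :
    FinGraph.FlipIso h.structGraph h'.structGraph :=
  (unionIso φ).quot (vertRel_iso_iff φ)

theorem mem_flowSet_iff {h₀ : SurfHoneycomb T n} {γ : Fin p → Fin n → ℝ}
    {ω : (unionGraph h₀.tri).Flow} : ω ∈ h₀.flowSet γ ↔
      ∃ (h : SurfHoneycomb T n) (φ : StructIso h h₀), h.HasBoundary γ ∧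
        ω = (unionIso φ).flow (unionFlow h.tri) :=
  exists_congr fun _ => exists_congr fun φ => and_congr_right fun _ =>
    (eq_unionIso_flow_iff φ ω).symm

instance (h : SurfHoneycomb T n) : Finite h.structGraph.V :=
  inferInstanceAs (Finite (Quot h.VertRel))

/-- The difference `η` of two flows has no divergence at interior vertices, where the sign is a
datum of the graph, nor at unglued boundary points, whose coordinates are prescribed. At two glued
points its divergences are opposite, because their coordinates sum to 1. -/
theorem div_eq_of_mem_flowSet (hn : n ≠ 0) {h₀ : SurfHoneycomb T n} {γ : Fin p → Fin n → ℝ}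
    {ω ω' : h₀.structGraph.Flow} (hω : ω ∈ h₀.flowSet γ) (hω' : ω' ∈ h₀.flowSet γ) :
    h₀.structGraph.div ω = h₀.structGraph.div ω' := by
  classical
  obtain ⟨h, φ, hb, rfl⟩ := mem_flowSet_iff.1 hω
  obtain ⟨h', φ', hb', rfl⟩ := mem_flowSet_iff.1 hω'
  have := Fintype.ofFinite (unionGraph h₀.tri).V
  refine sub_eq_zero.1 ((h₀.structGraph.div.map_sub _ _).symm.trans ?_)
  ext a
  set η : (unionGraph h₀.tri).Flow :=
    (unionIso φ).flow (unionFlow h.tri) - (unionIso φ').flow (unionFlow h'.tri) with hη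
  have hin : ∀ i (v : (h₀.tri i).verts), (∀ j, v.1 ∉ side j) →
      (unionGraph h₀.tri).div η ⟨i, v⟩ = 0 := by
    intro i v hv
    rw [hη, map_sub, Pi.sub_apply, div_unionIso_flow_inner hn φ i v hv,
      div_unionIso_flow_inner hn φ' i v hv, sub_self]
  have hbd : ∀ i j k, (unionGraph h₀.tri).div η (bpt h₀.tri i j k) =
      coord (j + 1) ((h'.tri i).bvert j k) - coord (j + 1) ((h.tri i).bvert j k) := by
    intro i j k
    rw [hη, map_sub, Pi.sub_apply, div_unionIso_flow_bpt, div_unionIso_flow_bpt]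
    ring
  have hpair : ∀ x y, h₀.VertRel x y →
      (unionGraph h₀.tri).div η x + (unionGraph h₀.tri).div η y = 0 := by
    intro x y hxy
    obtain ⟨i, j, i', j', k, hg, hne, rfl, rfl⟩ := vertRel_iff.1 hxy
    rw [hbd, hbd, h.coord_partner hg hne, h'.coord_partner hg hne, Fin.rev_rev]
    ring
  have hfree : ∀ x, (∀ y, ¬ h₀.VertRel x y) → (unionGraph h₀.tri).div η x = 0 := by
    rintro ⟨i, v⟩ hx
    by_cases hv : ∃ j, v.1 ∈ side j
    · obtain ⟨j, hj⟩ := hv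
      obtain ⟨k, hk⟩ := exists_bpt_eq hj
      rw [← hk] at hx ⊢
      have hg : T.glue (i, j) = (i, j) := by
        by_contra hne
        exact hx _ (vertRel_iff.2 ⟨i, j, _, _, k, rfl, hne, rfl, rfl⟩)
      obtain ⟨r, hr⟩ := (T.mem_range_bdry _).2 hg
      have h1 := hasBoundary_iff.1 hb r k
      have h2 := hasBoundary_iff.1 hb' r k
      rw [hr] at h1 h2
      rw [hbd, h1, h2, sub_self]
    · exact hin i v fun j hj => hv ⟨j, hj⟩
  -- The involution exchanging glued points cancels the divergences inside each class.
  let g : (unionGraph h₀.tri).V → (unionGraph h₀.tri).V := fun x =>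
    if hx : ∃ y, h₀.VertRel x y then hx.choose else x
  have hgrel : ∀ x y, h₀.VertRel x y → g x = y := by
    intro x y hxy
    have hx : ∃ y, h₀.VertRel x y := ⟨y, hxy⟩
    change dite _ _ _ = y
    rw [dif_pos hx]
    exact vertRel_unique hx.choose_spec hxy
  have hgfix : ∀ x, (¬ ∃ y, h₀.VertRel x y) → g x = x := fun x hx => dif_neg hx
  have key := FinGraph.div_quot (G := unionGraph h₀.tri) (Quot.mk h₀.VertRel) η a
  refine key.trans ?_
  rw [← Finset.sum_filter]
  refine Finset.sum_involution (fun x _ => g x) ?_ ?_ ?_ ?_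
  · intro x _
    by_cases hx : ∃ y, h₀.VertRel x y
    · obtain ⟨y, hy⟩ := hx
      rw [hgrel x y hy, hpair x y hy]
    · rw [hgfix x hx, hfree x fun y hy => hx ⟨y, hy⟩, add_zero]
  · intro x _ hne hgx
    by_cases hx : ∃ y, h₀.VertRel x y
    · obtain ⟨y, hy⟩ := hx
      rw [hgrel x y hy] at hgx
      subst hgx
      exact not_vertRel_self hy
    · exact hne (hfree x fun y hy => hx ⟨y, hy⟩)
  · intro x hxm
    rw [Finset.mem_filter] at hxm ⊢
    refine ⟨Finset.mem_univ _, Eq.trans ?_ hxm.2⟩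
    by_cases hx : ∃ y, h₀.VertRel x y
    · obtain ⟨y, hy⟩ := hx
      rw [hgrel x y hy]
      exact Quot.sound (vertRel_symm hy)
    · rw [hgfix x hx]
  · intro x _
    by_cases hx : ∃ y, h₀.VertRel x y
    · obtain ⟨y, hy⟩ := hx
      rw [hgrel x y hy, hgrel y x (vertRel_symm hy)]
    · rw [hgfix x hx, hgfix x hx]

/-- An isomorphism of structure graphs carries one flow set onto the other by an isometry compatible
with divergences, so the representative chosen by `out` is irrelevant. -/
theorem volOf_flowSet_eq (hn : n ≠ 0) {h₁ h₂ : SurfHoneycomb T n} (ψ : StructIso h₁ h₂)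
    (γ : Fin p → Fin n → ℝ) :
    h₂.structGraph.volOf (h₂.flowSet γ) = h₁.structGraph.volOf (h₁.flowSet γ) := by
  have h1 : h₂.flowSet γ = (structGraphIso ψ).flow '' h₁.flowSet γ := by
    ext ω
    constructor
    · intro hω
      obtain ⟨h, φ, hb, rfl⟩ := mem_flowSet_iff.1 hω
      refine ⟨(unionIso fun i => (φ i).trans (ψ i).symm).flow (unionFlow h.tri),
        mem_flowSet_iff.2 ⟨h, _, hb, rfl⟩, ?_⟩
      refine (unionIso_flow_trans _ ψ).trans ?_
      congr 3
      ext1 i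
      exact TriHoneycomb.StructIso.eq_of_iso (RelIso.ext fun v => (ψ i).iso.apply_symm_apply _)
    · rintro ⟨ω, hω, rfl⟩
      obtain ⟨h, φ, hb, rfl⟩ := mem_flowSet_iff.1 hω
      exact mem_flowSet_iff.2 ⟨h, _, hb, unionIso_flow_trans φ ψ⟩
  rw [h1, FinGraph.FlipIso.volOf_image]
  exact fun ω hω ω' hω' => div_eq_of_mem_flowSet hn hω hω'

/-- Each triangle contributes a connected graph, and since `n ≠ 0` every glued side has points
through which neighbouring triangles are joined. -/
theorem structGraph_isConn (hT : T.IsConnected) (hn : n ≠ 0) (h : SurfHoneycomb T n) :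
    h.structGraph.IsConn := by
  have : NeZero n := ⟨hn⟩
  let C : (Σ i, (h.tri i).verts) → (h.structGraph.spanned Set.univ).ConnectedComponent :=
    fun x => SimpleGraph.connectedComponentMk _ (Quot.mk h.VertRel x)
  have hedge : ∀ i (v w : (h.tri i).verts), (h.tri i).graph.Adj v w → C ⟨i, v⟩ = C ⟨i, w⟩ := by
    intro i v w hvw
    have h1 := FinGraph.spanned_reachable (G := h.structGraph) (S := Set.univ)
      (e := ⟨i, ⟨s(v.1, w.1), hvw⟩⟩) (Set.mem_univ _)
    have h2 : C ⟨i, ⟨(Quot.out s(v.1, w.1)).1, _, hvw, Sym2.out_fst_mem _⟩⟩ =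
        C ⟨i, ⟨(Quot.out s(v.1, w.1)).2, _, hvw, Sym2.out_snd_mem _⟩⟩ :=
      SimpleGraph.ConnectedComponent.sound h1
    rcases Sym2.eq_iff.1 (out_eq s(v.1, w.1)) with ⟨h3, h4⟩ | ⟨h3, h4⟩
    · simpa only [h3, h4] using h2
    · simpa only [h3, h4] using h2.symm
  have htri : ∀ i (v w : (h.tri i).verts), C ⟨i, v⟩ = C ⟨i, w⟩ := by
    intro i v w
    obtain ⟨q⟩ := (graph_connected (h := h.tri i) hn).preconnected v w
    induction q with
    | nil => rfl
    | cons hadj _ ih => exact (hedge i _ _ hadj).trans ih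
  have hglue : ∀ i j i' j', T.glue (i, j) = (i', j') →
      C (bpt h.tri i 0 0) = C (bpt h.tri i' 0 0) := by
    intro i j i' j' hg
    by_cases hne : (i', j') = (i, j)
    · rw [Prod.mk.injEq] at hne
      rw [hne.1]
    · have h1 : C (bpt h.tri i j 0) = C (bpt h.tri i' j' (Fin.rev 0)) :=
        congrArg (SimpleGraph.connectedComponentMk _) (Quot.sound (vertRel_iff.2 ⟨i, j, i', j', 0, hg, hne, rfl, rfl⟩))
      exact (htri i _ _).trans (h1.trans (htri i' _ _))
  have hall : ∀ i i', C (bpt h.tri i 0 0) = C (bpt h.tri i' 0 0) := by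
    intro i i'
    obtain ⟨q⟩ := hT.preconnected i i'
    induction q with
    | nil => rfl
    | cons hadj _ ih =>
      refine Eq.trans ?_ ih
      rcases (SimpleGraph.fromRel_adj _ _ _).1 hadj with ⟨-, ⟨j, j', hg⟩ | ⟨j, j', hg⟩⟩
      · exact hglue _ _ _ _ hg
      · exact (hglue _ _ _ _ hg).symm
  rw [FinGraph.IsConn, SimpleGraph.connected_iff]
  constructor
  · rintro ⟨i, v⟩ ⟨i', w⟩
    refine SimpleGraph.ConnectedComponent.exact ?_
    exact (htri i v _).trans ((hall i i').trans (htri i' _ w))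
  · obtain ⟨i⟩ := hT.nonempty
    exact ⟨Quot.mk _ (bpt h.tri i 0 0)⟩

end SurfHoneycomb

end Honey

end

/-! ### Transporting a honeycomb by a map of the plane -/

noncomputable section

namespace Honey

theorem segInterior_mk (v w : ℂ) : segInterior s(v, w) = openSegment ℝ v w := by
  ext z
  constructor
  · rintro ⟨a, b, hab, hz⟩
    rcases Sym2.eq_iff.1 hab with ⟨rfl, rfl⟩ | ⟨rfl, rfl⟩
    · exact hz
    · rwa [openSegment_symm]
  · exact fun hz => ⟨v, w, rfl, hz⟩

theorem segSet_mk (v w : ℂ) : segSet s(v, w) = segment ℝ v w := by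
  ext z
  constructor
  · rintro ⟨a, b, hab, hz⟩
    rcases Sym2.eq_iff.1 hab with ⟨rfl, rfl⟩ | ⟨rfl, rfl⟩
    · exact hz
    · rwa [segment_symm]
  · exact fun hz => ⟨v, w, rfl, hz⟩

theorem segment_subset_triangle {v w : ℂ} (hv : v ∈ triangle) (hw : w ∈ triangle) :
    segment ℝ v w ⊆ triangle := by
  rintro _ ⟨a, b, ha, hb, hab, rfl⟩
  rw [mem_triangle_iff]
  intro k
  rw [coord_lineMap _ _ _ _ _ hab]
  exact add_nonneg (mul_nonneg ha (coord_nonneg_of_mem hv k))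
    (mul_nonneg hb (coord_nonneg_of_mem hw k))

theorem exists_eq_add_mul_dir {v w : ℂ} {l : Fin 3} (h : coord l v = coord l w) :
    ∃ r : ℝ, w = v + r * dir l := by
  refine ⟨coord (l + 2) w - coord (l + 2) v, coord_ext l (l + 2) ?_ ?_ ?_⟩
  · fin_cases l <;> decide
  · rw [coord_add_mul_dir, slope_self, mul_zero, add_zero, h]
  · rw [coord_add_mul_dir, slope_add_two]
    ring

namespace TriHoneycomb

variable {n : ℕ}

theorem map_map_symm (g : Equiv.Perm ℂ) (e : Sym2 ℂ) : (e.map g.symm).map g = e := by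
  rw [Sym2.map_map]
  simp

theorem map_symm_map (g : Equiv.Perm ℂ) (e : Sym2 ℂ) : (e.map g).map g.symm = e := by
  rw [Sym2.map_map]
  simp

theorem mem_map_symm_iff {g : Equiv.Perm ℂ} {e : Sym2 ℂ} {v : ℂ} :
    g.symm v ∈ e.map g.symm ↔ v ∈ e := by
  rw [Sym2.mem_map]
  simp

/-- A permutation of the plane that maps the honeycomb `h` to a honeycomb. -/
structure IsTransport (h : TriHoneycomb n) (g : Equiv.Perm ℂ) : Prop where
  mem_triangle : ∀ v ∈ h.verts, g v ∈ triangle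
  mem_side : ∀ v ∈ h.verts, ∀ i, g v ∈ side i ↔ v ∈ side i
  meet : ∀ a ∈ h.verts, ∀ b ∈ h.verts, ∀ c ∈ h.verts, ∀ d ∈ h.verts,
    (openSegment ℝ (g a) (g b) ∩ openSegment ℝ (g c) (g d)).Nonempty →
      (openSegment ℝ a b ∩ openSegment ℝ c d).Nonempty
  angle : ∀ a ∈ h.verts, ∀ b ∈ h.verts, ∀ c ∈ h.verts, ∀ d ∈ h.verts,
    HasAngle (b - a) (d - c) (Real.pi / 3) → HasAngle (g b - g a) (g d - g c) (Real.pi / 3)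
  angle' : ∀ a ∈ h.verts, ∀ b ∈ h.verts, ∀ c ∈ h.verts, ∀ d ∈ h.verts,
    HasAngle (b - a) (d - c) (2 * Real.pi / 3) →
      HasAngle (g b - g a) (g d - g c) (2 * Real.pi / 3)
  coord_eq : ∀ a ∈ h.verts, ∀ b ∈ h.verts, ∀ l, coord l a = coord l b →
    coord l (g a) = coord l (g b)
  coord_lt : ∀ a ∈ h.verts, ∀ b ∈ h.verts, ∀ l, coord l (g a) < coord l (g b) ↔
    coord l a < coord l b

variable {h : TriHoneycomb n}

namespace IsTransport

variable {g : Equiv.Perm ℂ}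

/-- The edges of the image. -/
def newEdges (h : TriHoneycomb n) (g : Equiv.Perm ℂ) : Finset (Sym2 ℂ) :=
  h.edges.map ⟨Sym2.map g, Sym2.map.injective g.injective⟩

theorem mem_newEdges {e : Sym2 ℂ} : e ∈ newEdges h g ↔ e.map g.symm ∈ h.edges := by
  rw [newEdges, Finset.mem_map]
  constructor
  · rintro ⟨e, he, rfl⟩
    change (e.map g).map g.symm ∈ _
    rwa [map_symm_map]
  · exact fun he => ⟨_, he, map_map_symm g e⟩

/-- The image as a honeycomb. -/
def honeycomb (hg : h.IsTransport g) : Honeycomb triangle where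
  edges := newEdges h g
  color e := h.color ⟨e.1.map g.symm, mem_newEdges.1 e.2⟩
  nontrivial e he := by
    induction e with
    | _ v w =>
      have := ne_of_edge (mem_newEdges.1 he)
      simpa using this
  subset e he := by
    induction e with
    | _ v w =>
      have he := mem_newEdges.1 he
      have h1 := hg.mem_triangle _ (mem_verts_left he)
      have h2 := hg.mem_triangle _ (mem_verts_right he)
      rw [Equiv.apply_symm_apply] at h1 h2
      rw [segSet_mk]
      exact segment_subset_triangle h1 h2
  color_mem e := h.color_mem _
  crossing := by
    rintro ⟨e, he⟩ ⟨e', he'⟩ hne hm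
    have hE := mem_newEdges.1 he
    have hE' := mem_newEdges.1 he'
    have h1 : (segInterior (e.map g.symm) ∩ segInterior (e'.map g.symm)).Nonempty := by
      induction e with
      | _ v w =>
        induction e' with
        | _ v' w' =>
          rw [Sym2.map_mk, Sym2.map_mk, segInterior_mk, segInterior_mk]
          refine hg.meet _ (mem_verts_left hE) _ (mem_verts_right hE) _ (mem_verts_left hE') _
            (mem_verts_right hE') ?_
          simpa only [segInterior_mk, Equiv.apply_symm_apply] using hm
    have hne' : (⟨_, hE⟩ : {e // e ∈ h.edges}) ≠ ⟨_, hE'⟩ := by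
      intro heq
      refine hne (Subtype.ext (Sym2.map.injective g.symm.injective ?_))
      exact congrArg Subtype.val heq
    obtain ⟨⟨f, hf⟩, ⟨f', hf'⟩, hff, hc, hc', v, w, v', w', hv, hv', ha⟩ :=
      h.crossing ⟨_, hE⟩ ⟨_, hE'⟩ hne' h1
    dsimp only at hv hv'
    subst hv hv'
    have ha' := hg.angle _ (mem_verts_left hf) _ (mem_verts_right hf) _ (mem_verts_left hf') _
      (mem_verts_right hf') ha
    have key : ∀ {x y : Sym2 ℂ}, x = y.map g.symm → y = x.map g := by
      rintro x y rfl
      rw [map_map_symm]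
    rcases hff with ⟨hf1, hf2⟩ | ⟨hf1, hf2⟩
    · refine ⟨⟨e, he⟩, ⟨e', he'⟩, Or.inl ⟨rfl, rfl⟩, ?_, ?_, g v, g w, g v', g w',
        key (congrArg Subtype.val hf1), key (congrArg Subtype.val hf2), ha'⟩
      · rw [← hf1, hc]
      · rw [← hf2, hc']
    · refine ⟨⟨e', he'⟩, ⟨e, he⟩, Or.inr ⟨rfl, rfl⟩, ?_, ?_, g v, g w, g v', g w',
        key (congrArg Subtype.val hf1), key (congrArg Subtype.val hf2), ha'⟩
      · rw [← hf1, hc]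
      · rw [← hf2, hc']
  vertex v w w' he he' hne := by
    have hE := mem_newEdges.1 he
    have hE' := mem_newEdges.1 he'
    have h1 := hg.angle' _ (mem_verts_left hE) _ (mem_verts_right hE) _ (mem_verts_left hE') _
      (mem_verts_right hE')
    have h2 := hg.angle' _ (mem_verts_left hE') _ (mem_verts_right hE') _ (mem_verts_left hE) _
      (mem_verts_right hE)
    simp only [Equiv.apply_symm_apply] at h1 h2
    exact (h.vertex _ _ _ hE hE' fun heq => hne (g.symm.injective heq)).imp
      (fun h3 => ⟨h1 h3.1, h3.2⟩) (fun h3 => ⟨h2 h3.1, h3.2⟩)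

theorem mem_verts_iff (hg : h.IsTransport g) {v : ℂ} :
    v ∈ hg.honeycomb.verts ↔ g.symm v ∈ h.verts := by
  constructor
  · rintro ⟨e, he, hv⟩
    exact ⟨_, mem_newEdges.1 he, mem_map_symm_iff.2 hv⟩
  · rintro ⟨e, he, hv⟩
    refine ⟨e.map g, mem_newEdges.2 (by rwa [map_symm_map]), Sym2.mem_map.2 ⟨_, hv, ?_⟩⟩
    simp

theorem degree_eq (hg : h.IsTransport g) (v : ℂ) :
    hg.honeycomb.degree v = h.degree (g.symm v) := by
  have h1 : {e | e ∈ hg.honeycomb.edges ∧ v ∈ e} =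
      Sym2.map g '' {e | e ∈ h.edges ∧ g.symm v ∈ e} := by
    ext e
    constructor
    · rintro ⟨he, hv⟩
      exact ⟨e.map g.symm, ⟨mem_newEdges.1 he, mem_map_symm_iff.2 hv⟩, map_map_symm g e⟩
    · rintro ⟨e, ⟨he, hv⟩, rfl⟩
      refine ⟨mem_newEdges.2 (by rwa [map_symm_map]), Sym2.mem_map.2 ⟨_, hv, ?_⟩⟩
      simp
  rw [Honeycomb.degree, h1, Set.ncard_image_of_injective _ (Sym2.map.injective g.injective)]
  rfl

theorem mem_side_iff (hg : h.IsTransport g) {v : ℂ} (hv : v ∈ hg.honeycomb.verts) (i : Fin 3) :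
    g.symm v ∈ side i ↔ v ∈ side i := by
  have := hg.mem_side _ ((mem_verts_iff hg).1 hv) i
  rwa [Equiv.apply_symm_apply, Iff.comm] at this

/-- If the interior of an image edge touched a side, both its ends would lie on that side; so would
the ends of the original edge, which is excluded. -/
theorem support_inter_side (hg : h.IsTransport g) (i : Fin 3) :
    hg.honeycomb.support ∩ side i = {v | v ∈ hg.honeycomb.verts ∧ v ∈ side i} := by
  ext z
  constructor
  · rintro ⟨hz, hi⟩
    refine ⟨?_, hi⟩
    obtain ⟨e, he, hze⟩ := Set.mem_iUnion₂.1 hz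
    induction e with
    | _ v w =>
      have hv : v ∈ hg.honeycomb.verts := ⟨_, he, by simp⟩
      have hw : w ∈ hg.honeycomb.verts := ⟨_, he, by simp⟩
      rw [segSet_mk, ← insert_endpoints_openSegment] at hze
      rcases hze with rfl | rfl | hze
      · exact hv
      · exact hw
      · have hE := mem_newEdges.1 he
        have h1 := hg.mem_triangle _ (mem_verts_left hE)
        have h2 := hg.mem_triangle _ (mem_verts_right hE)
        rw [Equiv.apply_symm_apply] at h1 h2
        obtain ⟨h3, h4⟩ := mem_side_of_openSegment h1 h2 hze hi.2
        exact absurd ((mem_side_iff hg hw i).2 h4)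
          (not_mem_side_of_edge hE ((mem_side_iff hg hv i).2 h3))
  · rintro ⟨hz, hi⟩
    refine ⟨?_, hi⟩
    obtain ⟨e, he, hze⟩ := hz
    obtain ⟨w, rfl⟩ := Sym2.mem_iff_exists.1 hze
    exact Set.mem_biUnion he ⟨z, w, rfl, left_mem_segment ℝ z w⟩

/-- The image of a triangular honeycomb. -/
def image (hg : h.IsTransport g) : TriHoneycomb n where
  toHoneycomb := hg.honeycomb
  type e := h.type ⟨e.1.map g.symm, mem_newEdges.1 e.2⟩
  degree_eq v hv := by
    rw [hg.degree_eq]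
    exact h.degree_eq _ (hg.mem_verts_iff.1 hv)
  boundary_eq := by
    rw [Set.inter_iUnion]
    ext v
    simp only [support_inter_side, Set.mem_iUnion, Set.mem_ofPred_eq, exists_and_left]
    refine and_congr_right fun hv => ?_
    rw [hg.degree_eq, degree_eq_one_iff (hg.mem_verts_iff.1 hv)]
    exact exists_congr fun i => (hg.mem_side_iff hv i).symm
  type_spec := by
    rintro ⟨e, he⟩ v hv w hw
    refine exists_eq_add_mul_dir ?_
    have hE := mem_newEdges.1 he
    obtain ⟨r, hr⟩ := h.type_spec ⟨_, hE⟩ _ (mem_map_symm_iff.2 hv) _ (mem_map_symm_iff.2 hw)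
    have h1 := hg.coord_eq (g.symm v) ⟨_, hE, mem_map_symm_iff.2 hv⟩ (g.symm w)
      ⟨_, hE, mem_map_symm_iff.2 hw⟩ (h.type ⟨_, hE⟩)
    rw [Equiv.apply_symm_apply, Equiv.apply_symm_apply] at h1
    refine h1 ?_
    rw [hr, coord_add_mul_dir, slope_self, mul_zero, add_zero]
  encard_side i := by
    have h1 : hg.honeycomb.support ∩ side i = g '' (h.support ∩ side i) := by
      rw [support_inter_side, TriHoneycomb.support_inter_side]
      ext v
      constructor
      · rintro ⟨hv, hi⟩
        exact ⟨g.symm v, ⟨hg.mem_verts_iff.1 hv, (hg.mem_side_iff hv i).2 hi⟩, by simp⟩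
      · rintro ⟨v, ⟨hv, hi⟩, rfl⟩
        exact ⟨hg.mem_verts_iff.2 (by simpa using hv), (hg.mem_side v hv i).2 hi⟩
    rw [h1, g.injective.encard_image]
    exact h.encard_side i
  side_type i e v hv hi :=
    h.side_type i ⟨_, mem_newEdges.1 e.2⟩ (g.symm v) (mem_map_symm_iff.2 hv)
      ((hg.mem_side_iff ⟨_, e.2, hv⟩ i).2 hi)
  side_mono i e e' v hv v' hv' hi hi' hlt := by
    refine h.side_mono i ⟨_, mem_newEdges.1 e.2⟩ ⟨_, mem_newEdges.1 e'.2⟩ (g.symm v)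
      (mem_map_symm_iff.2 hv) (g.symm v') (mem_map_symm_iff.2 hv')
      ((hg.mem_side_iff ⟨_, e.2, hv⟩ i).2 hi) ((hg.mem_side_iff ⟨_, e'.2, hv'⟩ i).2 hi') ?_
    rw [← hg.coord_lt (g.symm v) ⟨_, mem_newEdges.1 e.2, mem_map_symm_iff.2 hv⟩ (g.symm v')
      ⟨_, mem_newEdges.1 e'.2, mem_map_symm_iff.2 hv'⟩]
    simpa using hlt

/-- The isomorphism of structure graphs onto the image. -/
def structIso (hg : h.IsTransport g) : StructIso h hg.image where
  iso :=
    { toFun := fun v => ⟨g v.1, hg.mem_verts_iff.2 (by simp)⟩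
      invFun := fun v => ⟨g.symm v.1, hg.mem_verts_iff.1 v.2⟩
      left_inv := fun v => Subtype.ext (by simp)
      right_inv := fun v => Subtype.ext (by simp)
      map_rel_iff' := by
        intro v w
        refine Iff.trans mem_newEdges ?_
        rw [Sym2.map_mk]
        simp only [Equiv.coe_fn_mk, Equiv.symm_apply_apply]
        rfl }
  color_eq v w hvw hvw' := by
    change h.color ⟨s(g.symm (g v.1), g.symm (g w.1)), _⟩ = _
    congr 2
    simp
  side_iff j v := hg.mem_side v.1 v.2 j
  order_iff j v w _ _ := hg.coord_lt v.1 v.2 w.1 w.2 (j + 1)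

end IsTransport

end TriHoneycomb

end Honey

end

noncomputable section

namespace Honey

open MeasureTheory

/-! ## Measurability of sets of configurations -/

/-- Such a set is the preimage of a subset of the finite set of truth tables. -/
theorem measurableSet_of_predicates {α B : Type*} [MeasurableSpace α] [Finite B]
    (P : B → α → Prop) (hP : ∀ b, MeasurableSet {x | P b x}) {S : Set α}
    (hS : ∀ x ∈ S, ∀ x', (∀ b, P b x ↔ P b x') → x' ∈ S) : MeasurableSet S := by
  have h1 : S = (fun x b => P b x) ⁻¹' ((fun x b => P b x) '' S) := by
    refine Set.Subset.antisymm (Set.subset_preimage_image _ _) ?_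
    rintro x' ⟨x, hx, hxx⟩
    exact hS x hx x' fun b => iff_of_eq (congrFun hxx b)
  rw [h1]
  refine (measurable_pi_lambda _ fun b => ?_) (Set.toFinite _).measurableSet
  exact measurableSet_setOfPred.1 (hP b)

theorem continuous_coord (i : Fin 3) : Continuous (coord i) := by
  fin_cases i
  · change Continuous fun v : ℂ => 1 - v.re - v.im / √3
    fun_prop
  · change Continuous fun v : ℂ => v.re - v.im / √3
    fun_prop
  · change Continuous fun v : ℂ => 2 * v.im / √3
    fun_prop

theorem isClosed_triangle : IsClosed triangle := by
  have h1 : triangle = ⋂ k, {v | 0 ≤ coord k v} := by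
    ext v
    simp [mem_triangle_iff]
  rw [h1]
  exact isClosed_iInter fun k => isClosed_le continuous_const (continuous_coord k)

theorem isClosed_side (i : Fin 3) : IsClosed (side i) :=
  isClosed_triangle.inter (isClosed_eq (continuous_coord i) continuous_const)

theorem measurableSet_hasAngle (θ : ℝ) : MeasurableSet {p : ℂ × ℂ | HasAngle p.1 p.2 θ} := by
  refine MeasurableSet.inter (s₁ := {p : ℂ × ℂ | 0 < p.1.re * p.2.im - p.1.im * p.2.re})
    (s₂ := {p : ℂ × ℂ | InnerProductGeometry.angle p.1 p.2 = θ}) ?_ ?_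
  · exact (isOpen_lt continuous_const (by fun_prop)).measurableSet
  · refine measurableSet_eq_fun ?_ measurable_const
    unfold InnerProductGeometry.angle
    exact Real.measurable_arccos.comp (by fun_prop)

/-- The open parameter intervals are exhausted by compact ones; projecting a closed set along a
compact factor gives a closed set, so the condition is a countable union of closed ones. -/
theorem measurableSet_openSegment_inter {α : Type*} [TopologicalSpace α] [MeasurableSpace α]
    [BorelSpace α] {a b c d : α → ℂ} (ha : Continuous a) (hb : Continuous b) (hc : Continuous c)
    (hd : Continuous d) :
    MeasurableSet {x | (openSegment ℝ (a x) (b x) ∩ openSegment ℝ (c x) (d x)).Nonempty} := by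
  let K : ℕ → Set ℝ := fun m => Set.Icc (1 / ((m : ℝ) + 2)) (1 - 1 / ((m : ℝ) + 2))
  have h1 : {x | (openSegment ℝ (a x) (b x) ∩ openSegment ℝ (c x) (d x)).Nonempty} =
      ⋃ p : ℕ × ℕ, Prod.fst '' {q : α × (K p.1 × K p.2) |
        (1 - (q.2.1 : ℝ)) • a q.1 + (q.2.1 : ℝ) • b q.1 =
          (1 - (q.2.2 : ℝ)) • c q.1 + (q.2.2 : ℝ) • d q.1} := by
    have hK : ∀ s : ℝ, 0 < s → s < 1 → ∃ m, s ∈ K m := by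
      intro s hs hs'
      obtain ⟨m, hm⟩ := exists_nat_one_div_lt (lt_min hs (sub_pos.2 hs'))
      have h2 : 1 / ((m : ℝ) + 2) ≤ 1 / ((m : ℝ) + 1) :=
        one_div_le_one_div_of_le (by positivity) (by linarith)
      have h3 := (lt_min_iff.1 hm).1
      have h4 := (lt_min_iff.1 hm).2
      exact ⟨m, by linarith, by linarith⟩
    have hK' : ∀ m, ∀ s ∈ K m, 0 < s ∧ s < 1 := by
      intro m s hs
      have : 0 < 1 / ((m : ℝ) + 2) := by positivity
      exact ⟨by linarith [hs.1], by linarith [hs.2]⟩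
    ext x
    simp only [Set.mem_ofPred_eq, Set.mem_iUnion, Set.mem_image]
    constructor
    · rintro ⟨z, ⟨s', s, hs', hs, hss, rfl⟩, ⟨t', t, ht', ht, htt, hz⟩⟩
      obtain ⟨m, hm⟩ := hK s hs (by linarith)
      obtain ⟨l, hl⟩ := hK t ht (by linarith)
      refine ⟨(m, l), (x, ⟨s, hm⟩, ⟨t, hl⟩), ?_, rfl⟩
      dsimp only
      rw [show 1 - s = s' by linarith, show 1 - t = t' by linarith, hz]
    · rintro ⟨⟨m, l⟩, ⟨x, ⟨s, hs⟩, ⟨t, ht⟩⟩, heq, rfl⟩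
      obtain ⟨h2, h3⟩ := hK' m s hs
      obtain ⟨h4, h5⟩ := hK' l t ht
      exact ⟨_, ⟨1 - s, s, by linarith, h2, by ring, rfl⟩, 1 - t, t, by linarith, h4, by ring,
        heq.symm⟩
  rw [h1]
  refine MeasurableSet.iUnion fun p => ?_
  have : CompactSpace (K p.1) := isCompact_iff_compactSpace.1 isCompact_Icc
  have : CompactSpace (K p.2) := isCompact_iff_compactSpace.1 isCompact_Icc
  refine (isClosedMap_fst_of_compactSpace _ ?_).measurableSet
  exact isClosed_eq (by fun_prop) (by fun_prop)

namespace TriHoneycomb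

variable {n : ℕ}

/-- The positions of the vertices of the honeycombs whose structure graph is isomorphic
to the structure graph of `h₀`. -/
def configs (h₀ : TriHoneycomb n) : Set (h₀.verts → ℂ) :=
  {X | ∃ (h : TriHoneycomb n) (φ : StructIso h h₀), ∀ v, X v = (φ.iso.symm v).1}

/-- The predicates that determine whether a configuration is a honeycomb. -/
def predicates (V : Type) :
    V × V ⊕ V ⊕ V × Fin 3 ⊕ (V × V) × (V × V) ⊕ (V × V) × (V × V) ⊕ (V × V) × (V × V) ⊕
      (V × V) × Fin 3 ⊕ (V × V) × Fin 3 → (V → ℂ) → Prop :=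
  Sum.elim (fun b X => X b.1 = X b.2) <|
  Sum.elim (fun b X => X b ∈ triangle) <|
  Sum.elim (fun b X => X b.1 ∈ side b.2) <|
  Sum.elim (fun b X => (openSegment ℝ (X b.1.1) (X b.1.2) ∩
    openSegment ℝ (X b.2.1) (X b.2.2)).Nonempty) <|
  Sum.elim (fun b X => HasAngle (X b.1.2 - X b.1.1) (X b.2.2 - X b.2.1) (Real.pi / 3)) <|
  Sum.elim (fun b X => HasAngle (X b.1.2 - X b.1.1) (X b.2.2 - X b.2.1) (2 * Real.pi / 3)) <|
  Sum.elim (fun b X => coord b.2 (X b.1.1) = coord b.2 (X b.1.2))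
    (fun b X => coord b.2 (X b.1.1) < coord b.2 (X b.1.2))

theorem measurableSet_predicates {V : Type} [Finite V] (b) :
    MeasurableSet {X | predicates V b X} := by
  have hang : ∀ (θ : ℝ) (b : (V × V) × (V × V)), MeasurableSet
      {X : V → ℂ | HasAngle (X b.1.2 - X b.1.1) (X b.2.2 - X b.2.1) θ} := by
    intro θ b
    have h1 : Measurable fun X : V → ℂ => (X b.1.2 - X b.1.1, X b.2.2 - X b.2.1) := by fun_prop
    exact h1 (measurableSet_hasAngle θ)
  have hc : ∀ (l : Fin 3) (v : V), Continuous fun X : V → ℂ => coord l (X v) :=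
    fun l v => (continuous_coord l).comp (continuous_apply v)
  rcases b with b | b | b | b | b | b | b | b
  · exact (isClosed_eq (continuous_apply b.1) (continuous_apply b.2)).measurableSet
  · exact (isClosed_triangle.preimage (continuous_apply b)).measurableSet
  · exact ((isClosed_side b.2).preimage (continuous_apply b.1)).measurableSet
  · exact measurableSet_openSegment_inter (continuous_apply b.1.1) (continuous_apply b.1.2)
      (continuous_apply b.2.1) (continuous_apply b.2.2)
  · exact hang _ b
  · exact hang _ b
  · exact (isClosed_eq (hc b.2 b.1.1) (hc b.2 b.1.2)).measurableSet
  · exact (isOpen_lt (hc b.2 b.1.1) (hc b.2 b.1.2)).measurableSet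

/-- Extending to a permutation of the whole plane lets the edges be transported by a single
injective `Sym2.map`. -/
theorem exists_perm_extension {s : Set ℂ} (hs : s.Finite) {f : s → ℂ}
    (hf : Function.Injective f) : ∃ g : Equiv.Perm ℂ, ∀ x : s, g x = f x := by
  have := hs.to_subtype
  refine Cardinal.extend_function_of_lt ⟨f, hf⟩ ?_ ⟨Equiv.refl _⟩
  exact (Cardinal.lt_aleph0_of_finite _).trans_le (Cardinal.aleph0_le_mk _)

/-- If two configurations satisfy the same predicates, the map matching their vertices is a
transport, so one is a honeycomb with the given structure graph as soon as the other is. -/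
theorem measurableSet_configs (h₀ : TriHoneycomb n) : MeasurableSet h₀.configs := by
  refine measurableSet_of_predicates (predicates h₀.verts) measurableSet_predicates ?_
  rintro X ⟨h, φ, hX⟩ X' hP
  have p1 : ∀ a b, X a = X b ↔ X' a = X' b := fun a b => hP (.inl (a, b))
  have p2 : ∀ a, X a ∈ triangle ↔ X' a ∈ triangle := fun a => hP (.inr (.inl a))
  have p3 : ∀ a i, X a ∈ side i ↔ X' a ∈ side i := fun a i => hP (.inr (.inr (.inl (a, i))))
  have p4 : ∀ a b c d, (openSegment ℝ (X a) (X b) ∩ openSegment ℝ (X c) (X d)).Nonempty ↔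
      (openSegment ℝ (X' a) (X' b) ∩ openSegment ℝ (X' c) (X' d)).Nonempty :=
    fun a b c d => hP (.inr (.inr (.inr (.inl ((a, b), (c, d))))))
  have p5 : ∀ a b c d, HasAngle (X b - X a) (X d - X c) (Real.pi / 3) ↔
      HasAngle (X' b - X' a) (X' d - X' c) (Real.pi / 3) :=
    fun a b c d => hP (.inr (.inr (.inr (.inr (.inl ((a, b), (c, d)))))))
  have p6 : ∀ a b c d, HasAngle (X b - X a) (X d - X c) (2 * Real.pi / 3) ↔
      HasAngle (X' b - X' a) (X' d - X' c) (2 * Real.pi / 3) :=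
    fun a b c d => hP (.inr (.inr (.inr (.inr (.inr (.inl ((a, b), (c, d))))))))
  have p7 : ∀ a b l, coord l (X a) = coord l (X b) ↔ coord l (X' a) = coord l (X' b) :=
    fun a b l => hP (.inr (.inr (.inr (.inr (.inr (.inr (.inl ((a, b), l))))))))
  have p8 : ∀ a b l, coord l (X a) < coord l (X b) ↔ coord l (X' a) < coord l (X' b) :=
    fun a b l => hP (.inr (.inr (.inr (.inr (.inr (.inr (.inr ((a, b), l))))))))
  have hX' : ∀ v, X (φ.iso v) = v.1 := fun v => by rw [hX, RelIso.symm_apply_apply]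
  obtain ⟨g, hg⟩ := exists_perm_extension h.verts_finite (f := fun v => X' (φ.iso v)) (by
    intro a b hab
    have := (p1 _ _).2 hab
    rw [hX', hX'] at this
    exact Subtype.ext this)
  have hx : ∀ v (hv : v ∈ h.verts), v = X (φ.iso ⟨v, hv⟩) ∧ g v = X' (φ.iso ⟨v, hv⟩) :=
    fun v hv => ⟨(hX' ⟨v, hv⟩).symm, hg ⟨v, hv⟩⟩
  have ht : h.IsTransport g := by
    constructor
    · intro v hv
      rw [(hx v hv).2, ← p2, ← (hx v hv).1]
      exact mem_triangle_of_verts hv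
    · intro v hv i
      rw [(hx v hv).2, ← p3, ← (hx v hv).1]
    · intro a ha b hb c hc d hd
      rw [(hx a ha).2, (hx b hb).2, (hx c hc).2, (hx d hd).2, ← p4, ← (hx a ha).1, ← (hx b hb).1,
        ← (hx c hc).1, ← (hx d hd).1]
      exact id
    · intro a ha b hb c hc d hd
      rw [(hx a ha).2, (hx b hb).2, (hx c hc).2, (hx d hd).2, ← p5, ← (hx a ha).1, ← (hx b hb).1,
        ← (hx c hc).1, ← (hx d hd).1]
      exact id
    · intro a ha b hb c hc d hd
      rw [(hx a ha).2, (hx b hb).2, (hx c hc).2, (hx d hd).2, ← p6, ← (hx a ha).1, ← (hx b hb).1,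
        ← (hx c hc).1, ← (hx d hd).1]
      exact id
    · intro a ha b hb l
      rw [(hx a ha).2, (hx b hb).2, ← p7, ← (hx a ha).1, ← (hx b hb).1]
      exact id
    · intro a ha b hb l
      rw [(hx a ha).2, (hx b hb).2, ← p8, ← (hx a ha).1, ← (hx b hb).1]
  refine ⟨ht.image, ht.structIso.symm.trans φ, fun v => ?_⟩
  change X' v = g (φ.iso.symm v).1
  rw [hg, RelIso.apply_symm_apply]

/-- The type of an edge is the only coordinate which is constant along the edge. -/
theorem eq_typ_of_coord_eq {h : TriHoneycomb n} {v w : ℂ} (he : s(v, w) ∈ h.edges) {l : Fin 3}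
    (hl : coord l v = coord l w) : l = h.typ s(v, w) := by
  by_contra hne
  exact ne_of_edge he (coord_ext l _ hne hl (coord_typ_eq he).symm)

end TriHoneycomb

end Honey

end

/-! ### Measurability of the flow sets -/

noncomputable section

namespace Honey

open MeasureTheory TriHoneycomb

namespace SurfHoneycomb

variable {N p n : ℕ} {T : Surface N p}

/-- The positions of the vertices of the honeycombs with boundary `γ` and with the structure graph
of `h₀`, whose edges have the types `τ`. -/
def surfConfigs (h₀ : SurfHoneycomb T n) (γ : Fin p → Fin n → ℝ)
    (τ : (Σ i, {e // e ∈ (h₀.tri i).edges}) → Fin 3) : Set ((Σ i, (h₀.tri i).verts) → ℂ) :=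
  {X | (∀ i, (fun v => X ⟨i, v⟩) ∈ (h₀.tri i).configs) ∧
    (∀ i j i' j', T.glue (i, j) = (i', j') → (i', j') ≠ (i, j) → ∀ k,
      coord (j' + 1) (X (bpt h₀.tri i' j' k)) = 1 - coord (j + 1) (X (bpt h₀.tri i j k.rev))) ∧
    (∀ r k, coord ((T.bdry r).2 + 1) (X (bpt h₀.tri (T.bdry r).1 (T.bdry r).2 k)) = γ r k) ∧
    ∀ (i : Fin N) (v w : (h₀.tri i).verts) (he : s(v.1, w.1) ∈ (h₀.tri i).edges),
      coord (τ ⟨i, ⟨_, he⟩⟩) (X ⟨i, v⟩) = coord (τ ⟨i, ⟨_, he⟩⟩) (X ⟨i, w⟩)}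

theorem measurable_coord_apply {V : Type*} (l : Fin 3) (v : V) :
    Measurable fun X : V → ℂ => coord l (X v) :=
  (continuous_coord l).measurable.comp (measurable_pi_apply v)

theorem measurableSet_surfConfigs (h₀ : SurfHoneycomb T n) (γ : Fin p → Fin n → ℝ)
    (τ : (Σ i, {e // e ∈ (h₀.tri i).edges}) → Fin 3) : MeasurableSet (h₀.surfConfigs γ τ) := by
  simp only [surfConfigs, Set.ofPred_and, Set.ofPred_forall]
  refine MeasurableSet.inter ?_ (MeasurableSet.inter ?_ (MeasurableSet.inter ?_ ?_))
  · refine MeasurableSet.iInter fun i => ?_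
    have h1 : Measurable fun (X : (Σ i, (h₀.tri i).verts) → ℂ) (v : (h₀.tri i).verts) => X ⟨i, v⟩ :=
      measurable_pi_lambda _ fun v => measurable_pi_apply _
    exact h1 (measurableSet_configs _)
  · refine MeasurableSet.iInter fun i => MeasurableSet.iInter fun j => MeasurableSet.iInter fun i' =>
      MeasurableSet.iInter fun j' => MeasurableSet.iInter fun _ => MeasurableSet.iInter fun _ =>
      MeasurableSet.iInter fun k => ?_
    exact measurableSet_eq_fun (measurable_coord_apply _ _)
      (measurable_const.sub (measurable_coord_apply _ _))
  · refine MeasurableSet.iInter fun r => MeasurableSet.iInter fun k => ?_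
    exact measurableSet_eq_fun (measurable_coord_apply _ _) measurable_const
  · refine MeasurableSet.iInter fun i => MeasurableSet.iInter fun v => MeasurableSet.iInter fun w =>
      MeasurableSet.iInter fun _ => ?_
    exact measurableSet_eq_fun (measurable_coord_apply _ _) (measurable_coord_apply _ _)

/-- The flow of a configuration. -/
def configFlow (h₀ : SurfHoneycomb T n) (τ : (Σ i, {e // e ∈ (h₀.tri i).edges}) → Fin 3)
    (X : (Σ i, (h₀.tri i).verts) → ℂ) : (unionGraph h₀.tri).Flow :=
  WithLp.toLp 2 fun e => (h₀.tri e.1).sign (Quot.out e.2.1).1 *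
    coord (τ e) (X ((unionGraph h₀.tri).src e))

theorem measurable_configFlow (h₀ : SurfHoneycomb T n)
    (τ : (Σ i, {e // e ∈ (h₀.tri i).edges}) → Fin 3) : Measurable (h₀.configFlow τ) := by
  refine (WithLp.measurable_toLp 2 _).comp (measurable_pi_lambda _ fun e => ?_)
  exact (measurable_coord_apply _ _).const_mul _

/-- The type of an edge of a configuration. -/
theorem type_eq_of_mem_surfConfigs {h₀ : SurfHoneycomb T n} {γ : Fin p → Fin n → ℝ}
    {τ : (Σ i, {e // e ∈ (h₀.tri i).edges}) → Fin 3} {X : (Σ i, (h₀.tri i).verts) → ℂ}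
    (hX : X ∈ h₀.surfConfigs γ τ) {i : Fin N} {h : TriHoneycomb n} {φ : h.StructIso (h₀.tri i)}
    (hφ : ∀ v, X ⟨i, v⟩ = (φ.iso.symm v).1) (v w : h.verts) (hvw : s(v.1, w.1) ∈ h.edges)
    (he : s((φ.iso v).1, (φ.iso w).1) ∈ (h₀.tri i).edges) :
    τ ⟨i, ⟨_, he⟩⟩ = h.typ s(v.1, w.1) := by
  refine eq_typ_of_coord_eq hvw ?_
  have h1 := hX.2.2.2 i _ _ he
  rwa [hφ, hφ, RelIso.symm_apply_apply, RelIso.symm_apply_apply] at h1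

theorem configFlow_eq (hn : n ≠ 0) {h₀ : SurfHoneycomb T n} {γ : Fin p → Fin n → ℝ}
    {τ : (Σ i, {e // e ∈ (h₀.tri i).edges}) → Fin 3} {X : (Σ i, (h₀.tri i).verts) → ℂ}
    (hX : X ∈ h₀.surfConfigs γ τ) {t : Fin N → TriHoneycomb n}
    (φ : ∀ i, (t i).StructIso (h₀.tri i)) (hφ : ∀ i v, X ⟨i, v⟩ = ((φ i).iso.symm v).1) :
    h₀.configFlow τ X = (unionIso φ).flow (unionFlow t) := by
  rw [eq_unionIso_flow_iff]
  rintro i v w hvw ⟨e, he⟩ h1 h2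
  have h3 := out_eq e
  dsimp only at h1 h2
  rw [h1, h2] at h3
  subst h3
  have h4 := type_eq_of_mem_surfConfigs hX (hφ i) v w hvw he
  have h5 : X ((unionGraph h₀.tri).src ⟨i, ⟨_, he⟩⟩) = v.1 := by
    rw [hφ]
    have : (⟨(Quot.out s(((φ i).iso v).1, ((φ i).iso w).1)).1, _, he, Sym2.out_fst_mem _⟩ :
        (h₀.tri i).verts) = (φ i).iso v := Subtype.ext h1
    rw [this, RelIso.symm_apply_apply]
  change (h₀.tri i).sign (Quot.out s(((φ i).iso v).1, ((φ i).iso w).1)).1 * coord _ (X _) = _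
  rw [h5, h4, h1, height_eq hvw (v := v.1) (by simp), ← (φ i).fn_coe, (φ i).sign_fn hn v.2]

/-- Isomorphisms of structure graphs do not record the types of the edges. The flow set is therefore
split according to the finitely many type assignments `τ`; for each of them the flow is a measurable
function of the positions. -/
theorem flowSet_eq (hn : n ≠ 0) (h₀ : SurfHoneycomb T n) (γ : Fin p → Fin n → ℝ) :
    h₀.flowSet γ = ⋃ τ, h₀.configFlow τ '' h₀.surfConfigs γ τ := by
  refine Set.ext fun (ω : (unionGraph h₀.tri).Flow) => Iff.trans ?_ Set.mem_iUnion.symm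
  constructor
  · intro hω
    obtain ⟨h, φ, hb, rfl⟩ := mem_flowSet_iff.1 hω
    let X : (Σ i, (h₀.tri i).verts) → ℂ := fun x => ((φ x.1).iso.symm x.2).1
    have hXb : ∀ i j k, X (bpt h₀.tri i j k) = (h.tri i).bvert j k := by
      intro i j k
      change ((φ i).iso.symm ⟨_, _⟩).1 = _
      rw [← (φ i).symm.fn_bvert j k]
      exact ((φ i).symm.fn_coe ⟨_, _⟩).symm
    let τ : (Σ i, {e // e ∈ (h₀.tri i).edges}) → Fin 3 :=
      fun e => (h.tri e.1).typ (e.2.1.map (φ e.1).symm.fn)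
    have hX : X ∈ h₀.surfConfigs γ τ := by
      refine ⟨fun i => ⟨h.tri i, φ i, fun v => rfl⟩, ?_, ?_, ?_⟩
      · intro i j i' j' hg hne k
        rw [hXb, hXb]
        exact h.coord_partner hg hne k
      · intro r k
        rw [hXb]
        exact hasBoundary_iff.1 hb r k
      · intro i v w he
        have h1 := (φ i).symm.map_mem he
        change coord ((h.tri i).typ (s(v.1, w.1).map (φ i).symm.fn)) ((φ i).symm.iso v).1 =
          coord ((h.tri i).typ (s(v.1, w.1).map (φ i).symm.fn)) ((φ i).symm.iso w).1
        rw [Sym2.map_mk] at h1 ⊢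
        rw [← (φ i).symm.fn_coe, ← (φ i).symm.fn_coe]
        exact (coord_typ_eq h1).symm
    exact ⟨τ, X, hX, configFlow_eq hn hX φ fun i v => rfl⟩
  · rintro ⟨τ, X, hX, rfl⟩
    choose t φ hφ using hX.1
    have hXb : ∀ i j k, X (bpt h₀.tri i j k) = (t i).bvert j k := by
      intro i j k
      refine (hφ i _).trans ?_
      rw [← (φ i).symm.fn_bvert j k]
      exact ((φ i).symm.fn_coe ⟨_, _⟩).symm
    let h : SurfHoneycomb T n := ⟨t, fun i j i' j' hg hne => by
      refine sideValues_eq_image_iff.2 fun k => ?_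
      rw [← hXb, ← hXb]
      exact hX.2.1 i j i' j' hg hne k⟩
    refine mem_flowSet_iff.2 ⟨h, φ, ?_, configFlow_eq hn hX φ hφ⟩
    rw [hasBoundary_iff]
    intro r k
    change coord _ ((t _).bvert _ k) = _
    rw [← hXb]
    exact hX.2.2.1 r k

/-- The flow gives the height of each edge. At an interior vertex the three heights are the three
coordinates; at a boundary vertex the coordinate vanishing on the side and the height of the only
edge suffice. -/
theorem injOn_configFlow (h₀ : SurfHoneycomb T n) (γ : Fin p → Fin n → ℝ)
    (τ : (Σ i, {e // e ∈ (h₀.tri i).edges}) → Fin 3) :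
    Set.InjOn (h₀.configFlow τ) (h₀.surfConfigs γ τ) := by
  intro X hX X' hX' heq
  have h1 : ∀ (i : Fin N) (v w : (h₀.tri i).verts) (he : s(v.1, w.1) ∈ (h₀.tri i).edges),
      coord (τ ⟨i, ⟨_, he⟩⟩) (X ⟨i, v⟩) = coord (τ ⟨i, ⟨_, he⟩⟩) (X' ⟨i, v⟩) := by
    intro i v w he
    have h2 : (h₀.tri i).sign (Quot.out s(v.1, w.1)).1 * coord (τ ⟨i, ⟨_, he⟩⟩)
        (X ((unionGraph h₀.tri).src ⟨i, ⟨_, he⟩⟩)) = (h₀.tri i).sign (Quot.out s(v.1, w.1)).1 *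
          coord (τ ⟨i, ⟨_, he⟩⟩) (X' ((unionGraph h₀.tri).src ⟨i, ⟨_, he⟩⟩)) :=
      congrFun (congrArg WithLp.ofLp heq) ⟨i, ⟨_, he⟩⟩
    have h3 : (h₀.tri i).sign (Quot.out s(v.1, w.1)).1 ≠ 0 := by
      rcases (h₀.tri i).sign_eq_or (Quot.out s(v.1, w.1)).1 with h | h <;> rw [h] <;> norm_num
    have h4 := mul_left_cancel₀ h3 h2
    have h5 : (unionGraph h₀.tri).src ⟨i, ⟨_, he⟩⟩ = ⟨i, v⟩ ∨
        (unionGraph h₀.tri).src ⟨i, ⟨_, he⟩⟩ = ⟨i, w⟩ := by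
      rcases Sym2.eq_iff.1 (out_eq s(v.1, w.1)) with ⟨h6, -⟩ | ⟨h6, -⟩
      · exact Or.inl (Sigma.ext rfl (heq_of_eq (Subtype.ext h6)))
      · exact Or.inr (Sigma.ext rfl (heq_of_eq (Subtype.ext h6)))
    rcases h5 with h5 | h5
    · rwa [h5] at h4
    · rw [h5] at h4
      rw [hX.2.2.2 i v w he, hX'.2.2.2 i v w he, h4]
  ext ⟨i, x⟩
  obtain ⟨h, φ, hφ⟩ := hX.1 i
  obtain ⟨h', φ', hφ'⟩ := hX'.1 i
  obtain ⟨v, rfl⟩ := φ.iso.surjective x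
  have h2 : ∀ w : ℂ, ∀ he : s(v.1, w) ∈ h.edges,
      coord (h.typ s(v.1, w)) (X ⟨i, φ.iso v⟩) = coord (h.typ s(v.1, w)) (X' ⟨i, φ.iso v⟩) := by
    intro w he
    have he' : s((φ.iso v).1, (φ.iso ⟨w, mem_verts_right he⟩).1) ∈ (h₀.tri i).edges :=
      φ.iso.map_rel_iff.2 he
    have h3 := h1 i _ _ he'
    rwa [type_eq_of_mem_surfConfigs hX hφ v ⟨w, mem_verts_right he⟩ he he'] at h3
  by_cases hv : ∃ j, v.1 ∈ side j
  · obtain ⟨j, hj⟩ := hv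
    obtain ⟨w, he⟩ := exists_edge v.2
    have h3 : X ⟨i, φ.iso v⟩ ∈ side j := by
      have := hφ (φ.iso v)
      dsimp only at this
      rw [RelIso.symm_apply_apply] at this
      rw [this]
      exact hj
    have h4 : X' ⟨i, φ.iso v⟩ ∈ side j := by
      have := hφ' (φ.iso v)
      dsimp only at this
      rw [this]
      exact (φ'.symm.side_iff j _).2 ((φ.side_iff j v).2 hj)
    refine coord_ext j (h.typ s(v.1, w)) ?_ (h3.2.trans h4.2.symm) (h2 w he)
    rcases side_spec hj he with ⟨-, h5, -⟩ | ⟨-, h5, -⟩ <;> rw [h5] <;> fin_cases j <;> decide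
  · have hd := degree_eq_three v.2 fun j hj => hv ⟨j, hj⟩
    have h3 : ∀ l, coord l (X ⟨i, φ.iso v⟩) = coord l (X' ⟨i, φ.iso v⟩) := by
      intro l
      obtain ⟨e, ⟨he, hve⟩, hl⟩ := exists_star_typ hd l
      obtain ⟨w, rfl⟩ := Sym2.mem_iff_exists.1 hve
      rw [← hl]
      exact h2 w he
    exact coord_ext 0 1 (by decide) (h3 0) (h3 1)

/-- Images of Borel sets under injective measurable maps are Borel, by the Lusin–Souslin theorem. -/
theorem measurableSet_flowSet (hn : n ≠ 0) (h₀ : SurfHoneycomb T n) (γ : Fin p → Fin n → ℝ) :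
    MeasurableSet (h₀.flowSet γ) := by
  rw [flowSet_eq hn]
  exact MeasurableSet.iUnion fun τ => (measurableSet_surfConfigs h₀ γ τ).image_of_measurable_injOn
    (measurable_configFlow h₀ τ) (injOn_configFlow h₀ γ τ)

end SurfHoneycomb

end Honey

end

/-! ### Cutting along the glued side -/

noncomputable section

namespace Honey

open MeasureTheory TriHoneycomb

/-- The only edge at a boundary vertex determines the divergence there. -/
theorem div_bpt {N n : ℕ} (t : Fin N → TriHoneycomb n) (i : Fin N) (j : Fin 3) (k : Fin n)
    (ω : (unionGraph t).Flow) :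
    (unionGraph t).div ω (bpt t i j k) =
      (open Classical in if (Quot.out ((t i).bedge ((t i).bvert j k))).1 = (t i).bvert j k
        then (1 : ℝ) else -1) *
      ω ⟨i, ⟨(t i).bedge ((t i).bvert j k), (bedge_mem ((t i).bvert_mem j k)).1⟩⟩ := by
  classical
  set P := (t i).bvert j k with hP
  have hb := bedge_mem ((t i).bvert_mem j k)
  rw [← hP] at hb
  have hsrc : ∀ (e : {e // e ∈ (t i).edges}),
      (unionGraph t).src ⟨i, e⟩ = bpt t i j k ↔ (Quot.out e.1).1 = P := by
    intro e
    rw [Sigma.ext_iff]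
    simp [bpt, Subtype.ext_iff, hP]
  have htgt : ∀ (e : {e // e ∈ (t i).edges}),
      (unionGraph t).tgt ⟨i, e⟩ = bpt t i j k ↔ (Quot.out e.1).2 = P := by
    intro e
    rw [Sigma.ext_iff]
    simp [bpt, Subtype.ext_iff, hP]
  rw [FinGraph.div_apply, Finset.sum_eq_single ⟨i, ⟨(t i).bedge P, hb.1⟩⟩]
  · have h1 := out_eq ((t i).bedge P)
    have h2 : P = (Quot.out ((t i).bedge P)).1 ∨ P = (Quot.out ((t i).bedge P)).2 := by
      have := hb.2
      rw [← h1] at this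
      exact Sym2.mem_iff.1 this
    have h3 : (Quot.out ((t i).bedge P)).1 ≠ (Quot.out ((t i).bedge P)).2 := by
      have := hb.1
      rw [← h1] at this
      exact ne_of_edge this
    by_cases h4 : (Quot.out ((t i).bedge P)).1 = P
    · rw [if_pos ((hsrc _).2 h4), if_neg fun h => h3 (h4.trans ((htgt _).1 h).symm), if_pos h4]
      ring
    · rw [if_neg fun h => h4 ((hsrc _).1 h),
        if_pos ((htgt _).2 (h2.resolve_left fun h => h4 h.symm).symm), if_neg h4]
      ring
  · rintro ⟨i', e⟩ _ hne
    have key : ∀ x : (t i').verts, x.1 ∈ e.1 → (⟨i', x⟩ : Σ i, (t i).verts) ≠ bpt t i j k := by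
      intro x hx heq
      obtain ⟨rfl, h1⟩ := Sigma.ext_iff.1 heq
      have h2 : x.1 = P := congrArg Subtype.val (eq_of_heq h1)
      rw [h2] at hx
      refine hne (Sigma.ext rfl (heq_of_eq (Subtype.ext ?_)))
      exact edge_unique ((t i').bvert_mem_side j k) ⟨e.2, hx⟩ hb
    have hs : (unionGraph t).src ⟨i', e⟩ ≠ bpt t i j k := key ⟨_, _⟩ (Sym2.out_fst_mem _)
    have ht : (unionGraph t).tgt ⟨i', e⟩ ≠ bpt t i j k := key ⟨_, _⟩ (Sym2.out_snd_mem _)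
    rw [if_neg hs, if_neg ht, sub_zero]
  · simp

/-- An edge shared by two boundary vertices of one side would lie in that side. -/
theorem bedge_bvert_injective {n : ℕ} (h : TriHoneycomb n) (j : Fin 3) :
    Function.Injective fun k => h.bedge (h.bvert j k) := by
  intro k l hkl
  by_contra hne
  have h1 := bedge_mem (h.bvert_mem j k)
  have h2 := bedge_mem (h.bvert_mem j l)
  dsimp only at hkl
  rw [← hkl] at h2
  have h3 : h.bedge (h.bvert j k) = s(h.bvert j k, h.bvert j l) :=
    (Sym2.mem_and_mem_iff fun heq => hne (h.bvert_injective j heq)).1 ⟨h1.2, h2.2⟩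
  have h4 := h1.1
  rw [h3] at h4
  exact not_mem_side_of_edge h4 (h.bvert_mem_side j k) (h.bvert_mem_side j l)

namespace Surface

variable {N q : ℕ} (T : Surface N (q + 2))

theorem bdry_ne : T.bdry (Fin.last (q + 1)) ≠ T.bdry (Fin.last q).castSucc := fun h =>
  (Fin.castSucc_lt_last (Fin.last q)).ne' (T.bdry_injective h)

theorem glue_bdry {p : ℕ} (T : Surface N p) (r : Fin p) : T.glue (T.bdry r) = T.bdry r :=
  (T.mem_range_bdry _).1 ⟨r, rfl⟩

theorem glueLastTwo_first :
    T.glueLastTwo.glue (T.bdry (Fin.last q).castSucc) = T.bdry (Fin.last (q + 1)) := if_pos rfl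

theorem glueLastTwo_second :
    T.glueLastTwo.glue (T.bdry (Fin.last (q + 1))) = T.bdry (Fin.last q).castSucc :=
  (if_neg T.bdry_ne).trans (if_pos rfl)

theorem glueLastTwo_of_ne {x : Fin N × Fin 3} (hx : T.glue x ≠ x) :
    T.glueLastTwo.glue x = T.glue x := by
  refine (if_neg ?_).trans (if_neg ?_)
  · rintro rfl
    exact hx (T.glue_bdry _)
  · rintro rfl
    exact hx (T.glue_bdry _)

theorem glueLastTwo_cases {x y : Fin N × Fin 3} (hxy : T.glueLastTwo.glue x = y) :
    (T.glue x = y) ∨ (x = T.bdry (Fin.last q).castSucc ∧ y = T.bdry (Fin.last (q + 1))) ∨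
      (x = T.bdry (Fin.last (q + 1)) ∧ y = T.bdry (Fin.last q).castSucc) := by
  change (if _ then _ else if _ then _ else _) = _ at hxy
  split_ifs at hxy with h1 h2
  · exact Or.inr (Or.inl ⟨h1, hxy.symm⟩)
  · exact Or.inr (Or.inr ⟨h2, hxy.symm⟩)
  · exact Or.inl hxy

end Surface

namespace SurfHoneycomb

variable {N q n : ℕ} {T : Surface N (q + 2)}

/-- The boundary conditions with two more sides. -/
def extend (γ : Fin q → Fin n → ℝ) (u : Fin n → ℝ) : Fin (q + 2) → Fin n → ℝ :=
  Fin.snoc (α := fun _ => Fin n → ℝ) (Fin.snoc (α := fun _ => Fin n → ℝ) γ u) (tilde u)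

theorem forall_extend {γ : Fin q → Fin n → ℝ} {u : Fin n → ℝ}
    {P : Fin (q + 2) → (Fin n → ℝ) → Prop} : (∀ r, P r (extend γ u r)) ↔
      (∀ r : Fin q, P r.castSucc.castSucc (γ r)) ∧ P (Fin.last q).castSucc u ∧
        P (Fin.last (q + 1)) (tilde u) := by
  rw [Fin.forall_fin_succ', Fin.forall_fin_succ', and_assoc]
  simp [extend]

theorem hasBoundary_extend_iff {h : SurfHoneycomb T n} {γ : Fin q → Fin n → ℝ} {u : Fin n → ℝ} :
    h.HasBoundary (extend γ u) ↔
      (∀ (r : Fin q) k, coord ((T.bdry r.castSucc.castSucc).2 + 1)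
        ((h.tri (T.bdry r.castSucc.castSucc).1).bvert (T.bdry r.castSucc.castSucc).2 k) = γ r k) ∧
      (∀ k, coord ((T.bdry (Fin.last q).castSucc).2 + 1)
        ((h.tri (T.bdry (Fin.last q).castSucc).1).bvert (T.bdry (Fin.last q).castSucc).2 k) =
          u k) ∧
      ∀ k, coord ((T.bdry (Fin.last (q + 1))).2 + 1)
        ((h.tri (T.bdry (Fin.last (q + 1))).1).bvert (T.bdry (Fin.last (q + 1))).2 k) =
          tilde u k :=
  hasBoundary_iff.trans (forall_extend (P := fun r x => ∀ k, coord ((T.bdry r).2 + 1)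
    ((h.tri (T.bdry r).1).bvert (T.bdry r).2 k) = x k))

/-- Cut a honeycomb along the last glued side. -/
def cut (h : SurfHoneycomb T.glueLastTwo n) : SurfHoneycomb T n where
  tri := h.tri
  compat i j i' j' hg hne := by
    refine h.compat i j i' j' ?_ hne
    rw [T.glueLastTwo_of_ne (by rwa [hg]), hg]

/-- Glue a honeycomb along the last two sides. -/
theorem exists_cut_eq {h : SurfHoneycomb T n} {γ : Fin q → Fin n → ℝ} {u : Fin n → ℝ}
    (hb : h.HasBoundary (extend γ u)) : ∃ h' : SurfHoneycomb T.glueLastTwo n, h'.cut = h := by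
  obtain ⟨-, h2, h3⟩ := hasBoundary_extend_iff.1 hb
  refine ⟨⟨h.tri, fun i j i' j' hg hne => ?_⟩, rfl⟩
  rcases T.glueLastTwo_cases hg with h4 | ⟨h4, h5⟩ | ⟨h4, h5⟩
  · exact h.compat i j i' j' h4 hne
  · rw [sideValues_eq_image_iff]
    intro k
    rw [← h4] at h2
    rw [← h5] at h3
    rw [h2, h3, tilde]
  · rw [sideValues_eq_image_iff]
    intro k
    rw [← h5] at h2
    rw [← h4] at h3
    rw [h2, h3, tilde, Fin.rev_rev]
    ring

variable (h : SurfHoneycomb T.glueLastTwo n)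

/-- The boundary vertices on the first of the two sides that are glued. -/
def firstPt (k : Fin n) : Σ i, (h.tri i).verts :=
  bpt h.tri (T.bdry (Fin.last q).castSucc).1 (T.bdry (Fin.last q).castSucc).2 k

/-- The boundary vertices on the second of the two sides that are glued. -/
def secondPt (k : Fin n) : Σ i, (h.tri i).verts :=
  bpt h.tri (T.bdry (Fin.last (q + 1))).1 (T.bdry (Fin.last (q + 1))).2 k.rev

/-- Regluing only adds the matching of the `k`-th point of the first side with the `k.rev`-th point
of the second, the order being reversed by the orientation. -/
theorem vertRel_cut {x y : Σ i, (h.tri i).verts} : h.VertRel x y ↔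
    h.cut.VertRel x y ∨ (∃ k, x = h.firstPt k ∧ y = h.secondPt k) ∨
      ∃ k, x = h.secondPt k ∧ y = h.firstPt k := by
  rw [vertRel_iff]
  refine Iff.trans ?_ (or_congr_left (vertRel_iff (h := h.cut))).symm
  constructor
  · rintro ⟨i, j, i', j', k, hg, hne, rfl, rfl⟩
    rcases T.glueLastTwo_cases hg with h4 | ⟨h4, h5⟩ | ⟨h4, h5⟩
    · exact Or.inl ⟨i, j, i', j', k, h4, hne, rfl, rfl⟩
    · refine Or.inr (Or.inl ⟨k, ?_, ?_⟩)
      · rw [firstPt, ← h4]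
      · rw [secondPt, ← h5]
    · refine Or.inr (Or.inr ⟨k.rev, ?_, ?_⟩)
      · rw [secondPt, ← h4, Fin.rev_rev]
      · rw [firstPt, ← h5]
  · rintro (⟨i, j, i', j', k, hg, hne, rfl, rfl⟩ | ⟨k, rfl, rfl⟩ | ⟨k, rfl, rfl⟩)
    · exact ⟨i, j, i', j', k, by rw [T.glueLastTwo_of_ne (by rwa [hg]), hg], hne, rfl, rfl⟩
    · exact ⟨_, _, _, _, k, T.glueLastTwo_first, T.bdry_ne, rfl, rfl⟩
    · refine ⟨_, _, _, _, k.rev, T.glueLastTwo_second, T.bdry_ne.symm, rfl, ?_⟩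
      rw [Fin.rev_rev]
      rfl

theorem not_vertRel_bdry {p : ℕ} {S : Surface N p} {h : SurfHoneycomb S n} {r : Fin p} {k : Fin n}
    {y : Σ i, (h.tri i).verts} : ¬ h.VertRel (bpt h.tri (S.bdry r).1 (S.bdry r).2 k) y := by
  rw [vertRel_iff]
  rintro ⟨i, j, i', j', l, hg, hne, h1, -⟩
  obtain ⟨h2, h3, -⟩ := bpt_inj h1
  have h4 : (i, j) = S.bdry r := by rw [← h2, ← h3]
  rw [h4, S.glue_bdry] at hg
  exact hne (by rw [← hg, h4])

theorem not_vertRel_firstPt {k : Fin n} {y : Σ i, (h.tri i).verts} :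
    ¬ h.cut.VertRel (h.firstPt k) y := not_vertRel_bdry (h := h.cut)

theorem firstPt_ne_secondPt (k l : Fin n) : h.firstPt k ≠ h.secondPt l := by
  intro heq
  obtain ⟨h1, h2, -⟩ := bpt_inj heq
  exact T.bdry_ne.symm (Prod.ext h1 h2)

theorem mk_eq_firstPt {k : Fin n} {x : Σ i, (h.tri i).verts}
    (hx : Quot.mk h.cut.VertRel x = Quot.mk h.cut.VertRel (h.firstPt k)) : x = h.firstPt k := by
  rcases quot_mk_eq_iff.1 hx.symm with h1 | h1
  · exact h1.symm
  · exact absurd h1 h.not_vertRel_firstPt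

/-- The map that merges the boundary vertices of the last two sides. -/
def mergeMap : h.cut.structGraph.V → h.structGraph.V :=
  Quot.lift (Quot.mk h.VertRel) fun _ _ hxy => Quot.sound (h.vertRel_cut.2 (Or.inl hxy))

/-- The divergence at the boundary vertices of the first side. -/
theorem div_firstPt (ω : h.cut.structGraph.Flow) (k : Fin n) :
    h.cut.structGraph.div ω (Quot.mk _ (h.firstPt k)) =
      (unionGraph h.tri).div ω (h.firstPt k) := by
  classical
  have := Fintype.ofFinite (unionGraph h.tri).V
  refine (FinGraph.div_quot (G := unionGraph h.tri) (Quot.mk h.cut.VertRel) ω _).trans ?_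
  rw [Finset.sum_eq_single (h.firstPt k)]
  · exact if_pos rfl
  · intro x _ hx
    exact if_neg fun heq => hx (h.mk_eq_firstPt heq)
  · simp

/-- The merging of the boundary vertices of the last two sides. -/
def leafMerging : FinGraph.LeafMerging h.cut.structGraph h.mergeMap n where
  v k := Quot.mk _ (h.firstPt k)
  w k := Quot.mk _ (h.secondPt k)
  e k := ⟨(T.bdry (Fin.last q).castSucc).1, ⟨_, (bedge_mem ((h.tri _).bvert_mem
    (T.bdry (Fin.last q).castSucc).2 k)).1⟩⟩
  σ k := open Classical in if (Quot.out ((h.tri (T.bdry (Fin.last q).castSucc).1).bedge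
    ((h.tri (T.bdry (Fin.last q).castSucc).1).bvert (T.bdry (Fin.last q).castSucc).2 k))).1 =
      (h.tri (T.bdry (Fin.last q).castSucc).1).bvert (T.bdry (Fin.last q).castSucc).2 k
    then 1 else -1
  v_injective k l hkl := (bpt_inj (h.mk_eq_firstPt hkl)).2.2
  e_injective k l hkl := bedge_bvert_injective _ _
    (congrArg Subtype.val (eq_of_heq (Sigma.ext_iff.1 hkl).2))
  w_notMem k l hkl := h.firstPt_ne_secondPt l k (h.mk_eq_firstPt hkl).symm
  surjective := by
    rintro ⟨x⟩
    exact ⟨Quot.mk _ x, rfl⟩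
  merge := by
    rintro ⟨x⟩ ⟨y⟩
    have hpair : ∀ k, h.mergeMap (Quot.mk _ (h.firstPt k)) = h.mergeMap (Quot.mk _ (h.secondPt k)) :=
      fun k => Quot.sound (h.vertRel_cut.2 (Or.inr (Or.inl ⟨k, rfl, rfl⟩)))
    constructor
    · intro hxy
      rcases quot_mk_eq_iff.1 hxy with rfl | h1
      · exact Or.inl rfl
      · rcases h.vertRel_cut.1 h1 with h2 | ⟨k, rfl, rfl⟩ | ⟨k, rfl, rfl⟩
        · exact Or.inl (Quot.sound h2)
        · exact Or.inr (Or.inl ⟨k, rfl, rfl⟩)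
        · exact Or.inr (Or.inr ⟨k, rfl, rfl⟩)
    · rintro (h1 | ⟨k, h1, h2⟩ | ⟨k, h1, h2⟩)
      · rw [h1]
      · rw [h1, h2, hpair]
      · rw [h1, h2, hpair]
  sq_eq k := by
    split_ifs
    · exact Or.inl rfl
    · exact Or.inr rfl
  div_leaf k ω := (h.div_firstPt ω k).trans (div_bpt h.tri _ _ k ω)

/-- The colours of the cut edges. -/
def firstColor (k : Fin n) : ℝ :=
  (h.tri (T.bdry (Fin.last q).castSucc).1).col ((h.tri (T.bdry (Fin.last q).castSucc).1).bedge
    ((h.tri (T.bdry (Fin.last q).castSucc).1).bvert (T.bdry (Fin.last q).castSucc).2 k))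

/-- The flows on the cut surface are the flows with given values on the cut edges. -/
theorem flowSet_cut (γ : Fin q → Fin n → ℝ) (u : Fin n → ℝ) :
    h.cut.flowSet (extend γ u) = {ω | ω ∈ h.flowSet γ ∧
      ∀ k, h.cut.structGraph.div ω (h.leafMerging.v k) =
        h.firstColor k - u k} := by
  have hdiv : ∀ (t : Fin N → TriHoneycomb n) (φ : ∀ i, (t i).StructIso (h.tri i)) (k : Fin n),
      h.cut.structGraph.div ((unionIso φ).flow (unionFlow t)) (h.leafMerging.v k) =
        h.firstColor k - coord ((T.bdry (Fin.last q).castSucc).2 + 1)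
            ((t (T.bdry (Fin.last q).castSucc).1).bvert (T.bdry (Fin.last q).castSucc).2 k) :=
    fun t φ k => (h.div_firstPt _ k).trans (div_unionIso_flow_bpt φ _ _ k)
  refine Set.ext fun (ω : (unionGraph h.tri).Flow) => ?_
  constructor
  · intro hω
    obtain ⟨h₁, φ, hb, rfl⟩ := mem_flowSet_iff.1 hω
    obtain ⟨h₁, rfl⟩ := exists_cut_eq hb
    obtain ⟨h2, h3, h4⟩ := hasBoundary_extend_iff.1 hb
    refine ⟨mem_flowSet_iff.2 ⟨h₁, φ, hasBoundary_iff.2 h2, rfl⟩, fun k => ?_⟩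
    rw [← h3 k]
    exact hdiv _ φ k
  · rintro ⟨hω, hk⟩
    obtain ⟨h₁, φ, hb, rfl⟩ := mem_flowSet_iff.1 hω
    -- The divergences at the leaves give back the boundary tuple `u` on the first side;
    -- compatibility with the gluing then forces `tilde u` on the second.
    refine mem_flowSet_iff.2 ⟨h₁.cut, φ, ?_, rfl⟩
    have h3 : ∀ k, coord ((T.bdry (Fin.last q).castSucc).2 + 1)
        ((h₁.tri (T.bdry (Fin.last q).castSucc).1).bvert (T.bdry (Fin.last q).castSucc).2 k) =
          u k := fun k => sub_right_injective ((hdiv _ φ k).symm.trans (hk k))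
    refine hasBoundary_extend_iff.2 ⟨hasBoundary_iff.1 hb, h3, fun k => ?_⟩
    rw [tilde, ← h3]
    exact h₁.coord_partner T.glueLastTwo_first T.bdry_ne k

theorem mem_flowSet_cut {γ : Fin q → Fin n → ℝ} {u : Fin n → ℝ} {ω : h.cut.structGraph.Flow} :
    ω ∈ h.cut.flowSet (extend γ u) ↔ ω ∈ h.flowSet γ ∧
      ∀ k, h.cut.structGraph.div ω (h.leafMerging.v k) = h.firstColor k - u k := by
  rw [flowSet_cut]
  rfl

/-- The volume of the flows on the glued surface is the integral of the volumes on the cut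
surface. -/
theorem volOf_cut (hT : T.IsConnected) (hn : n ≠ 0) (γ : Fin q → Fin n → ℝ) :
    Measurable (fun u => h.cut.structGraph.volOf (h.cut.flowSet (extend γ u))) ∧
      h.structGraph.volOf (h.flowSet γ) =
        ∫⁻ u, h.cut.structGraph.volOf (h.cut.flowSet (extend γ u)) := by
  rcases (h.flowSet γ).eq_empty_or_nonempty with he | ⟨ω₀, hω₀⟩
  · have h1 : ∀ u, h.cut.flowSet (extend γ u) = ∅ := by
      intro u
      refine Set.eq_empty_iff_forall_notMem.2 fun ω hω => ?_
      have h2 := (h.mem_flowSet_cut.1 hω).1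
      rw [he] at h2
      exact h2
    simp only [h1, he, FinGraph.volOf_empty, lintegral_zero]
    exact ⟨measurable_const, trivial⟩
  · obtain ⟨F, hF, hint, hzero, hval⟩ := h.leafMerging.exists_disintegration
      (structGraph_isConn hT hn h.cut) (measurableSet_flowSet hn h γ) ω₀
      h.firstColor
    -- When the slice is empty, `volOf` takes its default value 0, and so does the density `F`.
    -- Otherwise any element of the slice serves as base point.
    have hFu : (fun u => h.cut.structGraph.volOf (h.cut.flowSet (extend γ u))) = F := by
      ext u
      rcases (h.cut.flowSet (extend γ u)).eq_empty_or_nonempty with h1 | ⟨ω₁, hω₁⟩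
      · rw [h1, FinGraph.volOf_empty]
        refine (hzero u fun ω hω _ hk => ?_).symm
        exact Set.eq_empty_iff_forall_notMem.1 h1 ω (h.mem_flowSet_cut.2 ⟨hω, hk⟩)
      · rw [FinGraph.volOf_eq hω₁ fun ω hω => div_eq_of_mem_flowSet hn hω hω₁]
        have h2 := h.mem_flowSet_cut.1 hω₁
        rw [hval u ω₁ (div_eq_of_mem_flowSet hn h2.1 hω₀) h2.2, flowSet_cut]
        rfl
    rw [hFu]
    refine ⟨hF, ?_⟩
    rw [← hint]
    exact FinGraph.volOf_eq hω₀ fun ω hω => div_eq_of_mem_flowSet hn hω hω₀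

end SurfHoneycomb

end Honey

end

/-! ### Summation over structure graphs -/

noncomputable section

namespace Honey

open MeasureTheory

namespace TriHoneycomb

variable {n : ℕ}

/-- The colour of the edge between two vertices, if any; the boundary vertices and their order. -/
abbrev StructData (m : ℕ) : Type :=
  (Fin m → Fin m → Option ℕ) × (Fin m → Fin 3 → Prop) × (Fin m → Fin m → Fin 3 → Prop)

open Classical in
/-- The structure graph of a honeycomb with numbered vertices. -/
def structData (h : TriHoneycomb n) {m : ℕ} (ε : Fin m ≃ h.verts) : StructData m :=
  (fun a b => if hab : s((ε a).1, (ε b).1) ∈ h.edges then some (h.color ⟨_, hab⟩) else none,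
    fun a j => (ε a).1 ∈ side j, fun a b j => coord (j + 1) (ε a).1 < coord (j + 1) (ε b).1)

theorem nonempty_structIso {h h' : TriHoneycomb n} {m : ℕ} (ε : Fin m ≃ h.verts)
    (ε' : Fin m ≃ h'.verts) (heq : h.structData ε = h'.structData ε') :
    Nonempty (StructIso h h') := by
  have h1 : ∀ v w : h.verts, (h.structData ε).1 (ε.symm v) (ε.symm w) =
      (h'.structData ε').1 (ε.symm v) (ε.symm w) := fun v w => by rw [heq]
  have h2 : ∀ v : h.verts, ∀ j, (h.structData ε).2.1 (ε.symm v) j =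
      (h'.structData ε').2.1 (ε.symm v) j := fun v j => by rw [heq]
  have h3 : ∀ v w : h.verts, ∀ j, (h.structData ε).2.2 (ε.symm v) (ε.symm w) j =
      (h'.structData ε').2.2 (ε.symm v) (ε.symm w) j := fun v w j => by rw [heq]
  simp only [structData, Equiv.apply_symm_apply] at h1 h2 h3
  refine ⟨⟨⟨ε.symm.trans ε', ?_⟩, ?_, ?_, ?_⟩⟩
  · intro v w
    have h4 := h1 v w
    change s((ε' (ε.symm v)).1, (ε' (ε.symm w)).1) ∈ h'.edges ↔ s(v.1, w.1) ∈ h.edges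
    split_ifs at h4 with h5 h6 h6
    · exact iff_of_true h6 h5
    · exact iff_of_false h6 h5
  · intro v w hvw hvw'
    have h4 := h1 v w
    have h5 : s((ε' (ε.symm v)).1, (ε' (ε.symm w)).1) ∈ h'.edges := hvw'
    rw [dif_pos hvw, dif_pos h5] at h4
    exact (Option.some_injective _ h4).symm
  · intro j v
    exact (iff_of_eq (h2 v j)).symm
  · intro j v w _ _
    exact (iff_of_eq (h3 v w j)).symm

/-- Numbering the vertices encodes a structure graph by a finite table with entries in a countable
type, so there are countably many isomorphism classes. -/
theorem exists_code (n : ℕ) : ∃ c : TriHoneycomb n → Σ m, StructData m,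
    ∀ h h', c h = c h' → Nonempty (StructIso h h') := by
  have h1 : ∀ h : TriHoneycomb n, ∃ x : Σ m, StructData m,
      ∃ ε : Fin x.1 ≃ h.verts, h.structData ε = x.2 := by
    intro h
    exact ⟨⟨_, h.structData (Finite.equivFin h.verts).symm⟩, (Finite.equivFin h.verts).symm, rfl⟩
  choose c ε hε using h1
  refine ⟨c, fun h h' heq => ?_⟩
  have key : ∀ x, c h = x → c h' = x → Nonempty (StructIso h h') := by
    rintro x hx hx'
    obtain ⟨ε₁, h1⟩ : ∃ ε : Fin x.1 ≃ h.verts, h.structData ε = x.2 := hx ▸ ⟨ε h, hε h⟩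
    obtain ⟨ε₂, h2⟩ : ∃ ε : Fin x.1 ≃ h'.verts, h'.structData ε = x.2 := hx' ▸ ⟨ε h', hε h'⟩
    exact nonempty_structIso ε₁ ε₂ (h1.trans h2.symm)
  exact key _ heq rfl

end TriHoneycomb

instance countable_graphClass {N p : ℕ} (T : Surface N p) (n : ℕ) : Countable (GraphClass T n) := by
  obtain ⟨c, hc⟩ := TriHoneycomb.exists_code n
  refine Function.Injective.countable
    (f := fun (G : GraphClass T n) (i : Fin N) => c (G.out.tri i)) fun G G' heq => ?_
  rw [← G.out_eq, ← G'.out_eq]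
  exact Quotient.sound ⟨fun i => (hc _ _ (congrFun heq i)).some⟩

theorem measurableSet_Hreg (n : ℕ) : MeasurableSet (Hreg n) := by
  simp only [Hreg, StrictAnti, Set.ofPred_and, Set.ofPred_forall]
  refine MeasurableSet.inter ?_ ?_
  · exact MeasurableSet.iInter fun a => MeasurableSet.iInter fun b => MeasurableSet.iInter fun _ =>
      measurableSet_lt (measurable_pi_apply b) (measurable_pi_apply a)
  · exact MeasurableSet.iInter fun i => MeasurableSet.inter
      (measurableSet_le measurable_const (measurable_pi_apply i))
      (measurableSet_lt (measurable_pi_apply i) measurable_const)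

namespace SurfHoneycomb

variable {N q n : ℕ} {T : Surface N (q + 2)}

/-- Boundary coordinates of an actual honeycomb are strictly decreasing and lie in (0, 1). This
allows integrating over all of ℝⁿ before restricting to `Hreg n`. -/
theorem volOf_cut_of_notMem (h : SurfHoneycomb T.glueLastTwo n) {γ : Fin q → Fin n → ℝ}
    {u : Fin n → ℝ} (hu : u ∉ Hreg n) :
    h.cut.structGraph.volOf (h.cut.flowSet (extend γ u)) = 0 := by
  have h1 : h.cut.flowSet (extend γ u) = ∅ := by
    refine Set.eq_empty_iff_forall_notMem.2 fun ω hω => hu ?_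
    obtain ⟨h₁, -, hb, -⟩ := hω
    obtain ⟨-, h2, -⟩ := hasBoundary_extend_iff.1 hb
    have h3 := (h₁.tri (T.bdry (Fin.last q).castSucc).1).bvert_strictAnti
      (T.bdry (Fin.last q).castSucc).2
    rw [funext h2] at h3
    refine ⟨h3, fun k => ?_⟩
    have h4 := (h₁.tri (T.bdry (Fin.last q).castSucc).1).coord_bvert_mem_Ioo
      (T.bdry (Fin.last q).castSucc).2 k
    rw [h2] at h4
    exact ⟨h4.1.le, h4.2⟩
  rw [h1, FinGraph.volOf_empty]

/-- The classes of the cut honeycombs. -/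
def cutClass (G : GraphClass T.glueLastTwo n) : GraphClass T n :=
  Quotient.map cut (fun _ _ hφ => hφ) G

/-- Isomorphisms are given triangle by triangle and do not involve the gluing, so the same family
works before and after cutting. -/
theorem cutClass_injective : Function.Injective (cutClass (T := T) (n := n)) := by
  rintro ⟨h⟩ ⟨h'⟩ heq
  have h1 : (⟦h.cut⟧ : GraphClass T n) = ⟦h'.cut⟧ := heq
  exact Quotient.sound (Quotient.exact h1 : h.cut ≈ h'.cut)

/-- A class on `T` with nonzero volume contains a honeycomb with boundary tuples `u` and `tilde u`
on the last two sides; this one can be glued, so its class comes from the glued surface. -/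
theorem totalVolume_extend (hn : n ≠ 0) (γ : Fin q → Fin n → ℝ) (u : Fin n → ℝ) :
    totalVolume T (extend γ u) = ∑' G : GraphClass T.glueLastTwo n,
      G.out.cut.structGraph.volOf (G.out.cut.flowSet (extend γ u)) := by
  rw [totalVolume, ← cutClass_injective.tsum_eq]
  · refine tsum_congr fun G => ?_
    have h1 : (⟦G.out.cut⟧ : GraphClass T n) = ⟦(cutClass G).out⟧ := by
      rw [Quotient.out_eq]
      conv_rhs => rw [← G.out_eq]
      rfl
    obtain ⟨φ⟩ := Quotient.exact h1
    exact volOf_flowSet_eq hn φ _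
  · intro G hG
    rw [Function.mem_support] at hG
    rcases (G.out.flowSet (extend γ u)).eq_empty_or_nonempty with h1 | ⟨ω, h₁, φ, hb, -⟩
    · rw [h1, FinGraph.volOf_empty] at hG
      exact absurd rfl hG
    · obtain ⟨h₂, rfl⟩ := exists_cut_eq hb
      refine ⟨⟦h₂⟧, ?_⟩
      rw [← G.out_eq]
      exact Quotient.sound ⟨φ⟩

/-- Cutting a surface along a side. -/
theorem totalVolume_glueLastTwo (hT : T.IsConnected) (hn : n ≠ 0) (γ : Fin q → Fin n → ℝ) :
    AEMeasurable (fun u => totalVolume T (extend γ u)) (volume.restrict (Hreg n)) ∧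
      totalVolume T.glueLastTwo γ = ∫⁻ u in Hreg n, totalVolume T (extend γ u) := by
  simp only [totalVolume_extend hn]
  have hm := fun G : GraphClass T.glueLastTwo n => (G.out.volOf_cut hT hn γ).1
  refine ⟨(AEMeasurable.tsum fun G => (hm G).aemeasurable), ?_⟩
  rw [← lintegral_indicator (measurableSet_Hreg n)]
  -- The sum already vanishes outside `Hreg n`, so the restriction can be dropped before exchanging
  -- sum and integral.
  have h1 : ∀ u, (Hreg n).indicator (fun u => ∑' G : GraphClass T.glueLastTwo n,
      G.out.cut.structGraph.volOf (G.out.cut.flowSet (extend γ u))) u =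
      ∑' G : GraphClass T.glueLastTwo n,
        G.out.cut.structGraph.volOf (G.out.cut.flowSet (extend γ u)) := by
    intro u
    by_cases hu : u ∈ Hreg n
    · exact Set.indicator_of_mem hu _
    · rw [Set.indicator_of_notMem hu]
      simp [volOf_cut_of_notMem _ hu]
  rw [lintegral_congr h1,
    lintegral_tsum fun G => (hm G).aemeasurable, totalVolume]
  exact tsum_congr fun G => (G.out.volOf_cut hT hn γ).2

end SurfHoneycomb

end Honey

end

theorem mainTheorem8 (n : ℕ) (hn : 3 ≤ n) (N q : ℕ) (T : Honey.Surface N (q + 2))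
    (hT : T.IsConnected) (γ : Fin q → Fin n → ℝ) (hγ : ∀ i, γ i ∈ Honey.Hreg n)
    (hint : ∃ m : ℤ, ∑ i, ∑ j, |γ i j| = (m : ℝ)) :
    AEMeasurable
      (fun u : Fin n → ℝ => Honey.totalVolume T
        (Fin.snoc (α := fun _ => Fin n → ℝ) (Fin.snoc (α := fun _ => Fin n → ℝ) γ u)
          (Honey.tilde u)))
      (MeasureTheory.volume.restrict (Honey.Hreg n)) ∧
    Honey.totalVolume T.glueLastTwo γ =
      ∫⁻ u in Honey.Hreg n, Honey.totalVolume T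
        (Fin.snoc (α := fun _ => Fin n → ℝ) (Fin.snoc (α := fun _ => Fin n → ℝ) γ u)
          (Honey.tilde u)) := by
  exact Honey.SurfHoneycomb.totalVolume_glueLastTwo hT (by omega) γ
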